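/- **Setting.** Fix $\Delta\ge 2$. A *locally checkable labeling problem* (LCL) is a triple $\Pi=(\Sigma,\mathcal V,\mathcal E)$ with $\Sigma$ a finite set, $\mathcal V$ a set of cardinality-$\Delta$ multisets and $\mathcal E$ a set of cardinality-$2$ multisets of elements of $\Sigma$. A labeling of the half-edges $(v,e)$, $v\in e$, of a $\Delta$-regular graph is a $\Pi$-coloring if the labels around every vertex form a multiset in $\mathcal V$ and the two labels on every edge form a multiset in $\mathcal E$. The *line-augmented* problem $\overline\Pi$ has one new label; its vertex configurations are those of $\Pi$ and all cardinality-$\Delta$ multisets that contain the new label exactly twice, and its edge configurations are those of $\Pi$ and the multiset that contains the new label twice. A *$\Delta$-regular Borel forest* is an acyclic $\Delta$-regular graph $\mathcal G$ on a standard Borel space $X$ whose edge relation is Borel in $X\times X$. $\mathsf{BOREL}$ is the class of LCLs $\Pi$ such that every $\Delta$-regular Borel forest has a $\Pi$-coloring that is a Borel function on the space of half-edges. A *one-or-two-ended spanning forest* of $\mathcal G$ is a set $\mathcal T$ of edges of $\mathcal G$ such that every connected component of $(X,\mathcal T)$ is infinite and has exactly one or exactly two ends. $\Pi^2_{\mathrm{pm}}$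 is the problem of finding a perfect matching in the graph in which distinct vertices at distance at most $2$ are joined, written as an LCL as follows. A label on the half-edge $(v,\{v,w\})$ is a pair. Its first entry says whether $v$ does not reach its partner through this half-edge, or the partner of $v$ is $w$, or the partner of $v$ is another neighbor of $w$. Its second entry is empty, or it is one of $\lfloor\Delta/2\rfloor$ colors if the partner of $w$ is another neighbor of $v$. Around each vertex exactly one half-edge leads to its partner, and each color occurs zero or two times (the two half-edges with the same color lead to two vertices matched with each other). On each edge $\{v,w\}$, the half-edge at $v$ says "my partner is $w$" iff the one at $w$ says "my partner is $v$"; and one half-edge says "my partner is behind the other endpoint" iff the other half-edge carries a color. A *finite $\Delta$-regular tree* is a finite tree of maximum degree at most $\Delta$ in which each vertex of degree $d$ has $\Delta-d$ additional virtual half-edges, which are labeled and count for the vertex constraints but have no edge constraint; the half-edges at each vertex are numbered $1,\dots,\Delta$ in an arbitrary way. $\mathsf{RLOCAL}(o(\log n))$ is the class of LCLs $\Pi$ for which there are $t(n)=o(\log n)$ and a randomized local algorithm that, on every finite $\Delta$-regular tree with $n$ vertices, each holding an independent infinite random bit string, labels the half-edges around each vertex by a measurable function of $n$ and of the isomorphism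 type of its $t(n)$-hop neighborhood, and produces a $\Pi$-coloring with probability at least $1-1/n$. **Theorem.** Let $\Delta\ge 2$. 1. Every $\Delta$-regular Borel forest $\mathcal G$ has a Borel one-or-two-ended spanning forest $\mathcal T\subseteq\mathcal G$. 2. $\overline{\Pi^2_{\mathrm{pm}}}\in\mathsf{BOREL}$. 3. If $\Delta\ge 3$, then $\overline{\Pi^2_{\mathrm{pm}}}\notin\mathsf{RLOCAL}(o(\log n))$; hence $\mathsf{BOREL}\not\subseteq\mathsf{RLOCAL}(o(\log n))$. -/

import Mathlib

open MeasureTheory Filter Asymptotics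

universe u

/-! ### Locally checkable labeling problems -/

/-- A locally checkable labeling problem on `Δ`-regular trees: a finite set of half-edge labels, the
allowed cardinality-`Δ` multisets of labels around a vertex, and the allowed cardinality-`2`
multisets of labels on an edge. -/
structure LCL (Δ : ℕ) where
  Label : Type
  finite_label : Finite Label
  vertexConfigs : Set (Sym Label Δ)
  edgeConfigs : Set (Sym2 Label)

/-- The multiset of the values of a family indexed by `Fin Δ`. -/
def configOf {Δ : ℕ} {α : Type*} (f : Fin Δ → α) : Sym α Δ :=
  ⟨(Finset.univ : Finset (Fin Δ)).val.map f, by simp⟩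

namespace LCL

/-- The line-augmented problem. The new label is `none`. The allowed vertex configurations are
those of `P` and all multisets that contain the new label exactly twice; the allowed edge
configurations are those of `P` and the one that contains the new label twice. -/
def lineAugment {Δ : ℕ} (P : LCL Δ) : LCL Δ where
  Label := Option P.Label
  finite_label := by
    have := P.finite_label
    infer_instance
  vertexConfigs :=
    {s | ∃ s₀ ∈ P.vertexConfigs, s = s₀.map some} ∪
      {s | Multiset.countP (fun a => a.isNone = true) (s : Multiset (Option P.Label)) = 2}
  edgeConfigs := {e | ∃ e₀ ∈ P.edgeConfigs, e = e₀.map some} ∪ {s(none, none)}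

end LCL

/-! ### Perfect matching in the power-2 graph -/

/-- How a vertex `v` uses one of its half-edges `(v, {v, w})` to point to its partner:
not at all, or its partner is `w`, or its partner is another neighbor of `w`. -/
inductive Pointer : Type
  | idle
  | adjacent
  | far

/-- A label on a half-edge `(v, {v, w})`. `pointer` says how `v` reaches its own partner through this
half-edge. `relay` is `some c` if the partner of `w` is another neighbor of `v`, so that `v` is the
midpoint of that pair; the color `c` tells apart the at most `Δ / 2` pairs with midpoint `v`. -/
structure HopLabel (Δ : ℕ) : Type where
  pointer : Pointer
  relay : Option (Fin (Δ / 2))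

theorem finite_hopLabel (Δ : ℕ) : Finite (HopLabel Δ) := by
  have h1 : Finite Pointer := by
    refine Finite.of_injective
      (fun p : Pointer => (match p with | .idle => 0 | .adjacent => 1 | .far => 2 : Fin 3)) ?_
    intro a b h
    cases a <;> cases b <;> simp_all
  refine Finite.of_injective (fun a : HopLabel Δ => (a.pointer, a.relay)) ?_
  rintro ⟨a, b⟩ ⟨c, d⟩ h
  simp_all

/-- The two labels on the half-edges of an edge `{v, w}` are consistent: `v` has partner `w` iff `w`
has partner `v`, and one endpoint looks for its partner behind the other endpoint iff the other
endpoint relays it. -/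
def HopLabel.Compatible {Δ : ℕ} (a b : HopLabel Δ) : Prop :=
  (a.pointer = Pointer.adjacent ↔ b.pointer = Pointer.adjacent) ∧
  (a.pointer = Pointer.far ↔ b.relay ≠ none) ∧
  (b.pointer = Pointer.far ↔ a.relay ≠ none)

open Classical in
/-- The perfect matching problem in the power-2 graph (distinct vertices at distance at most `2` are
joined). Each vertex has exactly one partner, hence exactly one half-edge that points to it; and
each color of relayed half-edges around a vertex is either unused or used by exactly two half-edges,
whose other endpoints are partners of each other. -/
noncomputable def hopMatching (Δ : ℕ) : LCL Δ where
  Label := HopLabel Δ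
  finite_label := finite_hopLabel Δ
  vertexConfigs := {s |
    Multiset.countP (fun a => a.pointer ≠ Pointer.idle) (s : Multiset (HopLabel Δ)) = 1 ∧
    ∀ c : Fin (Δ / 2),
      Multiset.countP (fun a => a.relay = some c) (s : Multiset (HopLabel Δ)) = 0 ∨
      Multiset.countP (fun a => a.relay = some c) (s : Multiset (HopLabel Δ)) = 2}
  edgeConfigs := {e | ∃ a b : HopLabel Δ, e = s(a, b) ∧ a.Compatible b}

/-! ### Borel forests and the class `BOREL` -/

/-- The graph `G` on the (standard Borel) space `X` is a Borel subset of `X × X`. -/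
def IsBorelGraph {X : Type u} [MeasurableSpace X] (G : SimpleGraph X) : Prop :=
  MeasurableSet {p : X × X | G.Adj p.1 p.2}

/-- A `Δ`-regular Borel forest: an acyclic `Δ`-regular Borel graph. -/
structure IsRegularBorelForest {X : Type u} [MeasurableSpace X] (Δ : ℕ) (G : SimpleGraph X) :
    Prop where
  borel : IsBorelGraph G
  acyclic : G.IsAcyclic
  regular : ∀ x, (G.neighborSet x).encard = Δ

/-- `T` is a one-or-two-ended spanning forest of `G`: a set of edges of `G` such that every connected
component of the graph `T` on the whole vertex set is infinite and has exactly one or exactly two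
ends. -/
structure IsOneOrTwoEndedSpanningForest {X : Type u} (G T : SimpleGraph X) : Prop where
  le : T ≤ G
  infinite : ∀ C : T.ConnectedComponent, C.supp.Infinite
  ends : ∀ C : T.ConnectedComponent,
    (SimpleGraph.end C.toSimpleGraph).encard = 1 ∨ (SimpleGraph.end C.toSimpleGraph).encard = 2

/-- The half-edges of a graph without virtual half-edges: the half-edge `(x, {x, y})` is the pair
`(x, y)`. -/
abbrev HalfEdge {X : Type u} (G : SimpleGraph X) : Type u := {p : X × X // G.Adj p.1 p.2}

namespace LCL

/-- The half-edge labeling `f` of `G` is a `P`-coloring. -/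
def IsColoring {Δ : ℕ} (P : LCL Δ) {X : Type u} (G : SimpleGraph X) (f : HalfEdge G → P.Label) :
    Prop :=
  (∀ x, ∃ e : Fin Δ ≃ G.neighborSet x,
    configOf (fun i => f ⟨(x, (e i : X)), (e i).2⟩) ∈ P.vertexConfigs) ∧
  ∀ x y (h : G.Adj x y), s(f ⟨(x, y), h⟩, f ⟨(y, x), h.symm⟩) ∈ P.edgeConfigs

end LCL

/-- The class `BOREL`: the problems that have a Borel solution on every `Δ`-regular Borel forest on a
standard Borel space. -/
def BOREL (Δ : ℕ) : Set (LCL Δ) :=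
  {P | ∀ (X : Type u) [MeasurableSpace X] [StandardBorelSpace X] (G : SimpleGraph X),
    IsRegularBorelForest Δ G →
      ∃ f : HalfEdge G → P.Label, Measurable[_, ⊤] f ∧ P.IsColoring G f}

/-! ### Finite `Δ`-regular trees and randomized local algorithms -/

/-- A finite `Δ`-regular tree on the vertex set `V`: a tree of maximum degree at most `Δ` in which
each vertex `v` has exactly `Δ` half-edges `(v, i)`, numbered by `i : Fin Δ` in an arbitrary way.
`other v i` is the other endpoint of the edge that `(v, i)` belongs to, and `none` if `(v, i)` is a
virtual half-edge. -/
structure RegTree (Δ : ℕ) (V : Type) where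
  graph : SimpleGraph V
  isTree : graph.IsTree
  other : V → Fin Δ → Option V
  adj_iff : ∀ v w, graph.Adj v w ↔ ∃ i, other v i = some w
  other_inj : ∀ v w i j, other v i = some w → other v j = some w → i = j

namespace RegTree

/-- The half-edge labeling `c` of the finite tree `T` is a `P`-coloring. There is no edge constraint
on virtual half-edges. -/
def IsColoring {Δ : ℕ} {V : Type} (T : RegTree Δ V) (P : LCL Δ) (c : V → Fin Δ → P.Label) : Prop :=
  (∀ v, configOf (c v) ∈ P.vertexConfigs) ∧
  ∀ v w i j, T.other v i = some w → T.other w j = some v → s(c v i, c w j) ∈ P.edgeConfigs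

/-- The vertices of the `t`-hop neighborhood of `v`. -/
abbrev Ball {Δ : ℕ} {V : Type} (T : RegTree Δ V) (v : V) (t : ℕ) : Type :=
  {w : V // T.graph.dist v w ≤ t}

/-- The vertex `v₁` of `T₁` and the vertex `v₂` of `T₂` have isomorphic `t`-hop neighborhoods: some
bijection between the neighborhoods takes `v₁` to `v₂` and respects the inputs `r₁`, `r₂` of the
vertices, their numbered half-edges (real or virtual), and the edges. -/
def SameView {Δ : ℕ} {V₁ V₂ R : Type} (t : ℕ) (T₁ : RegTree Δ V₁) (r₁ : V₁ → R) (v₁ : V₁)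
    (T₂ : RegTree Δ V₂) (r₂ : V₂ → R) (v₂ : V₂) : Prop :=
  ∃ φ : T₁.Ball v₁ t ≃ T₂.Ball v₂ t,
    (∀ w : T₁.Ball v₁ t, (w : V₁) = v₁ → (φ w : V₂) = v₂) ∧
    (∀ w : T₁.Ball v₁ t, r₁ w = r₂ (φ w)) ∧
    (∀ (w : T₁.Ball v₁ t) (i : Fin Δ), T₁.other w i = none ↔ T₂.other (φ w) i = none) ∧
    ∀ (w x : T₁.Ball v₁ t) (i : Fin Δ), T₁.other w i = some (x : V₁) ↔ T₂.other (φ w) i = some (φ x : V₂)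

end RegTree

/-- An infinite string of random bits. -/
abbrev RandomString : Type := ℕ → Bool

/-- The law of an infinite string of independent fair bits. -/
noncomputable def fairBits : Measure RandomString :=
  Measure.infinitePi (fun _ : ℕ => (PMF.uniformOfFintype Bool).toMeasure)

/-- A randomized local algorithm of local complexity `t`. It knows the number `n` of vertices, and its
output at a vertex (a labeling of the half-edges around it) is a measurable function of the
isomorphism type of the `t n`-hop neighborhood, in which each vertex carries a random string. -/
structure LocalAlgorithm (Δ : ℕ) (Label : Type) (t : ℕ → ℕ) where
  output : ∀ n : ℕ, RegTree Δ (Fin n) → (Fin n → RandomString) → Fin n → Fin Δ → Label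
  isLocal : ∀ (n : ℕ) (T₁ T₂ : RegTree Δ (Fin n)) (r₁ r₂ : Fin n → RandomString) (v₁ v₂ : Fin n),
    RegTree.SameView (t n) T₁ r₁ v₁ T₂ r₂ v₂ → output n T₁ r₁ v₁ = output n T₂ r₂ v₂
  measurable_output : ∀ (n : ℕ) (T : RegTree Δ (Fin n)) (v : Fin n) (i : Fin Δ) (a : Label),
    MeasurableSet {r : Fin n → RandomString | output n T r v i = a}

/-- The class `RLOCAL(t(n))`: the problems with a randomized local algorithm of complexity `t` that,
on every `Δ`-regular tree with `n` vertices, gives a correct solution with probability at least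
`1 - 1/n`, when the vertices have independent random strings. -/
def RLOCAL (Δ : ℕ) (t : ℕ → ℕ) : Set (LCL Δ) :=
  {P | ∃ A : LocalAlgorithm Δ P.Label t, ∀ (n : ℕ) (T : RegTree Δ (Fin n)),
    1 - 1 / (n : ℝ) ≤
      (Measure.pi (fun _ : Fin n => fairBits)).real {r | T.IsColoring P (A.output n T r)}}

/-- The class `RLOCAL(o(log n))`. -/
def RLOCALoLog (Δ : ℕ) : Set (LCL Δ) :=
  {P | ∃ t : ℕ → ℕ, (fun n => (t n : ℝ)) =o[atTop] (fun n : ℕ => Real.log n) ∧ P ∈ RLOCAL Δ t}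

/-! Claims 1 and 2 rest on one Borel decomposition, `IsHangingForest`: bi-infinite lines, and off
the lines a parent function for which every vertex has only finitely many descendants. If the chain
of parents of a vertex reaches a line, its component is that line with finite trees hanging on it,
which has two ends; if the chain never reaches a line, the component has one end.

The decomposition comes from cutting out segments, that is, paths between two vertices of degree at
least 3 whose inner vertices have degree 2. The inner vertices become isolated and are hung one on
the next towards the end of the segment. Within a round the segments are disjoint, so an endpoint
loses one edge and every surviving vertex keeps degree at least 2. Since every possible segment is
offered in infinitely many rounds, a component of the limit has at most one branching vertex
(`IsCutSequence.branching_unique`). A surviving component is therefore a line or a star of rays, and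
in a star each vertex takes a neighbor farther from the center as its parent.

For claim 2 the line edges receive the new label, and the hanging trees are matched greedily from
the bottom. The children of a vertex that are left over are paired with each other; if their number
is odd, the last one is matched with the vertex itself, and otherwise the vertex is left over for
its parent. A line vertex already satisfies its constraint through its two line edges, so children
left over there do no harm.

For claim 3, suppose that an algorithm of complexity t runs on the regular tree truncated at depth
D, where t is small compared with D. Two quantities modulo 2 live on edges and have a prescribed sum
at each vertex: whether the edge lies on a line (sum 0) and, where there are no lines, how many
matched pairs use the edge (sum 1). Working inwards, the values on a sphere determine those at the
root (`eq_of_eq_on_sphere`). Resampling the bits near the root and permuting the ports there does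
not change the output on a sphere of radius greater than 2t. Hence the value at a root edge is
almost independent of itself, so almost constant, and almost the same for all ports
(`LocalSolver.labelProb_swap_bound`).

All half-edges at the root cannot be on lines when Δ ≥ 3, so lines are rare, and a union bound
removes them from a whole ball. Then either almost all root edges are even, against the sum 1, or
almost all are odd. In the second case each edge needs a pointer at one of its two half-edges, but a
vertex has only one pointer, so on average at most 2 < Δ edges per vertex can be odd. -/

/-! ### Borel enumeration of neighbors -/

/-- The neighbors of each vertex of a `Δ`-regular Borel graph can be enumerated by `Δ` Borel
functions. -/
theorem IsRegularBorelForest.exists_neighbor_enumeration {Δ : ℕ} {X : Type u} [MeasurableSpace X]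
    [StandardBorelSpace X] {G : SimpleGraph X} (hG : IsRegularBorelForest Δ G) :
    ∃ nb : Fin Δ → X → X, (∀ i, Measurable (nb i)) ∧
      (∀ x, Function.Injective (fun i => nb i x)) ∧ ∀ x y, G.Adj x y ↔ ∃ i, nb i x = y := by
  classical
  let φ := embeddingReal X
  have hφ : MeasurableEmbedding φ := measurableEmbedding_embeddingReal X
  -- Pairs of a vertex and the increasing list of its neighbors, in the order pulled back from ℝ.
  -- The list is unique, so the projection to `X` is a Borel bijection, and its inverse is Borel by
  -- Lusin–Souslin.
  let Z : Set (X × (Fin Δ → X)) :=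
    {z | (∀ i, G.Adj z.1 (z.2 i)) ∧ ∀ i j, i < j → φ (z.2 i) < φ (z.2 j)}
  have hZ : MeasurableSet Z := by
    have h1 : MeasurableSet {z : X × (Fin Δ → X) | ∀ i, G.Adj z.1 (z.2 i)} := by
      rw [Set.ofPred_forall]
      refine MeasurableSet.iInter fun i => ?_
      exact (hG.borel.preimage (f := fun z : X × (Fin Δ → X) => (z.1, z.2 i)) (by fun_prop))
    have h2 : MeasurableSet
        {z : X × (Fin Δ → X) | ∀ i j, i < j → φ (z.2 i) < φ (z.2 j)} := by
      simp only [Set.ofPred_forall]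
      refine MeasurableSet.iInter fun i => MeasurableSet.iInter fun j =>
        MeasurableSet.iInter fun _ => ?_
      exact measurableSet_lt (hφ.measurable.comp (by fun_prop)) (hφ.measurable.comp (by fun_prop))
    exact h1.inter h2
  have hfin : ∀ x, (G.neighborSet x).Finite := fun x =>
    Set.finite_of_encard_eq_coe (hG.regular x)
  let N : X → Finset ℝ := fun x => (hfin x).toFinset.image φ
  have hN : ∀ x, (N x).card = Δ := by
    intro x
    rw [Finset.card_image_of_injective _ hφ.injective]
    have := hG.regular x
    rw [(hfin x).encard_eq_coe_toFinset_card] at this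
    exact_mod_cast this
  have huniq : ∀ z ∈ Z, ∀ i, φ (z.2 i) = (N z.1).orderEmbOfFin (hN z.1) i := by
    intro z hz i
    have := Finset.orderEmbOfFin_unique (hN z.1) (f := fun i => φ (z.2 i))
      (fun i => by
        simp only [N, Finset.mem_image, Set.Finite.mem_toFinset]
        exact ⟨z.2 i, hz.1 i, rfl⟩) (fun i j hij => hz.2 i j hij)
    exact congrFun this i
  have hinj : Function.Injective (fun z : Z => z.1.1) := by
    rintro ⟨z, hz⟩ ⟨w, hw⟩ h
    have h' : z.1 = w.1 := h
    ext1
    refine Prod.ext h' (funext fun i => hφ.injective ?_)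
    rw [huniq z hz, huniq w hw]
    congr! 2
    simp only [h']
  have hsurj : Function.Surjective (fun z : Z => z.1.1) := by
    intro x
    have hmem : ∀ i, ∃ y, G.Adj x y ∧ φ y = (N x).orderEmbOfFin (hN x) i := by
      intro i
      have := Finset.orderEmbOfFin_mem (N x) (hN x) i
      simp only [N, Finset.mem_image, Set.Finite.mem_toFinset] at this
      exact this
    choose y hy1 hy2 using hmem
    refine ⟨⟨(x, y), hy1, fun i j hij => ?_⟩, rfl⟩
    simp only [hy2]
    exact ((N x).orderEmbOfFin (hN x)).strictMono hij
  have : StandardBorelSpace Z := hZ.standardBorel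
  have hme : MeasurableEmbedding (fun z : Z => z.1.1) :=
    Measurable.measurableEmbedding (by fun_prop) hinj
  let g : X → Z := Function.surjInv hsurj
  have hg : Measurable g := by
    intro s hs
    have : g ⁻¹' s = (fun z : Z => z.1.1) '' s := by
      ext x
      constructor
      · intro hx
        exact ⟨g x, hx, Function.surjInv_eq hsurj x⟩
      · rintro ⟨z, hz, rfl⟩
        have : g z.1.1 = z := hinj (Function.surjInv_eq hsurj z.1.1)
        simpa [this] using hz
    rw [this]
    exact hme.measurableSet_image.2 hs
  have hg1 : ∀ x, (g x).1.1 = x := fun x => Function.surjInv_eq hsurj x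
  have hmono : ∀ x i j, i < j → φ ((g x).1.2 i) < φ ((g x).1.2 j) := fun x => (g x).2.2
  refine ⟨fun i x => (g x).1.2 i, fun i => by fun_prop, fun x i j hij => ?_, fun x y => ?_⟩
  · by_contra hne
    rcases lt_or_gt_of_ne hne with h | h
    · exact absurd (congrArg φ hij) (hmono x i j h).ne
    · exact absurd (congrArg φ hij) (hmono x j i h).ne'
  · have hz := (g x).2
    constructor
    · intro hxy
      have : φ y ∈ N x := by
        simp only [N, Finset.mem_image, Set.Finite.mem_toFinset]
        exact ⟨y, hxy, rfl⟩
      have hr : φ y ∈ Set.range ((N x).orderEmbOfFin (hN x)) := by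
        rw [Finset.range_orderEmbOfFin]; exact this
      obtain ⟨i, hi⟩ := hr
      refine ⟨i, hφ.injective ?_⟩
      rw [huniq _ hz i, ← hi]
      congr! 2
      exact (hg1 x).symm ▸ rfl
    · rintro ⟨i, rfl⟩
      have := hz.1 i
      rwa [hg1 x] at this

/-- A countable family of Borel sets that separates points from finite sets. -/
theorem exists_separating_borel_sets (X : Type u) [MeasurableSpace X] [StandardBorelSpace X] :
    ∃ U : ℕ → Set X, (∀ k, MeasurableSet (U k)) ∧
      ∀ (x : X) (F : Set X), F.Finite → x ∉ F → ∃ k, x ∈ U k ∧ Disjoint F (U k) := by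
  let := upgradeStandardBorel X
  obtain ⟨U, hU⟩ := ((TopologicalSpace.countable_countableBasis X).insert ∅).exists_eq_range
    (Set.insert_nonempty _ _)
  have hb := TopologicalSpace.isBasis_countableBasis X
  refine ⟨U, fun k => ?_, fun x F hF hx => ?_⟩
  · have hk : U k ∈ insert ∅ (TopologicalSpace.countableBasis X) := hU ▸ Set.mem_range_self k
    rcases hk with hk | hk
    · rw [hk]; exact MeasurableSet.empty
    · exact (hb.isOpen hk).measurableSet
  · obtain ⟨V, hV, hxV, hVF⟩ := hb.exists_subset_of_mem_open (a := x) (u := Fᶜ) hx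
      hF.isClosed.isOpen_compl
    obtain ⟨k, rfl⟩ : V ∈ Set.range U := hU ▸ Set.mem_insert_of_mem _ hV
    exact ⟨k, hxV, Set.disjoint_left.2 fun y hyF hyU => hVF hyU hyF⟩

/-! ### Nonbacktracking sequences in forests -/

namespace SimpleGraph

variable {V : Type*} {G : SimpleGraph V}

/-- A nonbacktracking sequence of vertices in a forest gives a path. -/
theorem IsAcyclic.exists_isPath_of_nonbacktracking (hG : G.IsAcyclic) (p : ℕ → V) (m n : ℕ)
    (hadj : ∀ j < n, G.Adj (p (m + j)) (p (m + j + 1)))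
    (hne : ∀ j, j + 1 < n → p (m + j) ≠ p (m + j + 2)) :
    ∃ w : G.Walk (p m) (p (m + n)), w.IsPath ∧ (∀ v ∈ w.support, ∃ j ≤ n, v = p (m + j)) ∧
      w.length = n := by
  -- In a forest a walk is a path as soon as consecutive edges differ. The clause on the first edge
  -- is what the induction needs to prepend another edge.
  suffices H : ∃ w : G.Walk (p m) (p (m + n)), w.edges.IsChain (· ≠ ·) ∧
      (∀ v ∈ w.support, ∃ j ≤ n, v = p (m + j)) ∧ w.length = n ∧
      (∀ e ∈ w.edges.head?, e = s(p m, p (m + 1))) by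
    obtain ⟨w, h1, h2, h3, -⟩ := H
    exact ⟨w, (hG.isPath_iff_isChain w).2 h1, h2, h3⟩
  induction n generalizing m with
  | zero => exact ⟨Walk.nil, by simp⟩
  | succ n ih =>
    obtain ⟨w, h1, h2, h3, h4⟩ := ih (m + 1)
      (fun j hj => by
        have := hadj (j + 1) (by omega)
        rwa [show m + (j + 1) = m + 1 + j by omega] at this)
      (fun j hj => by
        have := hne (j + 1) (by omega)
        rwa [show m + (j + 1) = m + 1 + j by omega] at this)
    have h0 : G.Adj (p m) (p (m + 1)) := hadj 0 (by omega)
    refine ⟨(Walk.cons h0 w).copy rfl (by congr 1; omega), ?_, ?_, ?_, ?_⟩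
    · rw [Walk.edges_copy, Walk.edges_cons, List.isChain_cons]
      refine ⟨fun e he => ?_, h1⟩
      rw [h4 e he]
      intro heq
      have hn : 0 < n := by
        rw [← h3, ← Walk.length_edges]
        cases hw : w.edges with
        | nil => simp [hw] at he
        | cons a l => simp
      have := hne 0 (by omega)
      simp only [Sym2.eq_iff] at heq
      rcases heq with ⟨h, -⟩ | ⟨h, -⟩
      · exact h0.ne h
      · exact this h
    · intro v hv
      rw [Walk.support_copy, Walk.support_cons, List.mem_cons] at hv
      rcases hv with rfl | hv
      · exact ⟨0, by omega, rfl⟩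
      · obtain ⟨j, hj, rfl⟩ := h2 v hv
        exact ⟨j + 1, by omega, by congr 1; omega⟩
    · simp [h3]
    · simp

/-- A nonbacktracking sequence of vertices in a forest is injective. -/
theorem IsAcyclic.ne_of_nonbacktracking (hG : G.IsAcyclic) (p : ℕ → V) (n : ℕ)
    (hadj : ∀ j < n, G.Adj (p j) (p (j + 1)))
    (hne : ∀ j, j + 1 < n → p j ≠ p (j + 2)) {a b : ℕ} (hab : a < b) (hb : b ≤ n) :
    p a ≠ p b := by
  obtain ⟨w, hw, -, hl⟩ := hG.exists_isPath_of_nonbacktracking p a (b - a)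
    (fun j hj => hadj _ (by omega)) (fun j hj => hne _ (by omega))
  intro h
  have hb' : a + (b - a) = b := by omega
  have : (w.copy rfl (by rw [hb', h] : p (a + (b - a)) = p a)).IsPath :=
    (Walk.isPath_copy _ _ _).2 hw
  have h3 := Walk.length_eq_zero_iff.2 (Walk.isPath_iff_nil.1 this)
  rw [Walk.length_copy] at h3
  omega

/-- In an infinite-depth exhaustion by finite sets with at most two outer boundary vertices, a graph
has at most two ends. -/
theorem encard_end_le_two (hc : G.Preconnected) (K : ℕ → Set V) (hK : ∀ n, (K n).Finite)
    (hmono : Monotone K) (hne : (K 0).Nonempty) (hcov : ∀ v, ∃ n, v ∈ K n)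
    (hout : ∀ n, {y | y ∉ K n ∧ ∃ x ∈ K n, G.Adj x y}.encard ≤ 2) : G.end.encard ≤ 2 := by
  classical
  by_contra hcon
  rw [not_le] at hcon
  obtain ⟨E, hE, hE3⟩ := Set.exists_subset_encard_eq (k := 3) (Order.add_one_le_of_lt hcon)
  obtain ⟨s, t, r, hst, hsr, htr, rfl⟩ := Set.encard_eq_three.1 hE3
  have hs : s ∈ G.end := hE (Or.inl rfl)
  have ht : t ∈ G.end := hE (Or.inr (Or.inl rfl))
  have hr : r ∈ G.end := hE (Or.inr (Or.inr rfl))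
  have hdiff : ∀ s t : (j : (Finset V)ᵒᵖ) → G.componentComplFunctor.obj j, s ∈ G.end →
      t ∈ G.end → s ≠ t → ∃ F : Finset V, ∀ (L : Finset V), F ⊆ L →
        s (Opposite.op L) ≠ t (Opposite.op L) := by
    intro s t hs ht hst
    obtain ⟨F, hF⟩ := Function.ne_iff.1 hst
    refine ⟨F.unop, fun L hL h => hF ?_⟩
    have e1 := hs (CategoryTheory.opHomOfLE hL)
    have e2 := ht (CategoryTheory.opHomOfLE hL)
    rw [← h] at e2
    exact e1.symm.trans e2
  obtain ⟨F1, h1⟩ := hdiff s t hs ht hst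
  obtain ⟨F2, h2⟩ := hdiff s r hs hr hsr
  obtain ⟨F3, h3⟩ := hdiff t r ht hr htr
  have hbig : ∀ F : Finset V, ∃ n, (F : Set V) ⊆ K n := by
    intro F
    induction F using Finset.induction_on with
    | empty => exact ⟨0, by simp⟩
    | insert a F _ ih =>
      obtain ⟨n, hn⟩ := ih
      obtain ⟨m, hm⟩ := hcov a
      refine ⟨max n m, ?_⟩
      rw [Finset.coe_insert, Set.insert_subset_iff]
      exact ⟨hmono (le_max_right _ _) hm, hn.trans (hmono (le_max_left _ _))⟩
  -- Removing `K n` separates the three ends pairwise. Each of the three components meets the outer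
  -- boundary of `K n`, which would need three vertices.
  obtain ⟨n, hn⟩ := hbig (F1 ∪ F2 ∪ F3)
  let L : Finset V := (hK n).toFinset
  have hLK : (L : Set V) = K n := by simp [L]
  have hsub : F1 ∪ F2 ∪ F3 ⊆ L := by
    rw [← Finset.coe_subset, hLK]; exact hn
  have hL0 : (L : Set V).Nonempty := by
    rw [hLK]; exact hne.mono (hmono (Nat.zero_le n))
  let O : Set V := {y | y ∉ K n ∧ ∃ x ∈ K n, G.Adj x y}
  have htouch : ∀ C : G.ComponentCompl (L : Set V), ∃ v ∈ O, v ∈ C := by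
    intro C
    obtain ⟨⟨c, k⟩, hc1, hk, hadj⟩ := C.exists_adj_boundary_pair hc hL0
    rw [hLK] at hk
    refine ⟨c, ⟨?_, k, hk, hadj.symm⟩, hc1⟩
    have := ComponentCompl.notMem_of_mem hc1
    rwa [hLK] at this
  obtain ⟨a, haO, ha⟩ := htouch (s (Opposite.op L))
  obtain ⟨b, hbO, hb⟩ := htouch (t (Opposite.op L))
  obtain ⟨c, hcO, hcc⟩ := htouch (r (Opposite.op L))
  have key : ∀ (C D : G.ComponentCompl (L : Set V)) (a b : V), a ∈ C → b ∈ D → C ≠ D → a ≠ b := by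
    rintro C D a b haC hbD hCD rfl
    exact Set.disjoint_left.1 (ComponentCompl.pairwise_disjoint hCD) haC hbD
  have hab := key _ _ a b ha hb
    (h1 L ((Finset.subset_union_left.trans Finset.subset_union_left).trans hsub))
  have hac := key _ _ a c ha hcc
    (h2 L ((Finset.subset_union_right.trans Finset.subset_union_left).trans hsub))
  have hbc := key _ _ b c hb hcc (h3 L (Finset.subset_union_right.trans hsub))
  have h3 : ({a, b, c} : Set V).encard = 3 := Set.encard_eq_three.2 ⟨a, b, c, hab, hac, hbc, rfl⟩
  have hsubO : ({a, b, c} : Set V) ⊆ O := by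
    rintro x (rfl | rfl | rfl) <;> assumption
  have := (Set.encard_le_encard hsubO).trans (hout n)
  rw [h3] at this
  exact absurd this (by decide)

end SimpleGraph

/-- A locally finite preconnected infinite graph has at least one end. -/
theorem SimpleGraph.nonempty_end {V : Type u} {G : SimpleGraph V} [G.LocallyFinite]
    [Fact G.Preconnected] [Infinite V] : G.end.Nonempty := by
  have h1 : ∀ K : (Finset V)ᵒᵖ, Nonempty (G.componentComplFunctor.obj K) := fun K =>
    G.componentCompl_nonempty_of_infinite K.unop
  have h2 : ∀ K : (Finset V)ᵒᵖ, Finite (G.componentComplFunctor.obj K) := fun K =>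
    G.componentCompl_finite K.unop
  exact nonempty_sections_of_finite_inverse_system G.componentComplFunctor

/-! ### Lines with hanging trees -/

/-- A decomposition of a graph `G` into lines, given by a `2`-regular relation `S` on a set `L`, and
a parent relation `P` (`P x y` means that `y` is the parent of `x`), defined for the vertices outside
of `L`, that is well-founded towards the descendants. -/
structure IsHangingForest {X : Type u} (G : SimpleGraph X) (L : Set X) (S P : X → X → Prop) :
    Prop where
  line_adj : ∀ {x y}, S x y → G.Adj x y
  line_symm : ∀ {x y}, S x y → S y x
  line_mem : ∀ {x y}, S x y → x ∈ L
  line_encard : ∀ {x}, x ∈ L → {y | S x y}.encard = 2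
  parent_adj : ∀ {x y}, P x y → G.Adj x y
  exists_parent : ∀ {x}, x ∉ L → ∃ y, P x y
  notMem_of_parent : ∀ {x y}, P x y → x ∉ L
  parent_unique : ∀ {x y z}, P x y → P x z → y = z
  wf : WellFounded P

namespace IsHangingForest

variable {X : Type u} {G : SimpleGraph X} {L : Set X} {S P : X → X → Prop}

open Relation

theorem parent_asymm (h : IsHangingForest G L S P) {x y : X} (hxy : P x y) : ¬ P y x :=
  fun hyx => h.wf.asymmetric _ _ hxy hyx

/-- The graph formed by the lines and the edges from vertices to their parents. -/
def graph (h : IsHangingForest G L S P) : SimpleGraph X where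
  Adj x y := S x y ∨ P x y ∨ P y x
  symm := ⟨fun x y hxy => by
    rcases hxy with h1 | h1 | h1
    · exact Or.inl (h.line_symm h1)
    · exact Or.inr (Or.inr h1)
    · exact Or.inr (Or.inl h1)⟩
  loopless := ⟨fun x hx => by
    rcases hx with h1 | h1 | h1
    · exact (h.line_adj h1).ne rfl
    · exact (h.parent_adj h1).ne rfl
    · exact (h.parent_adj h1).ne rfl⟩

theorem graph_le (h : IsHangingForest G L S P) : h.graph ≤ G := by
  intro x y hxy
  rcases hxy with h1 | h1 | h1
  · exact h.line_adj h1
  · exact h.parent_adj h1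
  · exact (h.parent_adj h1).symm

/-- Well-founded induction in the style of König's lemma: a vertex has finitely many children, each
with finitely many descendants. -/
theorem finite_descendants (h : IsHangingForest G L S P) (hfin : ∀ x, (G.neighborSet x).Finite)
    (y : X) : {x | ReflTransGen P x y}.Finite := by
  induction y using h.wf.induction with
  | _ y ih =>
    have hsub : {x | ReflTransGen P x y} ⊆
        {y} ∪ ⋃ z ∈ {z | P z y}, {x | ReflTransGen P x z} := by
      intro x hx
      rcases ReflTransGen.cases_tail hx with rfl | ⟨z, hxz, hzy⟩
      · exact Or.inl rfl
      · exact Or.inr (Set.mem_biUnion (x := z) hzy hxz)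
    refine Set.Finite.subset ((Set.finite_singleton y).union
      (Set.Finite.biUnion ((hfin y).subset fun z hz => (h.parent_adj hz).symm) ?_)) hsub
    exact fun z hz => ih z hz

theorem reflTransGen_reachable (h : IsHangingForest G L S P) {x y : X}
    (hxy : ReflTransGen P x y) : h.graph.Reachable x y := by
  induction hxy with
  | refl => rfl
  | tail _ hbc ih => exact ih.trans (SimpleGraph.Adj.reachable (Or.inr (Or.inl hbc)))

/-- A component that is exhausted by finite sets with small boundary has at most two ends. -/
theorem ends_le_two_of_exhaustion {T : SimpleGraph X} (x₀ : X) (K : ℕ → Set X)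
    (hK : ∀ n, (K n).Finite) (hmono : Monotone K) (h0 : x₀ ∈ K 0)
    (hstep : ∀ n x y, x ∈ K n → T.Adj x y → y ∈ K (n + 1))
    (hout : ∀ n, {y | y ∉ K n ∧ ∃ x ∈ K n, T.Adj x y}.encard ≤ 2) :
    (SimpleGraph.end (T.connectedComponentMk x₀).toSimpleGraph).encard ≤ 2 := by
  set C := T.connectedComponentMk x₀
  have hcov : ∀ v : X, T.Reachable x₀ v → ∃ n, v ∈ K n := by
    rintro v ⟨w⟩
    suffices H : ∀ (a b : X) (w : T.Walk a b) (n : ℕ), a ∈ K n → ∃ m, b ∈ K m from H _ _ w 0 h0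
    intro a b w
    induction w with
    | nil => exact fun n hn => ⟨n, hn⟩
    | cons hadj _ ih => exact fun n hn => ih (n + 1) (hstep n _ _ hn hadj)
  refine SimpleGraph.encard_end_le_two (C.connected_toSimpleGraph).preconnected
    (fun n => Subtype.val ⁻¹' K n) (fun n => (hK n).preimage Subtype.val_injective.injOn)
    (fun m n hmn => Set.preimage_mono (hmono hmn)) ⟨⟨x₀, rfl⟩, h0⟩ ?_ ?_
  · rintro ⟨v, hv⟩
    exact hcov v (SimpleGraph.ConnectedComponent.exact hv).symm
  · intro n
    refine le_trans ?_ (hout n)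
    rw [← Subtype.val_injective.encard_image]
    refine Set.encard_le_encard ?_
    rintro _ ⟨y, ⟨hy, x, hx, hxy⟩, rfl⟩
    exact ⟨hy, x, hx, hxy⟩

/-- The set of vertices at distance at most `n` from `l` along the lines. -/
def lineBall (S : X → X → Prop) (l : X) : ℕ → Set X
  | 0 => {l}
  | n + 1 => lineBall S l n ∪ {y | ∃ x ∈ lineBall S l n, S x y}

theorem lineBall_subset (l : X) (n : ℕ) : lineBall S l n ⊆ lineBall S l (n + 1) :=
  Set.subset_union_left

theorem finite_lineBall (h : IsHangingForest G L S P) (hfin : ∀ x, (G.neighborSet x).Finite)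
    (l : X) (n : ℕ) : (lineBall S l n).Finite := by
  induction n with
  | zero => exact Set.finite_singleton l
  | succ n ih =>
    refine ih.union ((Set.Finite.biUnion ih fun x _ => hfin x).subset ?_)
    rintro y ⟨x, hx, hxy⟩
    exact Set.mem_biUnion hx (h.line_adj hxy)

/-- The new boundary injects into the old one: a new boundary vertex is next to an old boundary
vertex, whose other line neighbor lies inside the ball, so no old boundary vertex serves twice. -/
theorem lineBall_boundary (h : IsHangingForest G L S P) {l : X} (hl : l ∈ L) (n : ℕ) :
    {y | y ∉ lineBall S l n ∧ ∃ x ∈ lineBall S l n, S x y}.encard ≤ 2 := by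
  induction n with
  | zero =>
    rw [← h.line_encard hl]
    refine Set.encard_le_encard ?_
    rintro y ⟨-, x, rfl, hxy⟩
    exact hxy
  | succ n ih =>
    refine le_trans ?_ ih
    have hex : ∀ z ∈ {y | y ∉ lineBall S l (n + 1) ∧ ∃ x ∈ lineBall S l (n + 1), S x y},
        ∃ y, S y z ∧ y ∉ lineBall S l n ∧ ∃ x ∈ lineBall S l n, S x y := by
      rintro z ⟨hz, y, hy, hyz⟩
      have hyn : y ∉ lineBall S l n := fun hyn => hz (Or.inr ⟨y, hyn, hyz⟩)
      exact ⟨y, hyz, hyn, hy.resolve_left hyn⟩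
    choose! f hf1 hf2 using hex
    refine Set.encard_le_encard_of_injOn (f := f) hf2 ?_
    intro z hz z' hz' hzz
    obtain ⟨hyn, x, hx, hxy⟩ := hf2 z hz
    by_contra hne
    have h1 := hf1 z hz
    have h2 := hf1 z' hz'
    rw [← hzz] at h2
    have hsub : ({x, z, z'} : Set X) ⊆ {w | S (f z) w} := by
      rintro w (rfl | rfl | rfl)
      · exact h.line_symm hxy
      · exact h1
      · exact h2
    have hxz : x ≠ z := fun e => hz.1 (e ▸ Or.inl hx)
    have hxz' : x ≠ z' := fun e => hz'.1 (e ▸ Or.inl hx)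
    have h3 : ({x, z, z'} : Set X).encard = 3 :=
      Set.encard_eq_three.2 ⟨x, z, z', hxz, hxz', hne, rfl⟩
    have := Set.encard_le_encard hsub
    rw [h3, h.line_encard (h.line_mem h1)] at this
    exact absurd this (by decide)

/-- The state of the recursion is a directed line edge, so that each step can choose the line
neighbor that does not backtrack. -/
theorem exists_line_ray (h : IsHangingForest G L S P) {l : X} (hl : l ∈ L) :
    ∃ p : ℕ → X, p 0 = l ∧ (∀ n, S (p n) (p (n + 1))) ∧ ∀ n, p n ≠ p (n + 2) := by
  have hnext : ∀ q : {q : X × X // S q.1 q.2}, ∃ r : {q : X × X // S q.1 q.2},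
      r.1.1 = q.1.2 ∧ r.1.2 ≠ q.1.1 := by
    rintro ⟨⟨x, y⟩, hxy⟩
    obtain ⟨a, b, hab, he⟩ := Set.encard_eq_two.1 (h.line_encard (h.line_mem (h.line_symm hxy)))
    have ha : S y a := by
      have : a ∈ {z | S y z} := he ▸ Or.inl rfl
      exact this
    have hb : S y b := by
      have : b ∈ {z | S y z} := he ▸ Or.inr rfl
      exact this
    by_cases hax : a = x
    · exact ⟨⟨(y, b), hb⟩, rfl, fun e => hab (hax.trans e.symm)⟩
    · exact ⟨⟨(y, a), ha⟩, rfl, hax⟩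
  choose f hf1 hf2 using hnext
  obtain ⟨a, b, -, he⟩ := Set.encard_eq_two.1 (h.line_encard hl)
  have ha : S l a := by
    have : a ∈ {z | S l z} := he ▸ Or.inl rfl
    exact this
  let q : ℕ → {q : X × X // S q.1 q.2} := fun n => f^[n] ⟨(l, a), ha⟩
  have hq : ∀ n, q (n + 1) = f (q n) := fun n => Function.iterate_succ_apply' f n _
  have hq1 : ∀ n, (q (n + 1)).1.1 = (q n).1.2 := fun n => by rw [hq, hf1]
  refine ⟨fun n => (q n).1.1, rfl, fun n => ?_, fun n => ?_⟩
  · simp only [hq1]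
    exact (q n).2
  · change (q n).1.1 ≠ (q (n + 2)).1.1
    rw [hq1 (n + 1), hq]
    exact (hf2 (q n)).symm

theorem exists_parent_ray (h : IsHangingForest G L S P) {x : X}
    (hx : ∀ y, ReflTransGen P x y → y ∉ L) :
    ∃ p : ℕ → X, p 0 = x ∧ ∀ n, P (p n) (p (n + 1)) := by
  have hnext : ∀ q : {y // ReflTransGen P x y}, ∃ r : {y // ReflTransGen P x y}, P q r := by
    rintro ⟨y, hy⟩
    obtain ⟨z, hz⟩ := h.exists_parent (hx y hy)
    exact ⟨⟨z, hy.tail hz⟩, hz⟩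
  choose f hf using hnext
  refine ⟨fun n => (f^[n] ⟨x, ReflTransGen.refl⟩).1, rfl, fun n => ?_⟩
  simp only [Function.iterate_succ_apply']
  exact hf _

/-- A nonbacktracking line ray is injective in a forest, so the component is infinite. It is
exhausted by the balls of the line together with all descendants; these sets are finite, and one can
leave them only along the line. -/
theorem component_of_line (h : IsHangingForest G L S P) (hG : G.IsAcyclic)
    (hfin : ∀ x, (G.neighborSet x).Finite) {x l : X} (hxl : ReflTransGen P x l) (hl : l ∈ L) :
    (h.graph.connectedComponentMk x).supp.Infinite ∧
      (SimpleGraph.end (h.graph.connectedComponentMk x).toSimpleGraph).encard ≤ 2 := by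
  constructor
  · obtain ⟨p, rfl, hp1, hp2⟩ := h.exists_line_ray hl
    refine Set.infinite_of_injective_forall_mem (f := p) ?_ fun n => ?_
    · intro a b hab
      by_contra hne
      rcases lt_or_gt_of_ne hne with hlt | hlt
      · exact hG.ne_of_nonbacktracking p b (fun j _ => h.line_adj (hp1 j)) (fun j _ => hp2 j)
          hlt le_rfl hab
      · exact hG.ne_of_nonbacktracking p a (fun j _ => h.line_adj (hp1 j)) (fun j _ => hp2 j)
          hlt le_rfl hab.symm
    · refine SimpleGraph.ConnectedComponent.sound (SimpleGraph.Reachable.symm ?_)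
      induction n with
      | zero => exact h.reflTransGen_reachable hxl
      | succ n ih => exact ih.trans (SimpleGraph.Adj.reachable (Or.inl (hp1 n)))
  · refine ends_le_two_of_exhaustion x
      (fun n => ⋃ b ∈ lineBall S l n, {y | ReflTransGen P y b}) (fun n => ?_) ?_ ?_ ?_ ?_
    · exact (h.finite_lineBall hfin l n).biUnion fun b _ => h.finite_descendants hfin b
    · exact monotone_nat_of_le_succ fun n =>
        Set.biUnion_subset_biUnion_left (lineBall_subset l n)
    · exact Set.mem_biUnion (x := l) rfl hxl
    · intro n y z hy hyz
      obtain ⟨b, hb, hyb⟩ := Set.mem_iUnion₂.1 hy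
      rcases hyz with h1 | h1 | h1
      · rcases ReflTransGen.cases_head hyb with rfl | ⟨c, hyc, -⟩
        · exact Set.mem_biUnion (x := z) (Or.inr ⟨y, hb, h1⟩) ReflTransGen.refl
        · exact absurd (h.line_mem h1) (h.notMem_of_parent hyc)
      · rcases ReflTransGen.cases_head hyb with rfl | ⟨c, hyc, hcb⟩
        · refine absurd ?_ (h.notMem_of_parent h1)
          clear hy hyb
          induction n with
          | zero => exact (show y = l from hb) ▸ hl
          | succ n ih =>
            rcases hb with hb | ⟨w, -, hw⟩
            · exact ih hb
            · exact h.line_mem (h.line_symm hw)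
        · obtain rfl := h.parent_unique h1 hyc
          exact Set.mem_biUnion (lineBall_subset l n hb) hcb
      · exact Set.mem_biUnion (lineBall_subset l n hb) (ReflTransGen.head h1 hyb)
    · intro n
      refine le_trans (Set.encard_le_encard ?_) (h.lineBall_boundary hl n)
      rintro z ⟨hz, y, hy, hyz⟩
      obtain ⟨b, hb, hyb⟩ := Set.mem_iUnion₂.1 hy
      rcases hyz with h1 | h1 | h1
      · rcases ReflTransGen.cases_head hyb with rfl | ⟨c, hyc, -⟩
        · exact ⟨fun hzn => hz (Set.mem_biUnion hzn ReflTransGen.refl), y, hb, h1⟩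
        · exact absurd (h.line_mem h1) (h.notMem_of_parent hyc)
      · rcases ReflTransGen.cases_head hyb with rfl | ⟨c, hyc, hcb⟩
        · refine absurd ?_ (h.notMem_of_parent h1)
          clear hy hyb hz
          induction n with
          | zero => exact (show y = l from hb) ▸ hl
          | succ n ih =>
            rcases hb with hb | ⟨w, -, hw⟩
            · exact ih hb
            · exact h.line_mem (h.line_symm hw)
        · obtain rfl := h.parent_unique h1 hyc
          exact absurd (Set.mem_biUnion hb hcb) hz
      · exact absurd (Set.mem_biUnion (t := fun b => {y | ReflTransGen P y b}) hb
          (ReflTransGen.head h1 hyb)) hz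

/-- The chain of parents is infinite and never repeats, by well-foundedness. The component is
exhausted by the finite sets of descendants of `p n`, whose only outer neighbor is `p (n + 1)`. -/
theorem component_of_forall_notMem (h : IsHangingForest G L S P)
    (hfin : ∀ x, (G.neighborSet x).Finite) {x : X} (hx : ∀ y, ReflTransGen P x y → y ∉ L) :
    (h.graph.connectedComponentMk x).supp.Infinite ∧
      (SimpleGraph.end (h.graph.connectedComponentMk x).toSimpleGraph).encard ≤ 2 := by
  obtain ⟨p, rfl, hp⟩ := h.exists_parent_ray hx
  constructor
  · refine Set.infinite_of_injective_forall_mem (f := p) ?_ fun n => ?_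
    · have hlt : ∀ a b, a < b → TransGen P (p a) (p b) := by
        intro a b hab
        induction b, hab using Nat.le_induction with
        | base => exact TransGen.single (hp a)
        | succ b _ ih => exact ih.tail (hp b)
      have hirr : ∀ y, ¬ TransGen P y y := fun y hy => h.wf.transGen.irrefl.irrefl y hy
      intro a b hab
      by_contra hne
      rcases lt_or_gt_of_ne hne with hlt' | hlt'
      · exact hirr _ (hab ▸ hlt a b hlt')
      · exact hirr _ (hab ▸ hlt b a hlt')
    · refine SimpleGraph.ConnectedComponent.sound (SimpleGraph.Reachable.symm ?_)
      induction n with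
      | zero => rfl
      | succ n ih => exact ih.trans (SimpleGraph.Adj.reachable (Or.inr (Or.inl (hp n))))
  · refine ends_le_two_of_exhaustion (p 0) (fun n => {y | ReflTransGen P y (p n)})
      (fun n => h.finite_descendants hfin _) ?_ ReflTransGen.refl ?_ ?_
    · exact monotone_nat_of_le_succ fun n y hy => ReflTransGen.tail hy (hp n)
    · intro n y z hy hyz
      rcases hyz with h1 | h1 | h1
      · rcases ReflTransGen.cases_head hy with rfl | ⟨c, hyc, -⟩
        · exact absurd (h.line_mem h1) (h.notMem_of_parent (hp n))
        · exact absurd (h.line_mem h1) (h.notMem_of_parent hyc)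
      · rcases ReflTransGen.cases_head hy with rfl | ⟨c, hyc, hcb⟩
        · obtain rfl := h.parent_unique h1 (hp n)
          exact ReflTransGen.refl
        · obtain rfl := h.parent_unique h1 hyc
          exact hcb.tail (hp n)
      · exact (ReflTransGen.head h1 hy).tail (hp n)
    · intro n
      refine le_trans (Set.encard_le_encard (t := {p (n + 1)}) ?_)
        ((Set.encard_singleton _).le.trans (by decide))
      rintro z ⟨hz, y, hy, hyz⟩
      rcases hyz with h1 | h1 | h1
      · rcases ReflTransGen.cases_head hy with rfl | ⟨c, hyc, -⟩
        · exact absurd (h.line_mem h1) (h.notMem_of_parent (hp n))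
        · exact absurd (h.line_mem h1) (h.notMem_of_parent hyc)
      · rcases ReflTransGen.cases_head hy with rfl | ⟨c, hyc, hcb⟩
        · exact h.parent_unique h1 (hp n)
        · obtain rfl := h.parent_unique h1 hyc
          exact absurd hcb hz
      · exact absurd (ReflTransGen.head h1 hy) hz

/-- The lines with the trees that hang on them form a one-or-two-ended spanning forest. -/
theorem isOneOrTwoEndedSpanningForest (h : IsHangingForest G L S P) (hG : G.IsAcyclic)
    (hfin : ∀ x, (G.neighborSet x).Finite) : IsOneOrTwoEndedSpanningForest G h.graph := by
  have key : ∀ C : h.graph.ConnectedComponent, C.supp.Infinite ∧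
      (SimpleGraph.end C.toSimpleGraph).encard ≤ 2 := by
    intro C
    induction C using SimpleGraph.ConnectedComponent.ind with
    | _ x =>
      by_cases hx : ∀ y, ReflTransGen P x y → y ∉ L
      · exact h.component_of_forall_notMem hfin hx
      · push Not at hx
        obtain ⟨l, hxl, hl⟩ := hx
        exact h.component_of_line hG hfin hxl hl
  refine ⟨h.graph_le, fun C => (key C).1, fun C => ?_⟩
  obtain ⟨hinf, hle⟩ := key C
  have hne : (SimpleGraph.end C.toSimpleGraph).Nonempty := by
    have : Infinite C := hinf.to_subtype
    have : Fact C.toSimpleGraph.Preconnected := ⟨C.connected_toSimpleGraph.preconnected⟩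
    have : C.toSimpleGraph.LocallyFinite := fun v => Set.Finite.fintype
      (((hfin v).subset (fun y hy => h.graph_le hy)).preimage
        (f := Subtype.val) Subtype.val_injective.injOn)
    exact SimpleGraph.nonempty_end
  have h1 := Set.one_le_encard_iff_nonempty.2 hne
  generalize (SimpleGraph.end C.toSimpleGraph).encard = e at *
  have he : e ≠ ⊤ := ne_top_of_le_ne_top (by decide) hle
  lift e to ℕ using he
  have h1' : 1 ≤ e := by exact_mod_cast h1
  have h2' : e ≤ 2 := by exact_mod_cast hle
  interval_cases e
  · exact Or.inl rfl
  · exact Or.inr rfl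

end IsHangingForest

/-! ### The configurations of the line-augmented matching problem -/

theorem coe_configOf {Δ : ℕ} {α : Type*} (f : Fin Δ → α) :
    (configOf f : Multiset α) = Multiset.map f (Finset.univ : Finset (Fin Δ)).val := rfl

theorem countP_configOf {Δ : ℕ} {α : Type*} (f : Fin Δ → α) (p : α → Prop) [DecidablePred p] :
    Multiset.countP p (configOf f : Multiset α) =
      (Finset.univ.filter (fun i => p (f i))).card := by
  rw [coe_configOf, Multiset.countP_map]
  rfl

theorem configOf_comp {Δ : ℕ} {α β : Type*} (f : Fin Δ → α) (g : α → β) :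
    configOf (fun i => g (f i)) = (configOf f).map g := by
  apply Subtype.ext
  have : ((configOf f).map g).1 = Multiset.map g (configOf f : Multiset α) := rfl
  rw [this, coe_configOf, Multiset.map_map]
  rfl

open Classical in
theorem mem_hopMatching_vertexConfigs {Δ : ℕ} (g : Fin Δ → HopLabel Δ) :
    (configOf g : Sym (HopLabel Δ) Δ) ∈ (hopMatching Δ).vertexConfigs ↔
      (Finset.univ.filter (fun i => (g i).pointer ≠ Pointer.idle)).card = 1 ∧
        ∀ c : Fin (Δ / 2), (Finset.univ.filter (fun i => (g i).relay = some c)).card = 0 ∨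
          (Finset.univ.filter (fun i => (g i).relay = some c)).card = 2 := by
  have h : (configOf g : Sym (HopLabel Δ) Δ) ∈ (hopMatching Δ).vertexConfigs ↔
      Multiset.countP (fun a => a.pointer ≠ Pointer.idle) (configOf g : Multiset (HopLabel Δ)) = 1 ∧
      ∀ c : Fin (Δ / 2),
        Multiset.countP (fun a => a.relay = some c) (configOf g : Multiset (HopLabel Δ)) = 0 ∨
        Multiset.countP (fun a => a.relay = some c) (configOf g : Multiset (HopLabel Δ)) = 2 := by
    refine Iff.trans Iff.rfl ?_
    refine and_congr ?_ (forall_congr' fun c => or_congr ?_ ?_) <;>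
    · refine iff_of_eq (congrArg (· = _) ?_)
      congr!
  rw [h]
  simp only [countP_configOf]

open Classical in
theorem mem_lineAugment_vertexConfigs {Δ : ℕ} (f : Fin Δ → Option (HopLabel Δ)) :
    (configOf f : Sym (Option (HopLabel Δ)) Δ) ∈ (hopMatching Δ).lineAugment.vertexConfigs ↔
      (∃ g : Fin Δ → HopLabel Δ, (∀ i, f i = some (g i)) ∧
        (Finset.univ.filter (fun i => (g i).pointer ≠ Pointer.idle)).card = 1 ∧
        ∀ c : Fin (Δ / 2), (Finset.univ.filter (fun i => (g i).relay = some c)).card = 0 ∨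
          (Finset.univ.filter (fun i => (g i).relay = some c)).card = 2) ∨
      (Finset.univ.filter (fun i => f i = none)).card = 2 := by
  have h : (configOf f : Sym (Option (HopLabel Δ)) Δ) ∈ (hopMatching Δ).lineAugment.vertexConfigs ↔
      (∃ s₀ : Sym (HopLabel Δ) Δ, s₀ ∈ (hopMatching Δ).vertexConfigs ∧ configOf f = s₀.map some) ∨
      Multiset.countP (fun a => a.isNone = true)
        (configOf f : Multiset (Option (HopLabel Δ))) = 2 := Iff.rfl
  rw [h, countP_configOf]
  simp only [Option.isNone_iff_eq_none]
  refine or_congr ?_ (iff_of_eq (by congr!))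
  constructor
  · rintro ⟨s₀, hs, he⟩
    have hsome : ∀ i, ∃ a, f i = some a := by
      intro i
      have hi : f i ∈ (configOf f : Multiset (Option (HopLabel Δ))) := by
        rw [coe_configOf]
        exact Multiset.mem_map_of_mem _ (Finset.mem_univ i)
      rw [he] at hi
      obtain ⟨a, -, ha⟩ := Multiset.mem_map.1 hi
      exact ⟨a, ha.symm⟩
    choose g hg using hsome
    refine ⟨g, hg, (mem_hopMatching_vertexConfigs g).1 ?_⟩
    have : (configOf g).map some = s₀.map some := by
      rw [← configOf_comp, ← he, funext hg]
    rwa [Sym.map_injective (Option.some_injective _) _ this]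
  · rintro ⟨g, hg, hs⟩
    refine ⟨configOf g, (mem_hopMatching_vertexConfigs g).2 hs, ?_⟩
    rw [← configOf_comp, funext hg]

theorem mem_lineAugment_edgeConfigs {Δ : ℕ} (a b : Option (HopLabel Δ)) :
    s(a, b) ∈ (hopMatching Δ).lineAugment.edgeConfigs ↔
      (∃ a' b' : HopLabel Δ, a = some a' ∧ b = some b' ∧ a'.Compatible b') ∨
        (a = none ∧ b = none) := by
  have h : s(a, b) ∈ (hopMatching Δ).lineAugment.edgeConfigs ↔
      (∃ e₀ : Sym2 (HopLabel Δ), (∃ a b : HopLabel Δ, e₀ = s(a, b) ∧ a.Compatible b) ∧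
        s(a, b) = e₀.map some) ∨ s(a, b) = s(none, none) := Iff.rfl
  rw [h]
  refine or_congr ⟨?_, ?_⟩ (by simp)
  · rintro ⟨_, ⟨a', b', rfl, hc⟩, he⟩
    rw [Sym2.map_mk, Sym2.eq_iff] at he
    rcases he with ⟨h1, h2⟩ | ⟨h1, h2⟩
    · exact ⟨a', b', h1, h2, hc⟩
    · exact ⟨b', a', h1, h2, hc.1.symm, hc.2.2, hc.2.1⟩
  · rintro ⟨a', b', rfl, rfl, hc⟩
    exact ⟨s(a', b'), ⟨a', b', rfl, hc⟩, by simp⟩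

/-! ### Matchings of hanging trees -/

section Counting

open Finset

theorem measurable_card_filter {α ι : Type*} [MeasurableSpace α] [Fintype ι] (Q : ι → α → Prop)
    [∀ a, DecidablePred (fun i => Q i a)]
    (hQ : ∀ i, MeasurableSet {a | Q i a}) :
    Measurable (fun a => (univ.filter (fun i => Q i a)).card) := by
  classical
  have : (fun a => (univ.filter (fun i => Q i a)).card) = fun a => ∑ i, if Q i a then 1 else 0 := by
    funext a
    rw [card_filter]
  rw [this]
  exact Finset.measurable_sum _ fun i _ => Measurable.ite (hQ i) measurable_const measurable_const

/-- The rank function of a finite set of indices is a bijection with an initial segment. -/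
theorem card_filter_rank {Δ : ℕ} (A : Finset (Fin Δ)) (q : ℕ → Prop) [DecidablePred q] :
    (A.filter (fun i => q (A.filter (· < i)).card)).card = ((range A.card).filter q).card := by
  have hmono : ∀ i ∈ A, ∀ j, i < j → (A.filter (· < i)).card < (A.filter (· < j)).card := by
    intro i hi j hij
    refine card_lt_card ⟨fun k hk => ?_, fun h => ?_⟩
    · rw [mem_filter] at hk ⊢
      exact ⟨hk.1, hk.2.trans hij⟩
    · have := h (mem_filter.2 ⟨hi, hij⟩)
      simp at this
  have hinj : Set.InjOn (fun i => (A.filter (· < i)).card) A := by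
    intro i hi j hj hij
    by_contra hne
    rcases lt_or_gt_of_ne hne with h | h
    · exact (hmono i hi j h).ne hij
    · exact (hmono j hj i h).ne' hij
  have himg : A.image (fun i => (A.filter (· < i)).card) = range A.card := by
    refine eq_of_subset_of_card_le ?_ ?_
    · intro k hk
      obtain ⟨i, hi, rfl⟩ := mem_image.1 hk
      refine mem_range.2 (card_lt_card ⟨filter_subset _ _, fun h => ?_⟩)
      have := h hi
      simp at this
    · rw [card_range, card_image_of_injOn hinj]
  rw [← himg, filter_image, card_image_of_injOn]
  exact hinj.mono (fun i hi => (mem_filter.1 hi).1)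

/-- Ranks `2 * c` and `2 * c + 1` form the pair of color `c`. The only rank without a mate is the
last one for odd `m`, and it is excluded. -/
theorem card_filter_pairing (m c : ℕ) :
    ((range m).filter (fun k => ¬ (Odd m ∧ k + 1 = m) ∧ k / 2 = c)).card = 0 ∨
    ((range m).filter (fun k => ¬ (Odd m ∧ k + 1 = m) ∧ k / 2 = c)).card = 2 := by
  by_cases h : 2 * c + 1 < m
  · right
    have : (range m).filter (fun k => ¬ (Odd m ∧ k + 1 = m) ∧ k / 2 = c) = {2 * c, 2 * c + 1} := by
      ext k
      simp only [mem_filter, mem_range, mem_insert, mem_singleton, Nat.odd_iff]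
      omega
    rw [this, card_pair (by omega)]
  · left
    rw [card_eq_zero, filter_eq_empty_iff]
    intro k hk
    rw [mem_range] at hk
    rw [Nat.odd_iff]
    omega

end Counting

namespace IsHangingForest

open Finset Classical

variable {X : Type u} {Δ : ℕ} (nb : Fin Δ → X → X) (L : Set X) (S P : X → X → Prop)

/-- An approximation to `Unmatched`, which is exact at the vertices with less than `n` generations of
descendants. -/
def unmatchedAux : ℕ → X → Prop
  | 0, _ => False
  | n + 1, x => Even (univ.filter (fun i => P (nb i x) x ∧ unmatchedAux n (nb i x))).card

/-- The vertex is left over by the greedy matching of its proper descendants. -/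
def Unmatched (x : X) : Prop :=
  ∃ N, ∀ n ≥ N, unmatchedAux nb P n x

/-- The ports of `x` that lead to unmatched children. -/
noncomputable def unmatchedPorts (x : X) : Finset (Fin Δ) :=
  univ.filter (fun i => P (nb i x) x ∧ Unmatched nb P (nb i x))

/-- The position of the child `y` among the unmatched children of `x`. -/
noncomputable def childRank (x y : X) : ℕ :=
  (univ.filter (fun i => (P (nb i x) x ∧ Unmatched nb P (nb i x)) ∧ ∃ j, nb j x = y ∧ i < j)).card

/-- The child `y` is the one that is matched with `x`. -/
def IsLast (x y : X) : Prop :=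
  x ∉ L ∧ Odd (unmatchedPorts nb P x).card ∧ childRank nb P x y + 1 = (unmatchedPorts nb P x).card

/-- The pointer at the half-edge `(x, {x, y})`. -/
noncomputable def pointer (x y : X) : Pointer :=
  if P x y ∧ Unmatched nb P x then
    if IsLast nb L P y x then Pointer.adjacent else Pointer.far
  else if (P y x ∧ Unmatched nb P y) ∧ IsLast nb L P x y then Pointer.adjacent else Pointer.idle

/-- The color at the half-edge `(x, {x, y})` if `x` is the midpoint between `y` and its partner. -/
noncomputable def color (hΔ : 2 ≤ Δ) (x y : X) : Fin (Δ / 2) :=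
  ⟨(if x ∈ L then 0 else childRank nb P x y / 2) % (Δ / 2), Nat.mod_lt _ (by omega)⟩

/-- The relay entry at the half-edge `(x, {x, y})`. -/
noncomputable def relay (hΔ : 2 ≤ Δ) (x y : X) : Option (Fin (Δ / 2)) :=
  if (P y x ∧ Unmatched nb P y) ∧ ¬ IsLast nb L P x y then some (color nb L P hΔ x y) else none

/-- The label of the half-edge `(x, {x, y})`. -/
noncomputable def label (hΔ : 2 ≤ Δ) (x y : X) : Option (HopLabel Δ) :=
  if S x y then none else some ⟨pointer nb L P x y, relay nb L P hΔ x y⟩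

/-! ### Validity of the greedy matching -/

section Correct

variable {nb L S P} {G : SimpleGraph X}

/-- By well-founded induction: a vertex stabilizes one generation after the last of its finitely
many children. -/
theorem unmatchedAux_eventually (h : IsHangingForest G L S P) (x : X) :
    ∃ N, ∀ n ≥ N, (unmatchedAux nb P n x ↔ Unmatched nb P x) := by
  suffices H : ∃ N, ∀ n ≥ N, (unmatchedAux nb P n x ↔ unmatchedAux nb P N x) by
    obtain ⟨N, hN⟩ := H
    refine ⟨N, fun n hn => ⟨fun h1 => ⟨N, fun m hm => ?_⟩, fun ⟨M, hM⟩ => ?_⟩⟩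
    · exact (hN m hm).2 ((hN n hn).1 h1)
    · exact (hN n hn).2 ((hN (max N M) (le_max_left _ _)).1 (hM _ (le_max_right _ _)))
  induction x using h.wf.induction with
  | _ x ih =>
    have hex : ∀ i : Fin Δ, ∃ N, P (nb i x) x → ∀ n ≥ N,
        (unmatchedAux nb P n (nb i x) ↔ unmatchedAux nb P N (nb i x)) := by
      intro i
      by_cases hi : P (nb i x) x
      · obtain ⟨N, hN⟩ := ih _ hi
        exact ⟨N, fun _ => hN⟩
      · exact ⟨0, fun hc => absurd hc hi⟩
    choose N hN using hex
    refine ⟨univ.sup N + 1, fun n hn => ?_⟩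
    obtain ⟨n, rfl⟩ : ∃ k, n = k + 1 := ⟨n - 1, by omega⟩
    simp only [unmatchedAux]
    have : univ.filter (fun i => P (nb i x) x ∧ unmatchedAux nb P n (nb i x)) =
        univ.filter (fun i => P (nb i x) x ∧ unmatchedAux nb P (univ.sup N) (nb i x)) := by
      refine filter_congr fun i _ => and_congr_right fun hi => ?_
      have hle : N i ≤ univ.sup N := le_sup (mem_univ i)
      rw [hN i hi n (by omega), hN i hi (univ.sup N) hle]
    rw [this]

/-- The greedy rule itself: the leftover children pair up with each other, and the vertex is used up
exactly when one of them remains single. -/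
theorem unmatched_iff (h : IsHangingForest G L S P) (x : X) :
    Unmatched nb P x ↔ Even (unmatchedPorts nb P x).card := by
  obtain ⟨N, hN⟩ := h.unmatchedAux_eventually (nb := nb) x
  have hex : ∀ i : Fin Δ, ∃ M, ∀ n ≥ M,
      (unmatchedAux nb P n (nb i x) ↔ Unmatched nb P (nb i x)) :=
    fun i => h.unmatchedAux_eventually (nb i x)
  choose M hM using hex
  rw [← hN (max N (univ.sup M) + 1) (by omega)]
  simp only [unmatchedAux, unmatchedPorts]
  have : univ.filter (fun i => P (nb i x) x ∧
        unmatchedAux nb P (max N (univ.sup M)) (nb i x)) =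
      univ.filter (fun i => P (nb i x) x ∧ Unmatched nb P (nb i x)) := by
    refine filter_congr fun i _ => and_congr_right fun hi => ?_
    have hle : M i ≤ univ.sup M := le_sup (mem_univ i)
    rw [hM i _ (hle.trans (le_max_right _ _))]
  rw [this]

theorem childRank_port (hinj : ∀ x, Function.Injective (fun i => nb i x)) (x : X) (i : Fin Δ) :
    childRank nb P x (nb i x) = ((unmatchedPorts nb P x).filter (· < i)).card := by
  rw [childRank, unmatchedPorts, filter_filter]
  congr 1
  refine filter_congr fun k _ => and_congr_right fun _ => ?_
  exact ⟨fun ⟨j, hj, hk⟩ => hinj x hj ▸ hk, fun hk => ⟨i, rfl, hk⟩⟩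

theorem mem_unmatchedPorts {x : X} {i : Fin Δ} :
    i ∈ unmatchedPorts nb P x ↔ P (nb i x) x ∧ Unmatched nb P (nb i x) := by
  simp [unmatchedPorts]

theorem pointer_ne_idle_iff {x y : X} : pointer nb L P x y ≠ Pointer.idle ↔
    (P x y ∧ Unmatched nb P x) ∨ ((P y x ∧ Unmatched nb P y) ∧ IsLast nb L P x y) := by
  rw [pointer]
  split_ifs with h1 h2 h2
  · exact iff_of_true (by simp) (Or.inl h1)
  · exact iff_of_true (by simp) (Or.inl h1)
  · exact iff_of_true (by simp) (Or.inr h2)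
  · exact iff_of_false (by simp) (by tauto)

/-- Only the child can use this edge to be served: it is taken by the parent (adjacent on both
sides), or relayed by it (far against a color), or already matched below (nothing on either side).
-/
theorem compatible_of_parent (h : IsHangingForest G L S P) (hΔ : 2 ≤ Δ) {x y : X} (hyx : P y x) :
    HopLabel.Compatible (Δ := Δ) ⟨pointer nb L P x y, relay nb L P hΔ x y⟩
      ⟨pointer nb L P y x, relay nb L P hΔ y x⟩ := by
  have hxy := h.parent_asymm hyx
  have e1 : relay nb L P hΔ y x = none := by simp [relay, hxy]
  by_cases hU : Unmatched nb P y
  · by_cases hl : IsLast nb L P x y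
    · simp [HopLabel.Compatible, pointer, relay, hxy, hyx, hU, hl]
    · simp [HopLabel.Compatible, pointer, relay, hxy, hyx, hU, hl]
  · simp [HopLabel.Compatible, pointer, relay, hxy, hyx, hU]

theorem compatible (h : IsHangingForest G L S P) (hΔ : 2 ≤ Δ) (x y : X) :
    HopLabel.Compatible (Δ := Δ) ⟨pointer nb L P x y, relay nb L P hΔ x y⟩
      ⟨pointer nb L P y x, relay nb L P hΔ y x⟩ := by
  by_cases hyx : P y x
  · exact h.compatible_of_parent hΔ hyx
  · by_cases hxy : P x y
    · have := h.compatible_of_parent (nb := nb) hΔ hxy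
      exact ⟨this.1.symm, this.2.2, this.2.1⟩
    · simp [HopLabel.Compatible, pointer, relay, hxy, hyx]

theorem isColoring (h : IsHangingForest G L S P) (hΔ : 2 ≤ Δ)
    (hinj : ∀ x, Function.Injective (fun i => nb i x))
    (hadj : ∀ x y, G.Adj x y ↔ ∃ i, nb i x = y) :
    (hopMatching Δ).lineAugment.IsColoring G (fun e => label nb L S P hΔ e.1.1 e.1.2) := by
  constructor
  · intro x
    have hbij : Function.Bijective
        (fun i => (⟨nb i x, (hadj x _).2 ⟨i, rfl⟩⟩ : G.neighborSet x)) := by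
      constructor
      · intro i j hij
        exact hinj x (congrArg Subtype.val hij)
      · rintro ⟨y, hy⟩
        obtain ⟨i, rfl⟩ := (hadj x y).1 hy
        exact ⟨i, rfl⟩
    refine ⟨Equiv.ofBijective _ hbij, ?_⟩
    simp only [Equiv.ofBijective_apply]
    refine (mem_lineAugment_vertexConfigs _).2 ?_
    by_cases hx : x ∈ L
    -- At a line vertex only the number of new labels matters, so all leftover children may be
    -- relayed there with the same color, without being paired.
    · right
      have h2 : (univ.filter (fun i => S x (nb i x))).card = 2 := by
        have e1 : {y | S x y} = ((univ.filter (fun i => S x (nb i x))).image (fun i => nb i x) :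
            Finset X) := by
          ext y
          simp only [Set.mem_ofPred_eq, coe_image, Set.mem_image, coe_filter, mem_univ, true_and]
          constructor
          · intro hy
            obtain ⟨i, rfl⟩ := (hadj x y).1 (h.line_adj hy)
            exact ⟨i, hy, rfl⟩
          · rintro ⟨i, hi, rfl⟩
            exact hi
        have e2 := h.line_encard hx
        rw [e1, Set.encard_coe_eq_coe_finsetCard, card_image_of_injective _ (hinj x)] at e2
        exact_mod_cast e2
      rw [← h2]
      refine congrArg card (filter_congr fun i _ => ?_)
      simp only [label]
      split_ifs with hs <;> simp [hs]
    · left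
      have hS : ∀ y, ¬ S x y := fun y hy => hx (h.line_mem hy)
      set A := unmatchedPorts nb P x with hA
      have hlast : ∀ i, IsLast nb L P x (nb i x) ↔
          (Odd A.card ∧ (A.filter (· < i)).card + 1 = A.card) := by
        intro i
        rw [IsLast, childRank_port hinj]
        exact and_iff_right hx
      refine ⟨fun i => ⟨pointer nb L P x (nb i x), relay nb L P hΔ x (nb i x)⟩,
        fun i => by simp [label, hS], ?_, fun c => ?_⟩
      · simp only [pointer_ne_idle_iff, hlast, ← mem_unmatchedPorts, ← hA]
        -- A leftover vertex has an even number of leftover children, hence no last child, and its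
        -- only pointer goes to its parent. Otherwise the number is odd and the only pointer goes to
        -- the last child.
        by_cases hU : Unmatched nb P x
        · have hev := (h.unmatched_iff x).1 hU
          obtain ⟨y, hy⟩ := h.exists_parent hx
          obtain ⟨i, rfl⟩ := (hadj x y).1 (h.parent_adj hy)
          rw [card_eq_one]
          refine ⟨i, ?_⟩
          ext j
          have hno : ¬ Odd A.card := Nat.not_odd_iff_even.2 hev
          simp only [mem_filter, mem_univ, true_and, hno, mem_singleton, hU, and_true,
            false_and, and_false, or_false]
          exact ⟨fun hj => hinj x (h.parent_unique hj hy), fun hj => hj ▸ hy⟩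
        · have hodd : Odd A.card := by
            rw [← Nat.not_even_iff_odd]
            exact fun hev => hU ((h.unmatched_iff x).2 hev)
          have : univ.filter (fun i => (P x (nb i x) ∧ Unmatched nb P x) ∨
              (i ∈ A ∧ (Odd A.card ∧ (A.filter (· < i)).card + 1 = A.card))) =
              A.filter (fun i => (A.filter (· < i)).card + 1 = A.card) := by
            ext i
            simp [hU, hodd]
          rw [this, card_filter_rank A (fun k => k + 1 = A.card), card_eq_one]
          refine ⟨A.card - 1, ?_⟩
          ext k
          have := hodd.pos
          simp only [mem_filter, mem_range, mem_singleton]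
          omega
      · have hkey : (univ.filter (fun i => relay nb L P hΔ x (nb i x) = some c)).card =
            ((range A.card).filter
              (fun k => ¬ (Odd A.card ∧ k + 1 = A.card) ∧ k / 2 = (c : ℕ))).card := by
          rw [← card_filter_rank A]
          congr 1
          ext i
          simp only [mem_filter, mem_univ, true_and, relay, hlast, ← mem_unmatchedPorts, ← hA]
          by_cases hi : i ∈ A
          · by_cases hl : Odd A.card ∧ (A.filter (· < i)).card + 1 = A.card
            · simp [hl]
            · simp only [hi, hl, not_false_eq_true, and_self, ↓reduceIte, Option.some.injEq,
                true_and, Fin.ext_iff, color, hx, childRank_port hinj, ← hA]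
              -- The reduction modulo `Δ / 2` in `color` has no effect here: the rank belongs to a
              -- complete pair among at most `Δ` children.
              rw [Nat.mod_eq_of_lt]
              have h1 : (A.filter (· < i)).card < A.card :=
                card_lt_card ⟨filter_subset _ _, fun hc => by simpa using hc hi⟩
              have h2 : A.card ≤ Δ := by simpa using card_le_univ A
              rw [Nat.odd_iff] at hl
              omega
          · simp [hi]
        rw [hkey]
        exact card_filter_pairing _ _
  · intro x y hxy
    refine (mem_lineAugment_edgeConfigs _ _).2 ?_
    by_cases hs : S x y
    · right
      simp [label, hs, h.line_symm hs]
    · left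
      have hs' : ¬ S y x := fun hc => hs (h.line_symm hc)
      exact ⟨_, _, if_neg hs, if_neg hs', h.compatible hΔ x y⟩

end Correct

/-! ### Borel measurability of the greedy matching -/

section Measurability

variable [MeasurableSpace X] {nb L S P}

theorem measurableSet_unmatchedAux (hnb : ∀ i, Measurable (nb i))
    (hP : MeasurableSet {p : X × X | P p.1 p.2}) (n : ℕ) :
    MeasurableSet {x | unmatchedAux nb P n x} := by
  induction n with
  | zero => simp [unmatchedAux]
  | succ n ih =>
    have h1 : ∀ i, MeasurableSet {x | P (nb i x) x ∧ unmatchedAux nb P n (nb i x)} := fun i =>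
      (hP.preimage ((hnb i).prodMk measurable_id)).inter (ih.preimage (hnb i))
    exact measurable_card_filter _ h1 (t := {k | Even k}) (.of_discrete)

/-- The finite approximations serve this purpose: the recursion becomes a lower limit of Borel sets.
-/
theorem measurableSet_unmatched (hnb : ∀ i, Measurable (nb i))
    (hP : MeasurableSet {p : X × X | P p.1 p.2}) : MeasurableSet {x | Unmatched nb P x} := by
  simp only [Unmatched, Set.ofPred_exists, Set.ofPred_forall]
  exact MeasurableSet.iUnion fun N => MeasurableSet.iInter fun n => MeasurableSet.iInter fun _ =>
    measurableSet_unmatchedAux hnb hP n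

theorem measurable_label [StandardBorelSpace X] (hΔ : 2 ≤ Δ) (hnb : ∀ i, Measurable (nb i))
    (hL : MeasurableSet L) (hS : MeasurableSet {p : X × X | S p.1 p.2})
    (hP : MeasurableSet {p : X × X | P p.1 p.2}) :
    Measurable[_, ⊤] (fun p : X × X => label nb L S P hΔ p.1 p.2) := by
  have hU := measurableSet_unmatched hnb hP
  have hP' : MeasurableSet {p : X × X | P p.2 p.1} := hP.preimage measurable_swap
  have hport : ∀ i, MeasurableSet {x | P (nb i x) x ∧ Unmatched nb P (nb i x)} := fun i =>
    (hP.preimage ((hnb i).prodMk measurable_id)).inter (hU.preimage (hnb i))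
  have hm : Measurable (fun x => (unmatchedPorts nb P x).card) := measurable_card_filter _ hport
  have hr : Measurable (fun p : X × X => childRank nb P p.1 p.2) := by
    refine measurable_card_filter (fun i (p : X × X) =>
      (P (nb i p.1) p.1 ∧ Unmatched nb P (nb i p.1)) ∧ ∃ j, nb j p.1 = p.2 ∧ i < j) fun i => ?_
    refine ((hport i).preimage measurable_fst).inter ?_
    change MeasurableSet {p : X × X | ∃ j, nb j p.1 = p.2 ∧ i < j}
    rw [Set.ofPred_exists]
    refine MeasurableSet.iUnion fun j => MeasurableSet.inter ?_ (MeasurableSet.const _)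
    exact measurableSet_eq_fun ((hnb j).comp measurable_fst) measurable_snd
  have hlast : MeasurableSet {p : X × X | IsLast nb L P p.1 p.2} := by
    refine (hL.compl.preimage measurable_fst).inter (MeasurableSet.inter ?_ ?_)
    · exact (hm.comp measurable_fst) (t := {k | Odd k}) (.of_discrete)
    · exact measurableSet_eq_fun (hr.add_const 1) (hm.comp measurable_fst)
  have hlast' : MeasurableSet {p : X × X | IsLast nb L P p.2 p.1} := hlast.preimage measurable_swap
  have hPU : MeasurableSet {p : X × X | P p.1 p.2 ∧ Unmatched nb P p.1} :=
    hP.inter (hU.preimage measurable_fst)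
  have hPU' : MeasurableSet {p : X × X | P p.2 p.1 ∧ Unmatched nb P p.2} :=
    hPU.preimage measurable_swap
  have hpt : Measurable[_, ⊤] (fun p : X × X => pointer nb L P p.1 p.2) := by
    let _ : MeasurableSpace Pointer := ⊤
    exact Measurable.ite hPU (Measurable.ite hlast' measurable_const measurable_const)
      (Measurable.ite (hPU'.inter hlast) measurable_const measurable_const)
  have hcol : Measurable[_, ⊤] (fun p : X × X => some (color nb L P hΔ p.1 p.2)) := by
    let _ : MeasurableSpace (Option (Fin (Δ / 2))) := ⊤
    have h1 : Measurable (fun p : X × X => if p.1 ∈ L then 0 else childRank nb P p.1 p.2 / 2) :=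
      Measurable.ite (hL.preimage measurable_fst) measurable_const
        ((measurable_of_countable (fun k : ℕ => k / 2)).comp hr)
    exact (measurable_of_countable (fun k : ℕ =>
      some (⟨k % (Δ / 2), Nat.mod_lt _ (by omega)⟩ : Fin (Δ / 2)))).comp h1
  have hrel : Measurable[_, ⊤] (fun p : X × X => relay nb L P hΔ p.1 p.2) := by
    let _ : MeasurableSpace (Option (Fin (Δ / 2))) := ⊤
    exact Measurable.ite (hPU'.inter hlast.compl) hcol measurable_const
  have hfin : Finite (Option (HopLabel Δ)) := by
    have := finite_hopLabel Δ
    infer_instance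
  let _ : MeasurableSpace (Option (HopLabel Δ)) := ⊤
  refine Measurable.ite hS measurable_const (measurable_to_countable' fun a => ?_)
  rcases a with _ | ⟨p, r⟩
  · convert MeasurableSet.empty
    ext
    simp
  · have h1 : MeasurableSet {z : X × X | pointer nb L P z.1 z.2 = p} :=
      hpt (MeasurableSpace.measurableSet_top (s := {p}))
    have h2 : MeasurableSet {z : X × X | relay nb L P hΔ z.1 z.2 = r} :=
      hrel (MeasurableSpace.measurableSet_top (s := {r}))
    convert h1.inter h2
    ext
    simp

end Measurability

end IsHangingForest

/-! ### Thinning out a forest by cutting segments -/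

section Segments

open Finset Classical

variable {X : Type u} {Δ : ℕ} (nb : Fin Δ → X → X)

/-- The number of ports of `x` whose edges belong to `E`. -/
noncomputable def portDegree (E : X → X → Prop) (x : X) : ℕ :=
  (univ.filter (fun i => E x (nb i x))).card

/-- The sequence of vertices that starts in `x` and follows the ports in the sequence `w`. -/
def portPath (w : ℕ → Fin Δ) (x : X) : ℕ → X
  | 0 => x
  | j + 1 => nb (w j) (portPath w x j)

/-- The first `l` steps along `w` from `u` give a path of `E` whose endpoints have degree at least
`3` and whose inner vertices have degree `2`. -/
structure IsSegment (E : X → X → Prop) (w : ℕ → Fin Δ) (l : ℕ) (u : X) : Prop where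
  len_pos : 0 < l
  adj : ∀ j < l, E (portPath nb w u j) (portPath nb w u (j + 1))
  ne : ∀ j, j + 1 < l → portPath nb w u j ≠ portPath nb w u (j + 2)
  start_degree : 3 ≤ portDegree nb E u
  end_degree : 3 ≤ portDegree nb E (portPath nb w u l)
  inner_degree : ∀ j, 0 < j → j < l → portDegree nb E (portPath nb w u j) = 2

/-- A round of the construction: segments of length `len` along `word` that start in `start` are cut
out. -/
structure CutRound (Δ : ℕ) (X : Type u) where
  word : ℕ → Fin Δ
  len : ℕ
  start : Set X

/-! ### A single round of cutting -/

namespace CutRound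

variable (R : CutRound Δ X) (E : X → X → Prop)

/-- The paths of the round with different starting points are disjoint. -/
def Separated : Prop :=
  ∀ u ∈ R.start, ∀ u' ∈ R.start, ∀ j ≤ R.len, ∀ j' ≤ R.len,
    portPath nb R.word u j = portPath nb R.word u' j' → u = u'

/-- The starting points of the segments that are cut out. -/
def selected : Set X := {u | u ∈ R.start ∧ IsSegment nb E R.word R.len u}

/-- The directed edges of the segments that are cut out. -/
def Cut (x y : X) : Prop :=
  ∃ j < R.len, ∃ u ∈ R.selected nb E,
    (portPath nb R.word u j, portPath nb R.word u (j + 1)) = (x, y)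

/-- The edges from inner vertices of the segments to their successors. -/
def Hang (j : ℕ) (x y : X) : Prop :=
  0 < j ∧ j < R.len ∧ ∃ u ∈ R.selected nb E,
    (portPath nb R.word u j, portPath nb R.word u (j + 1)) = (x, y)

/-- The inner vertices of the segments. -/
def Inner (j : ℕ) (x : X) : Prop :=
  0 < j ∧ j < R.len ∧ ∃ u ∈ R.selected nb E, portPath nb R.word u j = x

/-- The edges that remain after the round. -/
def trim (x y : X) : Prop := E x y ∧ ¬ (R.Cut nb E x y ∨ R.Cut nb E y x)

variable {nb R E} {G : SimpleGraph X}

theorem portPath_ne (hG : G.IsAcyclic) (hE : ∀ x y, E x y → G.Adj x y) {u : X}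
    (hu : u ∈ R.selected nb E) {a b : ℕ} (hab : a < b) (hb : b ≤ R.len) :
    portPath nb R.word u a ≠ portPath nb R.word u b :=
  hG.ne_of_nonbacktracking (portPath nb R.word u) R.len
    (fun j hj => hE _ _ (hu.2.adj j hj)) (fun j hj => hu.2.ne j hj) hab hb

theorem Separated.eq_of_portPath_eq (hR : R.Separated nb) (hG : G.IsAcyclic)
    (hE : ∀ x y, E x y → G.Adj x y) {u u' : X} (hu : u ∈ R.selected nb E)
    (hu' : u' ∈ R.selected nb E) {j j' : ℕ} (hj : j ≤ R.len) (hj' : j' ≤ R.len)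
    (h : portPath nb R.word u j = portPath nb R.word u' j') : u = u' ∧ j = j' := by
  obtain rfl := hR u hu.1 u' hu'.1 j hj j' hj' h
  refine ⟨rfl, ?_⟩
  by_contra hne
  rcases lt_or_gt_of_ne hne with hlt | hlt
  · exact portPath_ne hG hE hu hlt hj' h
  · exact portPath_ne hG hE hu hlt hj h.symm

theorem trim_symm (hE : ∀ x y, E x y → E y x) {x y : X} (h : R.trim nb E x y) :
    R.trim nb E y x :=
  ⟨hE _ _ h.1, fun hc => h.2 hc.symm⟩

/-- An inner vertex has degree 2, and both of its edges belong to the segment and are cut, so it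
becomes isolated. -/
theorem Inner.not_trim (hinj : ∀ x, Function.Injective (fun i => nb i x))
    (hadj : ∀ x y, G.Adj x y ↔ ∃ i, nb i x = y) (hE : ∀ x y, E x y → G.Adj x y)
    (hEs : ∀ x y, E x y → E y x) {j : ℕ} {x y : X} (h : R.Inner nb E j x) :
    ¬ R.trim nb E x y := by
  rintro ⟨hxy, hcut⟩
  obtain ⟨h0, hl, u, hu, rfl⟩ := h
  obtain ⟨j, rfl⟩ : ∃ k, j = k + 1 := ⟨j - 1, by omega⟩
  set x := portPath nb R.word u (j + 1)
  have hprev : E x (portPath nb R.word u j) := hEs _ _ (hu.2.adj j (by omega))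
  have hnext : E x (portPath nb R.word u (j + 2)) := hu.2.adj (j + 1) hl
  have hy1 : y ≠ portPath nb R.word u j := by
    rintro rfl
    exact hcut (Or.inr ⟨j, by omega, u, hu, rfl⟩)
  have hy2 : y ≠ portPath nb R.word u (j + 2) := by
    rintro rfl
    exact hcut (Or.inl ⟨j + 1, hl, u, hu, rfl⟩)
  have h12 := hu.2.ne j hl
  have hdeg : portDegree nb E x = 2 := hu.2.inner_degree (j + 1) h0 hl
  have h3 : ({y, portPath nb R.word u j, portPath nb R.word u (j + 2)} : Finset X).card = 3 :=
    Finset.card_eq_three.2 ⟨_, _, _, hy1, hy2, h12, rfl⟩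
  have hsub : ({y, portPath nb R.word u j, portPath nb R.word u (j + 2)} : Finset X) ⊆
      (univ.filter (fun i => E x (nb i x))).image (fun i => nb i x) := by
    intro z hz
    have hxz : E x z := by
      simp only [mem_insert, mem_singleton] at hz
      rcases hz with rfl | rfl | rfl <;> assumption
    obtain ⟨i, rfl⟩ := (hadj x z).1 (hE _ _ hxz)
    exact mem_image.2 ⟨i, by simpa using hxz, rfl⟩
  have := card_le_card hsub
  rw [h3, card_image_of_injective _ (hinj x)] at this
  change 3 ≤ portDegree nb E x at this
  omega

/-- A vertex that is not inner can lose edges only as an endpoint, and then its degree was at least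
3. By separation it is an endpoint of one segment only and at one end only, so it loses a single
edge. -/
theorem two_le_portDegree_trim (hR : R.Separated nb) (hG : G.IsAcyclic)
    (hinj : ∀ x, Function.Injective (fun i => nb i x)) (hE : ∀ x y, E x y → G.Adj x y)
    {x : X} (hx : ∀ j, ¬ R.Inner nb E j x) (hd : 2 ≤ portDegree nb E x) :
    2 ≤ portDegree nb (R.trim nb E) x := by
  by_cases hcut : ∃ y, R.Cut nb E x y ∨ R.Cut nb E y x
  swap
  · push Not at hcut
    refine hd.trans (card_le_card fun i hi => ?_)
    simp only [mem_filter, mem_univ, true_and] at hi ⊢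
    exact ⟨hi, not_or.2 (hcut _)⟩
  obtain ⟨y, hy⟩ := hcut
  have hform : ∀ z, R.Cut nb E x z ∨ R.Cut nb E z x → ∃ u ∈ R.selected nb E,
      (x = portPath nb R.word u 0 ∧ z = portPath nb R.word u 1) ∨
      (x = portPath nb R.word u R.len ∧ z = portPath nb R.word u (R.len - 1)) := by
    rintro z (⟨j, hj, u, hu, he⟩ | ⟨j, hj, u, hu, he⟩)
    · obtain ⟨rfl, rfl⟩ := Prod.mk.inj he
      refine ⟨u, hu, Or.inl ?_⟩
      obtain rfl : j = 0 := by
        by_contra h0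
        exact hx j ⟨by omega, hj, u, hu, rfl⟩
      exact ⟨rfl, rfl⟩
    · obtain ⟨rfl, rfl⟩ := Prod.mk.inj he
      refine ⟨u, hu, Or.inr ?_⟩
      have h0 : j + 1 = R.len := by
        by_contra h0
        exact hx (j + 1) ⟨by omega, by omega, u, hu, rfl⟩
      rw [← h0]
      exact ⟨rfl, rfl⟩
  have h3 : 3 ≤ portDegree nb E x := by
    obtain ⟨u, hu, ⟨rfl, -⟩ | ⟨rfl, -⟩⟩ := hform y hy
    · exact hu.2.start_degree
    · exact hu.2.end_degree
  have huniq : ∀ z, R.Cut nb E x z ∨ R.Cut nb E z x → z = y := by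
    intro z hz
    obtain ⟨u, hu, hxu⟩ := hform y hy
    obtain ⟨v, hv, hxv⟩ := hform z hz
    have hl := hu.2.len_pos
    rcases hxu with ⟨e1, rfl⟩ | ⟨e1, rfl⟩ <;> rcases hxv with ⟨e2, rfl⟩ | ⟨e2, rfl⟩
    · rw [(hR.eq_of_portPath_eq hG hE hu hv (Nat.zero_le _) (Nat.zero_le _) (e1.symm.trans e2)).1]
    · have := (hR.eq_of_portPath_eq hG hE hu hv (Nat.zero_le _) le_rfl (e1.symm.trans e2)).2
      omega
    · have := (hR.eq_of_portPath_eq hG hE hu hv le_rfl (Nat.zero_le _) (e1.symm.trans e2)).2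
      omega
    · rw [(hR.eq_of_portPath_eq hG hE hu hv le_rfl le_rfl (e1.symm.trans e2)).1]
  have hle : portDegree nb E x ≤ portDegree nb (R.trim nb E) x + 1 := by
    rw [portDegree, portDegree]
    have hsub : univ.filter (fun i => E x (nb i x)) ⊆
        univ.filter (fun i => R.trim nb E x (nb i x)) ∪ univ.filter (fun i => nb i x = y) := by
      intro i hi
      simp only [mem_filter, mem_univ, true_and, mem_union] at hi ⊢
      by_cases hc : R.Cut nb E x (nb i x) ∨ R.Cut nb E (nb i x) x
      · exact Or.inr (huniq _ hc)
      · exact Or.inl ⟨hi, hc⟩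
    refine (card_le_card hsub).trans ((card_union_le _ _).trans (Nat.add_le_add_left ?_ _))
    refine card_le_one.2 fun i hi j hj => hinj x ?_
    simp only [mem_filter, mem_univ, true_and] at hi hj
    exact hi.trans hj.symm
  omega

end CutRound

/-- The edges that remain after `n` rounds. -/
def remaining (G : SimpleGraph X) (R : ℕ → CutRound Δ X) : ℕ → X → X → Prop
  | 0 => G.Adj
  | n + 1 => (R n).trim nb (remaining G R n)

/-- The edges that remain after all rounds. -/
def remainingLimit (G : SimpleGraph X) (R : ℕ → CutRound Δ X) (x y : X) : Prop :=
  ∀ n, remaining nb G R n x y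

/-- The vertex `x` is hung on `y` in some round. -/
def Hung (G : SimpleGraph X) (R : ℕ → CutRound Δ X) (x y : X) : Prop :=
  ∃ n j, (R n).Hang nb (remaining nb G R n) j x y

/-- The vertex is removed in some round. -/
def Removed (G : SimpleGraph X) (R : ℕ → CutRound Δ X) (x : X) : Prop :=
  ∃ n j, (R n).Inner nb (remaining nb G R n) j x

/-- Assumptions under which the rounds produce a hanging forest. -/
structure IsCutSequence (G : SimpleGraph X) (R : ℕ → CutRound Δ X) : Prop where
  acyclic : G.IsAcyclic
  two_le : 2 ≤ Δ
  injective : ∀ x, Function.Injective (fun i => nb i x)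
  adj_iff : ∀ x y, G.Adj x y ↔ ∃ i, nb i x = y
  separated : ∀ n, (R n).Separated nb
  rich : ∀ (w : ℕ → Fin Δ) (l : ℕ) (u : X) (N : ℕ), ∃ n ≥ N, (R n).len = l ∧
    (∀ j < l, (R n).word j = w j) ∧ u ∈ (R n).start

/-! ### Infinitely many rounds and their limit -/

namespace IsCutSequence

variable {nb} {G : SimpleGraph X} {R : ℕ → CutRound Δ X} (h : IsCutSequence nb G R)

theorem remaining_antitone {m n : ℕ} (hmn : m ≤ n) {x y : X} (hxy : remaining nb G R n x y) :
    remaining nb G R m x y := by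
  induction n, hmn using Nat.le_induction with
  | base => exact hxy
  | succ n _ ih => exact ih hxy.1

theorem remaining_adj {n : ℕ} (x y : X) (hxy : remaining nb G R n x y) : G.Adj x y :=
  remaining_antitone (Nat.zero_le n) hxy

theorem remaining_symm (n : ℕ) (x y : X) (hxy : remaining nb G R n x y) :
    remaining nb G R n y x := by
  induction n generalizing x y with
  | zero => exact G.symm.symm _ _ hxy
  | succ n ih => exact CutRound.trim_symm ih hxy

include h

theorem not_remaining_of_inner {n j : ℕ} {x : X} (hx : (R n).Inner nb (remaining nb G R n) j x)
    {m : ℕ} (hm : n < m) (y : X) : ¬ remaining nb G R m x y := fun hxy =>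
  hx.not_trim h.injective h.adj_iff remaining_adj (remaining_symm n)
    (remaining_antitone (m := n + 1) hm hxy : remaining nb G R (n + 1) x y)

theorem two_le_portDegree {x : X} (hx : ¬ Removed nb G R x) (n : ℕ) :
    2 ≤ portDegree nb (remaining nb G R n) x := by
  induction n with
  | zero =>
    have : univ.filter (fun i => remaining nb G R 0 x (nb i x)) = univ :=
      filter_true_of_mem fun i _ => (h.adj_iff x _).2 ⟨i, rfl⟩
    rw [portDegree, this, card_univ, Fintype.card_fin]
    exact h.two_le
  | succ n ih =>
    exact CutRound.two_le_portDegree_trim (h.separated n) h.acyclic h.injective remaining_adj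
      (fun j hj => hx ⟨n, j, hj⟩) ih

/-- The round and the position at which an inner vertex occurs are unique. -/
theorem inner_unique {n n' j j' : ℕ} {u u' : X}
    (hu : u ∈ (R n).selected nb (remaining nb G R n))
    (hu' : u' ∈ (R n').selected nb (remaining nb G R n')) (h0 : 0 < j) (hl : j < (R n).len)
    (h0' : 0 < j') (hl' : j' < (R n').len)
    (he : portPath nb (R n).word u j = portPath nb (R n').word u' j') :
    n = n' ∧ j = j' ∧ portPath nb (R n).word u (j + 1) = portPath nb (R n').word u' (j' + 1) := by
  obtain rfl : n = n' := by
    by_contra hne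
    rcases lt_or_gt_of_ne hne with hlt | hlt
    · exact h.not_remaining_of_inner ⟨h0, hl, u, hu, he⟩ hlt _ (hu'.2.adj j' hl')
    · exact h.not_remaining_of_inner ⟨h0', hl', u', hu', he.symm⟩ hlt _ (hu.2.adj j hl)
  obtain ⟨rfl, rfl⟩ := (h.separated n).eq_of_portPath_eq h.acyclic remaining_adj hu hu' hl.le
    hl'.le he
  exact ⟨rfl, rfl, rfl⟩

theorem hung_unique {x y z : X} (hy : Hung nb G R x y) (hz : Hung nb G R x z) : y = z := by
  obtain ⟨n, j, h0, hl, u, hu, he⟩ := hy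
  obtain ⟨n', j', h0', hl', u', hu', he'⟩ := hz
  obtain ⟨rfl, rfl⟩ := Prod.mk.inj he
  obtain ⟨e, rfl⟩ := Prod.mk.inj he'
  exact (h.inner_unique hu hu' h0 hl h0' hl' e.symm).2.2

omit h in
theorem hung_adj {x y : X} (hy : Hung nb G R x y) : G.Adj x y := by
  obtain ⟨n, j, h0, hl, u, hu, he⟩ := hy
  obtain ⟨rfl, rfl⟩ := Prod.mk.inj he
  exact remaining_adj _ _ (hu.2.adj j hl)

omit h in
theorem exists_hung {x : X} (hx : Removed nb G R x) : ∃ y, Hung nb G R x y := by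
  obtain ⟨n, j, h0, hl, u, hu, rfl⟩ := hx
  exact ⟨_, n, j, h0, hl, u, hu, rfl⟩

omit h in
theorem removed_of_hung {x y : X} (hy : Hung nb G R x y) : Removed nb G R x := by
  obtain ⟨n, j, h0, hl, u, hu, he⟩ := hy
  exact ⟨n, j, h0, hl, u, hu, (Prod.mk.inj he).1⟩

theorem not_removed_left {x y : X} (hxy : remainingLimit nb G R x y) : ¬ Removed nb G R x := by
  rintro ⟨n, j, hj⟩
  exact h.not_remaining_of_inner hj (Nat.lt_succ_self n) y (hxy (n + 1))

omit h in
theorem remainingLimit_symm {x y : X} (hxy : remainingLimit nb G R x y) :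
    remainingLimit nb G R y x := fun n => remaining_symm n _ _ (hxy n)

/-- The vertices that are hung on an inner vertex are inner vertices of an earlier round, or precede
it in the same segment. -/
theorem hung_inner {n j : ℕ} {x y : X} (hy : (R n).Inner nb (remaining nb G R n) j y)
    (hxy : Hung nb G R x y) : ∃ n' j', (n' < n ∨ n' = n ∧ j' < j) ∧
      (R n').Inner nb (remaining nb G R n') j' x := by
  obtain ⟨n', j', h0', hl', u', hu', he'⟩ := hxy
  obtain ⟨rfl, rfl⟩ := Prod.mk.inj he'
  refine ⟨n', j', ?_, h0', hl', u', hu', rfl⟩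
  obtain ⟨h0, hl, u, hu, e⟩ := id hy
  by_cases hlast : j' + 1 < (R n').len
  · obtain ⟨rfl, rfl, -⟩ := h.inner_unique hu hu' h0 hl (Nat.succ_pos j') hlast e
    exact Or.inr ⟨rfl, Nat.lt_succ_self j'⟩
  -- Here `y` is the endpoint of the segment that contains `x`. In the same round this contradicts
  -- separation, and in a later round `y` is already isolated.
  · have hend : j' + 1 = (R n').len := by omega
    rcases lt_trichotomy n' n with hlt | rfl | hlt
    · exact Or.inl hlt
    · have := ((h.separated n').eq_of_portPath_eq h.acyclic remaining_adj hu hu' hl.le hend.le e).2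
      omega
    · exact absurd (remaining_symm n' _ _ (hu'.2.adj j' hl')) (h.not_remaining_of_inner hy hlt _)

omit h in
/-- After finitely many rounds the edges at a vertex do not change any more. -/
theorem remaining_eventually (x : X) : ∃ N, ∀ n ≥ N, ∀ i,
    (remaining nb G R n x (nb i x) ↔ remainingLimit nb G R x (nb i x)) := by
  have hex : ∀ i, ∃ N, ∀ n ≥ N,
      (remaining nb G R n x (nb i x) ↔ remainingLimit nb G R x (nb i x)) := by
    intro i
    by_cases hi : remainingLimit nb G R x (nb i x)
    · exact ⟨0, fun n _ => ⟨fun _ => hi, fun _ => hi n⟩⟩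
    · obtain ⟨N, hN⟩ := not_forall.1 hi
      exact ⟨N, fun n hn => ⟨fun hc => absurd (remaining_antitone hn hc) hN, fun hc => absurd hc hi⟩⟩
  choose N hN using hex
  exact ⟨univ.sup N, fun n hn i => hN i n ((le_sup (mem_univ i)).trans hn)⟩

omit h in
theorem portDegree_eventually (x : X) : ∃ N, ∀ n ≥ N,
    portDegree nb (remaining nb G R n) x = portDegree nb (remainingLimit nb G R) x := by
  obtain ⟨N, hN⟩ := remaining_eventually (nb := nb) (G := G) (R := R) x
  exact ⟨N, fun n hn => congrArg card (filter_congr fun i _ => hN n hn i)⟩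

theorem two_le_portDegree_limit {x : X} (hx : ¬ Removed nb G R x) :
    2 ≤ portDegree nb (remainingLimit nb G R) x := by
  obtain ⟨N, hN⟩ := portDegree_eventually (nb := nb) (G := G) (R := R) x
  rw [← hN N le_rfl]
  exact h.two_le_portDegree hx N

omit h in
/-- The graph of the edges that remain after all rounds. -/
def limitGraph (nb : Fin Δ → X → X) (G : SimpleGraph X) (R : ℕ → CutRound Δ X) :
    SimpleGraph X where
  Adj := remainingLimit nb G R
  symm := ⟨fun _ _ => remainingLimit_symm⟩
  loopless := ⟨fun _ hx => (hx 0).ne rfl⟩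

omit h in
theorem limitGraph_le : limitGraph nb G R ≤ G := fun _ _ hxy => hxy 0

/-- A component of the limit graph has at most one vertex of degree at least `3`. -/
theorem branching_unique {b b' : X} (hb : 3 ≤ portDegree nb (remainingLimit nb G R) b)
    (hb' : 3 ≤ portDegree nb (remainingLimit nb G R) b')
    (hr : (limitGraph nb G R).Reachable b b') : b = b' := by
  obtain ⟨p₀⟩ := hr
  -- Strong induction on the length reduces to a closest pair of branching vertices: a branching
  -- vertex inside the path would give a shorter path from `b`.
  suffices H : ∀ (l : ℕ) (b' : X), 3 ≤ portDegree nb (remainingLimit nb G R) b' →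
      ∀ p : (limitGraph nb G R).Walk b b', p.IsPath → p.length = l → b = b' from
    H _ b' hb' p₀.bypass p₀.bypass_isPath rfl
  intro l
  induction l using Nat.strong_induction_on with
  | _ l ih =>
    intro b' hb' p hp hl
    by_contra hne
    have hl0 : 0 < l := by
      rw [← hl]
      exact SimpleGraph.Walk.not_nil_iff_lt_length.1 (SimpleGraph.Walk.not_nil_of_ne hne)
    have hinner : ∀ j, 0 < j → j < l →
        portDegree nb (remainingLimit nb G R) (p.getVert j) = 2 := by
      intro j h0 hj
      have h2 : 2 ≤ portDegree nb (remainingLimit nb G R) (p.getVert j) :=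
        h.two_le_portDegree_limit (h.not_removed_left (p.adj_getVert_succ (hl.symm ▸ hj)))
      by_contra h3
      have := ih j hj (p.getVert j) (by omega) (p.take j) (hp.take j)
        (by rw [SimpleGraph.Walk.take_length]; omega)
      have h4 := hp.getVert_injOn (show (0 : ℕ) ∈ {i | i ≤ p.length} from Nat.zero_le _)
        (show j ∈ {i | i ≤ p.length} from hl.symm ▸ hj.le) (by simpa using this)
      omega
    have hport : ∀ j, ∃ i, j < l → nb i (p.getVert j) = p.getVert (j + 1) := by
      intro j
      by_cases hj : j < l
      · obtain ⟨i, hi⟩ := (h.adj_iff _ _).1 (limitGraph_le (p.adj_getVert_succ (hl.symm ▸ hj)))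
        exact ⟨i, fun _ => hi⟩
      · exact ⟨⟨0, lt_of_lt_of_le Nat.zero_lt_two h.two_le⟩, fun hc => absurd hc hj⟩
    choose w hw using hport
    choose N hN using portDegree_eventually (nb := nb) (G := G) (R := R)
    -- This round offers the path and comes after the degrees of all its vertices have become final.
    -- So the path is a segment at that time, and its first edge is cut, although it was assumed to
    -- survive.
    obtain ⟨n, hn, hlen, hword, hstart⟩ := h.rich w l b ((range (l + 1)).sup fun j => N (p.getVert j))
    have hdeg : ∀ j ≤ l, portDegree nb (remaining nb G R n) (p.getVert j) =
        portDegree nb (remainingLimit nb G R) (p.getVert j) := fun j hj =>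
      hN _ n ((le_sup (f := fun j => N (p.getVert j)) (mem_range.2 (by omega))).trans hn)
    have hpath : ∀ j ≤ l, portPath nb (R n).word b j = p.getVert j := by
      intro j hj
      induction j with
      | zero => simp [portPath]
      | succ j ihj => rw [portPath, ihj (by omega), hword j (by omega), hw j (by omega)]
    have hend : p.getVert l = b' := by rw [← hl, SimpleGraph.Walk.getVert_length]
    have hadj : ∀ j < l, remainingLimit nb G R (p.getVert j) (p.getVert (j + 1)) := fun j hj =>
      p.adj_getVert_succ (hl.symm ▸ hj)
    have hseg : IsSegment nb (remaining nb G R n) (R n).word (R n).len b := by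
      rw [hlen]
      refine ⟨hl0, fun j hj => ?_, fun j hj => ?_, ?_, ?_, fun j h0 hj => ?_⟩
      · rw [hpath j hj.le, hpath (j + 1) hj]
        exact hadj j hj n
      · rw [hpath j (by omega), hpath (j + 2) (by omega)]
        intro he
        have := hp.getVert_injOn (show j ∈ {i | i ≤ p.length} from
          (show j ≤ p.length by omega)) (show j + 2 ∈ {i | i ≤ p.length} from
          (show j + 2 ≤ p.length by omega)) he
        omega
      · have := hdeg 0 (Nat.zero_le _)
        rw [SimpleGraph.Walk.getVert_zero] at this
        rw [this]
        exact hb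
      · rw [hpath l le_rfl, hdeg l le_rfl, hend]
        exact hb'
      · rw [hpath j hj.le, hdeg j hj.le, hinner j h0 hj]
    have h01 := hadj 0 hl0 (n + 1)
    refine h01.2 (Or.inl ⟨0, hlen.symm ▸ hl0, b, ⟨hstart, hseg⟩, ?_⟩)
    rw [hpath 0 (Nat.zero_le _), hpath (0 + 1) hl0]

end IsCutSequence

end Segments

/-! ### The hanging forest of a cut sequence -/

section Limit

open Finset Classical

variable {X : Type u} {Δ : ℕ} (nb : Fin Δ → X → X) (G : SimpleGraph X) (R : ℕ → CutRound Δ X)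

/-- The vertices at distance at most `m` from a branching vertex of the limit graph. -/
def NearBranching : ℕ → X → Prop
  | 0, x => 3 ≤ portDegree nb (remainingLimit nb G R) x
  | m + 1, x => NearBranching m x ∨
      ∃ i, remainingLimit nb G R x (nb i x) ∧ NearBranching m (nb i x)

/-- The edge from `x` to `y` of the limit graph leads away from the branching vertex. -/
def LeadsAway (x y : X) : Prop :=
  remainingLimit nb G R x y ∧ ∃ m, NearBranching nb G R m x ∧ ¬ NearBranching nb G R m y

/-- The vertex `y` is the first neighbor of `x` that is farther away from the branching vertex. -/
def FirstAway (x y : X) : Prop :=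
  ∃ i, nb i x = y ∧ LeadsAway nb G R x (nb i x) ∧ ∀ i' < i, ¬ LeadsAway nb G R x (nb i' x)

/-- The vertices on the lines of the limit graph that are components. -/
def limitLines : Set X :=
  {x | ¬ Removed nb G R x ∧ ∀ m, ¬ NearBranching nb G R m x}

namespace IsCutSequence

variable {nb G R} (h : IsCutSequence nb G R)

theorem nearBranching_mono {m n : ℕ} (hmn : m ≤ n) {x : X} (hx : NearBranching nb G R m x) :
    NearBranching nb G R n x := by
  induction n, hmn using Nat.le_induction with
  | base => exact hx
  | succ n _ ih => exact Or.inl ih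

theorem NearBranching.exists_walk {m : ℕ} {x : X} (hx : NearBranching nb G R m x) :
    ∃ b, 3 ≤ portDegree nb (remainingLimit nb G R) b ∧
      ∃ p : (limitGraph nb G R).Walk x b, p.length ≤ m := by
  induction m generalizing x with
  | zero => exact ⟨x, hx, SimpleGraph.Walk.nil, le_rfl⟩
  | succ m ih =>
    rcases hx with hx | ⟨i, hi, hx⟩
    · obtain ⟨b, hb, p, hp⟩ := ih hx
      exact ⟨b, hb, p, by omega⟩
    · obtain ⟨b, hb, p, hp⟩ := ih hx
      exact ⟨b, hb, SimpleGraph.Walk.cons hi p, Nat.succ_le_succ hp⟩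

include h

theorem nearBranching_succ {m : ℕ} {x y : X} (hxy : remainingLimit nb G R x y)
    (hy : NearBranching nb G R m y) : NearBranching nb G R (m + 1) x := by
  obtain ⟨i, rfl⟩ := (h.adj_iff x y).1 (hxy 0)
  exact Or.inr ⟨i, hxy, hy⟩

theorem nearBranching_of_walk {x b : X} (hb : 3 ≤ portDegree nb (remainingLimit nb G R) b)
    (p : (limitGraph nb G R).Walk x b) : NearBranching nb G R p.length x := by
  induction p with
  | nil => exact hb
  | cons hadj p ih => exact h.nearBranching_succ hadj (ih hb)

/-- A surviving vertex has two remaining edges. If neither led away from the branching vertex, each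
would start a path to a branching vertex; there is only one in the component, and the two paths
would contradict acyclicity. -/
theorem exists_leadsAway {x : X} (hx : ¬ Removed nb G R x) {m : ℕ}
    (hm : NearBranching nb G R m x) : ∃ i, LeadsAway nb G R x (nb i x) := by
  have hdeg := h.two_le_portDegree_limit hx
  obtain ⟨i₁, hi₁, i₂, hi₂, hne⟩ := one_lt_card.1 (show 1 < _ from hdeg)
  simp only [mem_filter, mem_univ, true_and] at hi₁ hi₂
  have hex : ∃ m, NearBranching nb G R m x := ⟨m, hm⟩
  obtain ⟨d, hd⟩ : ∃ d, d = Nat.find hex := ⟨_, rfl⟩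
  have hdx : NearBranching nb G R d x := hd ▸ Nat.find_spec hex
  by_cases h1 : NearBranching nb G R d (nb i₁ x)
  swap
  · exact ⟨i₁, hi₁, d, hdx, h1⟩
  by_cases h2 : NearBranching nb G R d (nb i₂ x)
  swap
  · exact ⟨i₂, hi₂, d, hdx, h2⟩
  exfalso
  -- A walk of length at most `d` from the neighbor that returned to `x` would leave fewer than `d`
  -- steps from `x` to a branching vertex, against the minimality of `d`.
  have hpath : ∀ i, remainingLimit nb G R x (nb i x) → NearBranching nb G R d (nb i x) →
      ∃ b, 3 ≤ portDegree nb (remainingLimit nb G R) b ∧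
        ∃ p : (limitGraph nb G R).Walk (nb i x) b, p.IsPath ∧ x ∉ p.support := by
    intro i hi hn
    obtain ⟨b, hb, p, hp⟩ := NearBranching.exists_walk hn
    refine ⟨b, hb, p.bypass, p.bypass_isPath, fun hmem => ?_⟩
    have hnil : ¬ (p.bypass.takeUntil x hmem).Nil :=
      SimpleGraph.Walk.not_nil_of_ne (G := limitGraph nb G R) (hi 0).ne'
    have hpos := SimpleGraph.Walk.not_nil_iff_lt_length.1 hnil
    have hlen := congrArg SimpleGraph.Walk.length (p.bypass.take_spec hmem)
    rw [SimpleGraph.Walk.length_append] at hlen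
    have hle := p.length_bypass_le_length
    have hx' := h.nearBranching_of_walk hb (p.bypass.dropUntil x hmem)
    exact Nat.find_min hex (m := (p.bypass.dropUntil x hmem).length) (by omega) hx'
  obtain ⟨b₁, hb₁, p₁, hp₁, hx₁⟩ := hpath i₁ hi₁ h1
  obtain ⟨b₂, hb₂, p₂, hp₂, hx₂⟩ := hpath i₂ hi₂ h2
  let q₁ : (limitGraph nb G R).Walk x b₁ := SimpleGraph.Walk.cons hi₁ p₁
  let q₂ : (limitGraph nb G R).Walk x b₂ := SimpleGraph.Walk.cons hi₂ p₂
  obtain rfl : b₁ = b₂ := h.branching_unique hb₁ hb₂ (q₁.reachable.symm.trans q₂.reachable)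
  have hq₁ : q₁.IsPath := (SimpleGraph.Walk.cons_isPath_iff _ _).2 ⟨hp₁, hx₁⟩
  have hq₂ : q₂.IsPath := (SimpleGraph.Walk.cons_isPath_iff _ _).2 ⟨hp₂, hx₂⟩
  have hac : (limitGraph nb G R).IsAcyclic := h.acyclic.anti limitGraph_le
  have heq := congrArg (fun q : (limitGraph nb G R).Path x b₁ => q.1.getVert 1)
    ((hac.subsingleton_path x b₁).elim ⟨q₁, hq₁⟩ ⟨q₂, hq₂⟩)
  have this : nb i₁ x = nb i₂ x := by
    change p₁.getVert 0 = p₂.getVert 0 at heq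
    rwa [SimpleGraph.Walk.getVert_zero, SimpleGraph.Walk.getVert_zero] at heq
  exact hne (h.injective x this)

theorem exists_firstAway {x : X} (hx : ¬ Removed nb G R x) {m : ℕ}
    (hm : NearBranching nb G R m x) : ∃ y, FirstAway nb G R x y := by
  obtain ⟨i, hi, hmin⟩ := wellFounded_lt.has_min {i | LeadsAway nb G R x (nb i x)}
    (h.exists_leadsAway hx hm)
  exact ⟨_, i, rfl, hi, fun i' hi' hc => hmin i' hc hi'⟩

omit h in
theorem firstAway_unique {x y z : X} (hy : FirstAway nb G R x y) (hz : FirstAway nb G R x z) :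
    y = z := by
  obtain ⟨i, rfl, hi, hmin⟩ := hy
  obtain ⟨j, rfl, hj, hmin'⟩ := hz
  rcases lt_trichotomy i j with hlt | rfl | hlt
  · exact absurd hi (hmin' i hlt)
  · rfl
  · exact absurd hj (hmin j hlt)

omit h in
theorem FirstAway.leadsAway {x y : X} (hy : FirstAway nb G R x y) : LeadsAway nb G R x y := by
  obtain ⟨i, rfl, hi, -⟩ := hy
  exact hi

/-- Accessibility is shown in stages. For removed vertices it follows by lexicographic induction on
the round and the position in the segment, since nothing survives next to them. For vertices near a
branching vertex it follows by induction on the distance, which is smaller for a child that leads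
away. The children of any vertex are of these two kinds. -/
theorem wellFounded_parent :
    WellFounded (fun x y => Hung nb G R x y ∨ FirstAway nb G R x y) := by
  set P := fun x y => Hung nb G R x y ∨ FirstAway nb G R x y
  have hinner : ∀ n j y, (R n).Inner nb (remaining nb G R n) j y → Acc P y := by
    intro n
    induction n using Nat.strong_induction_on with
    | _ n ihn =>
      intro j
      induction j using Nat.strong_induction_on with
      | _ j ihj =>
        intro y hy
        refine Acc.intro y fun x hx => ?_
        rcases hx with hx | hx
        · obtain ⟨n', j', hlt | ⟨rfl, hlt⟩, hin⟩ := h.hung_inner hy hx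
          · exact ihn n' hlt j' x hin
          · exact ihj j' hlt x hin
        · exact absurd ⟨n, j, hy⟩
            (h.not_removed_left (remainingLimit_symm (FirstAway.leadsAway hx).1))
  have hrem : ∀ y, Removed nb G R y → Acc P y := fun y ⟨n, j, hj⟩ => hinner n j y hj
  have hnear : ∀ d y, NearBranching nb G R d y → Acc P y := by
    intro d
    induction d with
    | zero =>
      intro y hy
      refine Acc.intro y fun x hx => ?_
      rcases hx with hx | hx
      · exact hrem x (removed_of_hung hx)
      · obtain ⟨-, m, -, hm⟩ := FirstAway.leadsAway hx
        exact absurd (nearBranching_mono (Nat.zero_le m) hy) hm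
    | succ d ih =>
      intro y hy
      refine Acc.intro y fun x hx => ?_
      rcases hx with hx | hx
      · exact hrem x (removed_of_hung hx)
      · obtain ⟨-, m, hmx, hm⟩ := FirstAway.leadsAway hx
        refine ih x (nearBranching_mono ?_ hmx)
        by_contra hlt
        exact hm (nearBranching_mono (by omega) hy)
  refine ⟨fun y => Acc.intro y fun x hx => ?_⟩
  rcases hx with hx | hx
  · exact hrem x (removed_of_hung hx)
  · obtain ⟨-, m, hmx, -⟩ := FirstAway.leadsAway hx
    exact hnear m x hmx

/-- A surviving vertex in a component without branching has degree exactly 2. Every other vertex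
gets a parent from the segment that removed it or from the orientation away from the branching
vertex, never from both. -/
theorem isHangingForest : IsHangingForest G (limitLines nb G R)
    (fun x y => remainingLimit nb G R x y ∧ x ∈ limitLines nb G R)
    (fun x y => Hung nb G R x y ∨ FirstAway nb G R x y) where
  line_adj hxy := hxy.1 0
  line_symm := by
    rintro x y ⟨hxy, hx⟩
    refine ⟨remainingLimit_symm hxy, h.not_removed_left (remainingLimit_symm hxy), fun m hm => ?_⟩
    exact hx.2 (m + 1) (h.nearBranching_succ hxy hm)
  line_mem hxy := hxy.2
  line_encard := by
    intro x hx
    have h2 : portDegree nb (remainingLimit nb G R) x = 2 := by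
      have h1 := h.two_le_portDegree_limit hx.1
      have h3 : ¬ 3 ≤ portDegree nb (remainingLimit nb G R) x := hx.2 0
      omega
    have e1 : {y | remainingLimit nb G R x y ∧ x ∈ limitLines nb G R} =
        ((univ.filter (fun i => remainingLimit nb G R x (nb i x))).image (fun i => nb i x) :
          Finset X) := by
      ext y
      simp only [Set.mem_ofPred_eq, coe_image, Set.mem_image, coe_filter, mem_univ, true_and]
      constructor
      · rintro ⟨hy, -⟩
        obtain ⟨i, rfl⟩ := (h.adj_iff x y).1 (hy 0)
        exact ⟨i, hy, rfl⟩
      · rintro ⟨i, hi, rfl⟩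
        exact ⟨hi, hx⟩
    rw [e1, Set.encard_coe_eq_coe_finsetCard, card_image_of_injective _ (h.injective x)]
    exact_mod_cast h2
  parent_adj := by
    rintro x y (hxy | hxy)
    · exact hung_adj hxy
    · exact (FirstAway.leadsAway hxy).1 0
  exists_parent := by
    intro x hx
    by_cases hr : Removed nb G R x
    · obtain ⟨y, hy⟩ := exists_hung hr
      exact ⟨y, Or.inl hy⟩
    · obtain ⟨m, hm⟩ : ∃ m, NearBranching nb G R m x := by
        by_contra hc
        exact hx ⟨hr, not_exists.1 hc⟩
      obtain ⟨y, hy⟩ := h.exists_firstAway hr hm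
      exact ⟨y, Or.inr hy⟩
  notMem_of_parent := by
    rintro x y (hxy | hxy) hx
    · exact hx.1 (removed_of_hung hxy)
    · obtain ⟨-, m, hm, -⟩ := FirstAway.leadsAway hxy
      exact hx.2 m hm
  parent_unique := by
    rintro x y z (hy | hy) (hz | hz)
    · exact h.hung_unique hy hz
    · exact absurd (removed_of_hung hy) (h.not_removed_left (FirstAway.leadsAway hz).1)
    · exact absurd (removed_of_hung hz) (h.not_removed_left (FirstAway.leadsAway hy).1)
    · exact firstAway_unique hy hz
  wf := h.wellFounded_parent

end IsCutSequence

end Limit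

/-! ### Measurability of the construction -/

section Measurability

open Finset Classical

variable {X : Type u} [MeasurableSpace X] {Δ : ℕ} {nb : Fin Δ → X → X}

theorem measurable_portPath (hnb : ∀ i, Measurable (nb i)) (w : ℕ → Fin Δ) (j : ℕ) :
    Measurable (fun x => portPath nb w x j) := by
  induction j with
  | zero => exact measurable_id
  | succ j ih => exact (hnb (w j)).comp ih

theorem measurable_portDegree (hnb : ∀ i, Measurable (nb i)) {E : X → X → Prop}
    (hE : MeasurableSet {p : X × X | E p.1 p.2}) : Measurable (portDegree nb E) :=
  measurable_card_filter _ fun i => hE.preimage (measurable_id.prodMk (hnb i))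

namespace CutRound

variable {R : CutRound Δ X} {E : X → X → Prop}

theorem measurableSet_selected [StandardBorelSpace X] (hnb : ∀ i, Measurable (nb i))
    (hR : MeasurableSet R.start) (hE : MeasurableSet {p : X × X | E p.1 p.2}) :
    MeasurableSet (R.selected nb E) := by
  have hp := measurable_portPath hnb R.word
  have hd := measurable_portDegree hnb hE
  have : R.selected nb E = R.start ∩ ({_u | 0 < R.len} ∩
      ({u | ∀ j, j < R.len → E (portPath nb R.word u j) (portPath nb R.word u (j + 1))} ∩
      ({u | ∀ j, j + 1 < R.len → portPath nb R.word u j ≠ portPath nb R.word u (j + 2)} ∩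
      ({u | 3 ≤ portDegree nb E u} ∩ ({u | 3 ≤ portDegree nb E (portPath nb R.word u R.len)} ∩
      {u | ∀ j, 0 < j → j < R.len → portDegree nb E (portPath nb R.word u j) = 2}))))) := by
    ext u
    exact ⟨fun ⟨h0, h1, h2, h3, h4, h5, h6⟩ => ⟨h0, h1, h2, h3, h4, h5, h6⟩,
      fun ⟨h0, h1, h2, h3, h4, h5, h6⟩ => ⟨h0, h1, h2, h3, h4, h5, h6⟩⟩
  rw [this]
  refine hR.inter ((MeasurableSet.const _).inter (MeasurableSet.inter ?_ (MeasurableSet.inter ?_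
    (MeasurableSet.inter ?_ (MeasurableSet.inter ?_ ?_)))))
  · simp only [Set.ofPred_forall]
    exact MeasurableSet.iInter fun j => MeasurableSet.iInter fun _ =>
      hE.preimage ((hp j).prodMk (hp (j + 1)))
  · simp only [Set.ofPred_forall]
    exact MeasurableSet.iInter fun j => MeasurableSet.iInter fun _ =>
      (measurableSet_eq_fun (hp j) (hp (j + 2))).compl
  · exact hd (t := {k | 3 ≤ k}) .of_discrete
  · exact (hd.comp (hp _)) (t := {k | 3 ≤ k}) .of_discrete
  · simp only [Set.ofPred_forall]
    exact MeasurableSet.iInter fun j => MeasurableSet.iInter fun _ => MeasurableSet.iInter fun _ =>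
      (hd.comp (hp j)) (t := {k | k = 2}) .of_discrete

/-- Separation makes the map from starting points to edges injective, so the image of a Borel set is
Borel by Lusin–Souslin. -/
theorem measurableSet_step [StandardBorelSpace X] (hnb : ∀ i, Measurable (nb i))
    (hR : MeasurableSet R.start) (hsep : R.Separated nb)
    (hE : MeasurableSet {p : X × X | E p.1 p.2}) {j : ℕ} (hj : j < R.len) :
    MeasurableSet {p : X × X | ∃ u ∈ R.selected nb E,
      (portPath nb R.word u j, portPath nb R.word u (j + 1)) = (p.1, p.2)} := by
  have hp := measurable_portPath hnb R.word
  refine (measurableSet_selected hnb hR hE).image_of_measurable_injOn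
    (f := fun u => (portPath nb R.word u j, portPath nb R.word u (j + 1)))
    ((hp j).prodMk (hp (j + 1))) ?_
  intro u hu v hv huv
  exact hsep u hu.1 v hv.1 j hj.le j hj.le (Prod.mk.inj huv).1

theorem measurableSet_cut [StandardBorelSpace X] (hnb : ∀ i, Measurable (nb i))
    (hR : MeasurableSet R.start) (hsep : R.Separated nb)
    (hE : MeasurableSet {p : X × X | E p.1 p.2}) :
    MeasurableSet {p : X × X | R.Cut nb E p.1 p.2} := by
  have : {p : X × X | R.Cut nb E p.1 p.2} = ⋃ j, ⋃ _ : j < R.len, {p : X × X |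
      ∃ u ∈ R.selected nb E,
        (portPath nb R.word u j, portPath nb R.word u (j + 1)) = (p.1, p.2)} := by
    ext p
    simp [Cut]
  rw [this]
  exact MeasurableSet.iUnion fun j => MeasurableSet.iUnion fun hj =>
    measurableSet_step hnb hR hsep hE hj

theorem measurableSet_trim [StandardBorelSpace X] (hnb : ∀ i, Measurable (nb i))
    (hR : MeasurableSet R.start) (hsep : R.Separated nb)
    (hE : MeasurableSet {p : X × X | E p.1 p.2}) :
    MeasurableSet {p : X × X | R.trim nb E p.1 p.2} := by
  have hc := measurableSet_cut hnb hR hsep hE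
  exact hE.inter (hc.union (hc.preimage measurable_swap)).compl

end CutRound

namespace IsCutSequence

variable [StandardBorelSpace X] {G : SimpleGraph X} {R : ℕ → CutRound Δ X}

theorem measurableSet_remaining (h : IsCutSequence nb G R) (hG : IsBorelGraph G)
    (hnb : ∀ i, Measurable (nb i)) (hR : ∀ n, MeasurableSet (R n).start) (n : ℕ) :
    MeasurableSet {p : X × X | remaining nb G R n p.1 p.2} := by
  induction n with
  | zero => exact hG
  | succ n ih => exact CutRound.measurableSet_trim hnb (hR n) (h.separated n) ih

theorem measurableSet_remainingLimit (h : IsCutSequence nb G R) (hG : IsBorelGraph G)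
    (hnb : ∀ i, Measurable (nb i)) (hR : ∀ n, MeasurableSet (R n).start) :
    MeasurableSet {p : X × X | remainingLimit nb G R p.1 p.2} := by
  simp only [remainingLimit, Set.ofPred_forall]
  exact MeasurableSet.iInter fun n => h.measurableSet_remaining hG hnb hR n

theorem measurableSet_hung (h : IsCutSequence nb G R) (hG : IsBorelGraph G)
    (hnb : ∀ i, Measurable (nb i)) (hR : ∀ n, MeasurableSet (R n).start) :
    MeasurableSet {p : X × X | Hung nb G R p.1 p.2} := by
  simp only [Hung, Set.ofPred_exists]
  refine MeasurableSet.iUnion fun n => MeasurableSet.iUnion fun j => ?_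
  by_cases hj : 0 < j ∧ j < (R n).len
  · convert CutRound.measurableSet_step hnb (hR n) (h.separated n)
      (h.measurableSet_remaining hG hnb hR n) hj.2 using 1
    ext p
    exact ⟨fun hp => hp.2.2, fun hp => ⟨hj.1, hj.2, hp⟩⟩
  · convert MeasurableSet.empty
    ext p
    exact ⟨fun hp => hj ⟨hp.1, hp.2.1⟩, fun hp => hp.elim⟩

/-- The existential quantifier over the parent is replaced by a finite union over ports, which
avoids a projection. -/
theorem measurableSet_removed (h : IsCutSequence nb G R) (hG : IsBorelGraph G)
    (hnb : ∀ i, Measurable (nb i)) (hR : ∀ n, MeasurableSet (R n).start) :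
    MeasurableSet {x : X | Removed nb G R x} := by
  have : {x : X | Removed nb G R x} = ⋃ i, {x | Hung nb G R x (nb i x)} := by
    ext x
    rw [Set.mem_iUnion]
    constructor
    · intro hx
      obtain ⟨y, hy⟩ := exists_hung hx
      obtain ⟨i, rfl⟩ := (h.adj_iff x y).1 (hung_adj hy)
      exact ⟨i, hy⟩
    · rintro ⟨i, hi⟩
      exact removed_of_hung hi
  rw [this]
  exact MeasurableSet.iUnion fun i =>
    (h.measurableSet_hung hG hnb hR).preimage (measurable_id.prodMk (hnb i))

theorem measurableSet_nearBranching (h : IsCutSequence nb G R) (hG : IsBorelGraph G)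
    (hnb : ∀ i, Measurable (nb i)) (hR : ∀ n, MeasurableSet (R n).start) (m : ℕ) :
    MeasurableSet {x : X | NearBranching nb G R m x} := by
  have hE := h.measurableSet_remainingLimit hG hnb hR
  induction m with
  | zero => exact (measurable_portDegree hnb hE) (t := {k | 3 ≤ k}) .of_discrete
  | succ m ih =>
    refine ih.union ?_
    change MeasurableSet {x | ∃ i, remainingLimit nb G R x (nb i x) ∧ NearBranching nb G R m (nb i x)}
    rw [Set.ofPred_exists]
    exact MeasurableSet.iUnion fun i =>
      (hE.preimage (measurable_id.prodMk (hnb i))).inter (ih.preimage (hnb i))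

theorem measurableSet_firstAway (h : IsCutSequence nb G R) (hG : IsBorelGraph G)
    (hnb : ∀ i, Measurable (nb i)) (hR : ∀ n, MeasurableSet (R n).start) :
    MeasurableSet {p : X × X | FirstAway nb G R p.1 p.2} := by
  have hE := h.measurableSet_remainingLimit hG hnb hR
  have hN := h.measurableSet_nearBranching hG hnb hR
  have haway : ∀ i, MeasurableSet {x | LeadsAway nb G R x (nb i x)} := by
    intro i
    refine (hE.preimage (measurable_id.prodMk (hnb i))).inter ?_
    change MeasurableSet {x | ∃ m, NearBranching nb G R m x ∧ ¬ NearBranching nb G R m (nb i x)}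
    rw [Set.ofPred_exists]
    exact MeasurableSet.iUnion fun m => (hN m).inter ((hN m).preimage (hnb i)).compl
  simp only [FirstAway, Set.ofPred_exists]
  refine MeasurableSet.iUnion fun i => MeasurableSet.inter ?_ (MeasurableSet.inter ?_ ?_)
  · exact measurableSet_eq_fun ((hnb i).comp measurable_fst) measurable_snd
  · exact (haway i).preimage measurable_fst
  · change MeasurableSet {p : X × X | ∀ i' < i, ¬ LeadsAway nb G R p.1 (nb i' p.1)}
    simp only [Set.ofPred_forall]
    exact MeasurableSet.iInter fun i' => MeasurableSet.iInter fun _ =>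
      ((haway i').preimage measurable_fst).compl

theorem measurableSet_limitLines (h : IsCutSequence nb G R) (hG : IsBorelGraph G)
    (hnb : ∀ i, Measurable (nb i)) (hR : ∀ n, MeasurableSet (R n).start) :
    MeasurableSet (limitLines nb G R) := by
  refine (h.measurableSet_removed hG hnb hR).compl.inter ?_
  change MeasurableSet {x | ∀ m, ¬ NearBranching nb G R m x}
  rw [Set.ofPred_forall]
  exact MeasurableSet.iInter fun m => (h.measurableSet_nearBranching hG hnb hR m).compl

end IsCutSequence

end Measurability

/-! ### Existence of cut sequences -/

section Existence

variable {X : Type u} {Δ : ℕ} {nb : Fin Δ → X → X} {G : SimpleGraph X}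

theorem exists_list_of_walk (hadj : ∀ x y, G.Adj x y ↔ ∃ i, nb i x = y) {x y : X}
    (p : G.Walk x y) :
    ∃ v : List (Fin Δ), v.length = p.length ∧ v.foldl (fun z i => nb i z) x = y := by
  induction p with
  | nil => exact ⟨[], rfl, rfl⟩
  | cons h p ih =>
    obtain ⟨v, hv, he⟩ := ih
    obtain ⟨i, rfl⟩ := (hadj _ _).1 h
    exact ⟨i :: v, by simp [hv], he⟩

theorem exists_walk_portPath (hadj : ∀ x y, G.Adj x y ↔ ∃ i, nb i x = y) (w : ℕ → Fin Δ) (x : X)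
    (j : ℕ) : ∃ p : G.Walk x (portPath nb w x j), p.length = j := by
  induction j with
  | zero => exact ⟨SimpleGraph.Walk.nil, rfl⟩
  | succ j ih =>
    obtain ⟨p, hp⟩ := ih
    exact ⟨p.concat ((hadj _ _).2 ⟨w j, rfl⟩), by simp [hp]⟩

/-- A Borel cut sequence exists for every regular Borel forest. -/
theorem IsRegularBorelForest.exists_cutSequence [MeasurableSpace X] [StandardBorelSpace X]
    (hG : IsRegularBorelForest Δ G) (hΔ : 2 ≤ Δ) (hnb : ∀ i, Measurable (nb i))
    (hinj : ∀ x, Function.Injective (fun i => nb i x))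
    (hadj : ∀ x y, G.Adj x y ↔ ∃ i, nb i x = y) :
    ∃ R : ℕ → CutRound Δ X, IsCutSequence nb G R ∧ ∀ n, MeasurableSet (R n).start := by
  obtain ⟨U, hU, hsep⟩ := exists_separating_borel_sets X
  obtain ⟨f, hf⟩ := exists_surjective_nat (List (Fin Δ) × ℕ)
  let i₀ : Fin Δ := ⟨0, by omega⟩
  -- The starting points of `U` that see no other point of `U` within twice the word length: two
  -- paths of at most that length that meet join their starting points by such a walk.
  let A : List (Fin Δ) × ℕ → Set X := fun q =>
    {u | u ∈ U q.2 ∧ ∀ v : List (Fin Δ), v.length ≤ 2 * q.1.length →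
      v.foldl (fun z i => nb i z) u ≠ u → v.foldl (fun z i => nb i z) u ∉ U q.2}
  let T : List (Fin Δ) × ℕ → CutRound Δ X := fun q =>
    ⟨fun j => q.1.getD j i₀, q.1.length, A q⟩
  have hfold : ∀ v : List (Fin Δ), Measurable (fun u => v.foldl (fun z i => nb i z) u) := by
    intro v
    induction v with
    | nil => exact measurable_id
    | cons i v ih => exact ih.comp (hnb i)
  -- Reading only the first coordinate of the unpaired index makes every pair of a word and a set
  -- occur in infinitely many rounds.
  refine ⟨fun n => T (f n.unpair.1), ⟨hG.acyclic, hΔ, hinj, hadj, fun n => ?_, ?_⟩, fun n => ?_⟩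
  · generalize f n.unpair.1 = q
    intro u hu u' hu' j hj j' hj' he
    obtain ⟨p, hp⟩ := exists_walk_portPath hadj (T q).word u j
    obtain ⟨p', hp'⟩ := exists_walk_portPath hadj (T q).word u' j'
    obtain ⟨v, hv, hve⟩ := exists_list_of_walk hadj (p.append (p'.copy rfl he.symm).reverse)
    have hlen : v.length ≤ 2 * q.1.length := by
      have h1 : j ≤ q.1.length := hj
      have h2 : j' ≤ q.1.length := hj'
      simp only [SimpleGraph.Walk.length_append, SimpleGraph.Walk.length_reverse,
        SimpleGraph.Walk.length_copy] at hv
      omega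
    by_contra hne
    refine hu.2 v hlen ?_ ?_
    · rw [hve]
      exact Ne.symm hne
    · rw [hve]
      exact hu'.1
  · intro w l u N
    let v : List (Fin Δ) := (List.range l).map w
    have hfin : {y | ∃ v' : List (Fin Δ), v'.length ≤ 2 * l ∧
        v'.foldl (fun z i => nb i z) u = y}.Finite := by
      have : {y | ∃ v' : List (Fin Δ), v'.length ≤ 2 * l ∧ v'.foldl (fun z i => nb i z) u = y} =
          (fun v' : List (Fin Δ) => v'.foldl (fun z i => nb i z) u) '' {v' | v'.length ≤ 2 * l} :=
        rfl
      rw [this]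
      exact (List.finite_length_le _ _).image _
    -- Only finitely many vertices are reachable in `2 * l` steps, so some set of the countable
    -- family contains `u` and none of the others.
    obtain ⟨k, hk, hdisj⟩ := hsep u _ (hfin.sdiff (t := {u})) (fun hc => hc.2 rfl)
    obtain ⟨a, ha⟩ := hf (v, k)
    have hvl : v.length = l := by simp [v]
    refine ⟨Nat.pair a N, Nat.right_le_pair a N, ?_⟩
    simp only [Nat.unpair_pair, ha]
    refine ⟨hvl, fun j hj => ?_, hk, fun v' hv' hne hmem => ?_⟩
    · change v.getD j i₀ = w j
      simp [v, List.getD, hj]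
    · exact Set.disjoint_left.1 hdisj ⟨⟨v', hvl ▸ hv', rfl⟩, hne⟩ hmem
  · change MeasurableSet (A (f n.unpair.1))
    generalize f n.unpair.1 = q
    refine (hU q.2).inter ?_
    change MeasurableSet {u | ∀ v : List (Fin Δ), v.length ≤ 2 * q.1.length →
      v.foldl (fun z i => nb i z) u ≠ u → v.foldl (fun z i => nb i z) u ∉ U q.2}
    rw [Set.ofPred_forall]
    refine MeasurableSet.iInter fun v => ?_
    have h1 : MeasurableSet {u | v.foldl (fun z i => nb i z) u = u} :=
      measurableSet_eq_fun (hfold v) measurable_id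
    have h2 : MeasurableSet {u | v.foldl (fun z i => nb i z) u ∈ U q.2} :=
      (hU q.2).preimage (hfold v)
    have : {u | v.length ≤ 2 * q.1.length → v.foldl (fun z i => nb i z) u ≠ u →
        v.foldl (fun z i => nb i z) u ∉ U q.2} = {_u | ¬ v.length ≤ 2 * q.1.length} ∪
        ({u | v.foldl (fun z i => nb i z) u = u} ∪
          {u | v.foldl (fun z i => nb i z) u ∈ U q.2}ᶜ) := by
      ext u
      simp only [Set.mem_ofPred_eq, Set.mem_union, Set.mem_compl_iff]
      tauto
    rw [this]
    exact (MeasurableSet.const _).union (h1.union h2.compl)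

/-- A regular Borel forest has a Borel decomposition into lines and trees that hang on them, and
one-ended trees. -/
theorem IsRegularBorelForest.exists_isHangingForest [MeasurableSpace X] [StandardBorelSpace X]
    (hG : IsRegularBorelForest Δ G) (hΔ : 2 ≤ Δ) (hnb : ∀ i, Measurable (nb i))
    (hinj : ∀ x, Function.Injective (fun i => nb i x))
    (hadj : ∀ x y, G.Adj x y ↔ ∃ i, nb i x = y) :
    ∃ (L : Set X) (S P : X → X → Prop), IsHangingForest G L S P ∧ MeasurableSet L ∧
      MeasurableSet {p : X × X | S p.1 p.2} ∧ MeasurableSet {p : X × X | P p.1 p.2} := by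
  obtain ⟨R, h, hR⟩ := hG.exists_cutSequence hΔ hnb hinj hadj
  have hL := h.measurableSet_limitLines hG.borel hnb hR
  exact ⟨_, _, _, h.isHangingForest, hL,
    (h.measurableSet_remainingLimit hG.borel hnb hR).inter (hL.preimage measurable_fst),
    (h.measurableSet_hung hG.borel hnb hR).union (h.measurableSet_firstAway hG.borel hnb hR)⟩

theorem IsRegularBorelForest.exists_spanningForest [MeasurableSpace X] [StandardBorelSpace X]
    (hG : IsRegularBorelForest Δ G) (hΔ : 2 ≤ Δ) :
    ∃ T : SimpleGraph X, IsBorelGraph T ∧ IsOneOrTwoEndedSpanningForest G T := by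
  obtain ⟨nb, hnb, hinj, hadj⟩ := hG.exists_neighbor_enumeration
  obtain ⟨L, S, P, h, -, hS, hP⟩ := hG.exists_isHangingForest hΔ hnb hinj hadj
  refine ⟨h.graph, ?_, h.isOneOrTwoEndedSpanningForest hG.acyclic fun x =>
    Set.finite_of_encard_eq_coe (hG.regular x)⟩
  exact hS.union (hP.union (hP.preimage measurable_swap))

theorem hopMatching_lineAugment_mem_BOREL (hΔ : 2 ≤ Δ) :
    (hopMatching Δ).lineAugment ∈ BOREL.{u} Δ := by
  intro X _ _ G hG
  obtain ⟨nb, hnb, hinj, hadj⟩ := hG.exists_neighbor_enumeration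
  obtain ⟨L, S, P, h, hL, hS, hP⟩ := hG.exists_isHangingForest hΔ hnb hinj hadj
  refine ⟨fun e => IsHangingForest.label nb L S P hΔ e.1.1 e.1.2, ?_,
    h.isColoring hΔ hinj hadj⟩
  exact (IsHangingForest.measurable_label hΔ hnb hL hS hP).comp measurable_subtype_coe

end Existence

/-! ### Truncated regular trees -/

section WordTree

variable {Δ : ℕ}

/-- Multiplication of a reduced word by an involutive letter (the last letter comes first). -/
def pushLetter (a : Fin Δ) : List (Fin Δ) → List (Fin Δ)
  | [] => [a]
  | b :: u => if b = a then u else a :: b :: u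

theorem pushLetter_of_tail (a : Fin Δ) (u : List (Fin Δ)) : pushLetter a (a :: u) = u := by
  simp [pushLetter]

theorem isChain_pushLetter (a : Fin Δ) {u : List (Fin Δ)} (hu : u.IsChain (· ≠ ·)) :
    (pushLetter a u).IsChain (· ≠ ·) := by
  cases u with
  | nil => simp [pushLetter]
  | cons b u =>
    rw [pushLetter]
    split_ifs with h
    · exact hu.tail
    · exact List.isChain_cons_cons.2 ⟨Ne.symm h, hu⟩

theorem pushLetter_pushLetter (a : Fin Δ) {u : List (Fin Δ)} (hu : u.IsChain (· ≠ ·)) :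
    pushLetter a (pushLetter a u) = u := by
  cases u with
  | nil => simp [pushLetter]
  | cons b u =>
    by_cases h : b = a
    · subst h
      rw [pushLetter_of_tail]
      cases u with
      | nil => simp [pushLetter]
      | cons c u =>
        have : b ≠ c := (List.isChain_cons_cons.1 hu).1
        simp [pushLetter, this.symm]
    · simp [pushLetter, h]

theorem length_pushLetter (a : Fin Δ) (u : List (Fin Δ)) :
    (pushLetter a u).length = u.length + 1 ∨ (pushLetter a u).length + 1 = u.length := by
  cases u with
  | nil => simp [pushLetter]
  | cons b u =>
    rw [pushLetter]
    split_ifs <;> simp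

theorem length_pushLetter_le (a : Fin Δ) (u : List (Fin Δ)) :
    (pushLetter a u).length ≤ u.length + 1 := by
  have := length_pushLetter a u
  omega

theorem pushLetter_injective {a b : Fin Δ} {u : List (Fin Δ)}
    (h : pushLetter a u = pushLetter b u) : a = b := by
  cases u with
  | nil => simpa [pushLetter] using h
  | cons c u =>
    simp only [pushLetter] at h
    split_ifs at h with h1 h2 h2
    · exact h1.symm.trans h2
    · exact absurd (congrArg List.length h) (by simp; omega)
    · exact absurd (congrArg List.length h) (by simp; omega)
    · simpa using h

theorem pushLetter_eq_tail {a : Fin Δ} {u : List (Fin Δ)}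
    (h : (pushLetter a u).length ≤ u.length) : pushLetter a u = u.tail := by
  cases u with
  | nil => simp [pushLetter] at h
  | cons b u =>
    simp only [pushLetter] at h ⊢
    split_ifs at h ⊢ with hb
    · rfl
    · simp at h

theorem pushLetter_map {Δ' : ℕ} (f : Fin Δ ≃ Fin Δ') (a : Fin Δ) (u : List (Fin Δ)) :
    pushLetter (f a) (u.map f) = (pushLetter a u).map f := by
  cases u with
  | nil => simp [pushLetter]
  | cons b u =>
    simp only [pushLetter, List.map_cons, EmbeddingLike.apply_eq_iff_eq]
    split_ifs <;> simp

/-- Left multiplication of a reduced word by a letter. -/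
def shiftLetter (a : Fin Δ) (u : List (Fin Δ)) : List (Fin Δ) := (pushLetter a u.reverse).reverse

theorem isChain_ne_reverse {u : List (Fin Δ)} (hu : u.IsChain (· ≠ ·)) :
    u.reverse.IsChain (· ≠ ·) := by
  rw [List.isChain_reverse]
  exact hu.imp fun _ _ h => h.symm

theorem isChain_shiftLetter (a : Fin Δ) {u : List (Fin Δ)} (hu : u.IsChain (· ≠ ·)) :
    (shiftLetter a u).IsChain (· ≠ ·) :=
  isChain_ne_reverse (isChain_pushLetter a (isChain_ne_reverse hu))

theorem shiftLetter_shiftLetter (a : Fin Δ) {u : List (Fin Δ)} (hu : u.IsChain (· ≠ ·)) :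
    shiftLetter a (shiftLetter a u) = u := by
  rw [shiftLetter, shiftLetter, List.reverse_reverse,
    pushLetter_pushLetter a (isChain_ne_reverse hu), List.reverse_reverse]

theorem length_shiftLetter_le (a : Fin Δ) (u : List (Fin Δ)) :
    (shiftLetter a u).length ≤ u.length + 1 := by
  have := length_pushLetter_le a u.reverse
  simpa [shiftLetter] using this

theorem shiftLetter_concat (a : Fin Δ) (u : List (Fin Δ)) : shiftLetter a (u ++ [a]) = u := by
  simp [shiftLetter, pushLetter]

theorem shiftLetter_concat_of_ne {a b : Fin Δ} (h : b ≠ a) (u : List (Fin Δ)) :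
    shiftLetter a (u ++ [b]) = u ++ [b, a] := by
  simp [shiftLetter, pushLetter, h]

theorem pushLetter_append (b : Fin Δ) {u : List (Fin Δ)} (hu : u ≠ []) (v : List (Fin Δ)) :
    pushLetter b (u ++ v) = pushLetter b u ++ v := by
  cases u with
  | nil => exact absurd rfl hu
  | cons c u =>
    simp only [pushLetter, List.cons_append]
    split_ifs <;> rfl

/-- Left and right multiplication in the free product of `Δ` groups of order 2 commute. They
interact only on words of length at most 1. Hence left multiplication is a symmetry that preserves
directions. -/
theorem shiftLetter_pushLetter (a b : Fin Δ) (u : List (Fin Δ)) :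
    shiftLetter a (pushLetter b u) = pushLetter b (shiftLetter a u) := by
  rcases List.eq_nil_or_concat' u with rfl | ⟨u, c, rfl⟩
  · by_cases h : b = a
    · subst h; simp [shiftLetter, pushLetter]
    · simp [shiftLetter, pushLetter, h, Ne.symm h]
  · by_cases hu : u = []
    · subst hu
      by_cases h1 : c = b <;> by_cases h2 : c = a
      · subst h1; subst h2; simp [shiftLetter, pushLetter]
      · subst h1; simp [shiftLetter, pushLetter, h2]
      · subst h2; simp [shiftLetter, pushLetter, h1]
      · simp [shiftLetter, pushLetter, h1, h2]
    · rw [pushLetter_append b hu]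
      by_cases h2 : c = a
      · subst h2
        rw [shiftLetter_concat, shiftLetter_concat]
      · rw [shiftLetter_concat_of_ne h2, shiftLetter_concat_of_ne h2, pushLetter_append b hu]

variable (Δ) in
/-- The vertices of the `Δ`-regular tree at distance at most `D` from the root: reduced words of
length at most `D`. -/
abbrev TreeVertex (D : ℕ) : Type :=
  {u : List (Fin Δ) // u.IsChain (· ≠ ·) ∧ u.length ≤ D}

variable {D : ℕ}

instance : Finite (TreeVertex Δ D) :=
  Set.Finite.to_subtype ((List.finite_length_le (Fin Δ) D).subset fun _ hu => hu.2)

/-- The root of the tree. -/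
def treeRoot : TreeVertex Δ D := ⟨[], List.isChain_nil, Nat.zero_le _⟩

variable (Δ D) in
/-- The `Δ`-regular tree, truncated at distance `D` from the root. -/
def wordTree : SimpleGraph (TreeVertex Δ D) where
  Adj u v := ∃ a, pushLetter a u.1 = v.1
  symm := ⟨fun u v ⟨a, ha⟩ => ⟨a, by rw [← ha, pushLetter_pushLetter a u.2.1]⟩⟩
  loopless := ⟨fun u ⟨a, ha⟩ => by
    have := length_pushLetter a u.1
    rw [ha] at this
    omega⟩

theorem wordTree_adj {u v : TreeVertex Δ D} :
    (wordTree Δ D).Adj u v ↔ ∃ a, pushLetter a u.1 = v.1 := Iff.rfl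

theorem wordTree_reachable (u : TreeVertex Δ D) : (wordTree Δ D).Reachable treeRoot u := by
  obtain ⟨u, hu⟩ := u
  induction u with
  | nil => rfl
  | cons a u ih =>
    have hu' : u.IsChain (· ≠ ·) ∧ u.length ≤ D := ⟨hu.1.tail, by
      have := hu.2
      rw [List.length_cons] at this
      omega⟩
    refine (ih hu').trans (SimpleGraph.Adj.reachable (SimpleGraph.Adj.symm ?_))
    exact ⟨a, pushLetter_of_tail a u⟩

theorem wordTree_connected : (wordTree Δ D).Connected where
  preconnected u v := (wordTree_reachable u).symm.trans (wordTree_reachable v)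
  nonempty := ⟨treeRoot⟩

/-- At a longest word on a cycle, both cycle neighbors are no longer than it, hence both are its
tail, although they must differ. -/
theorem wordTree_isAcyclic : (wordTree Δ D).IsAcyclic := by
  classical
  intro v c hc
  obtain ⟨m, hm, hmax⟩ := Finset.exists_max_image c.support.toFinset (fun u => u.1.length)
    ⟨v, by simp⟩
  rw [List.mem_toFinset] at hm
  let p := c.rotate m hm
  have hp : p.IsCycle := hc.rotate hm
  have hsupp : ∀ w ∈ p.support, w.1.length ≤ m.1.length := by
    intro w hw
    exact hmax w (List.mem_toFinset.2 ((c.mem_support_rotate_iff m hm).1 hw))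
  have key : ∀ w ∈ p.support, (wordTree Δ D).Adj m w → w.1 = m.1.tail := by
    rintro w hw ⟨a, ha⟩
    rw [← ha]
    exact pushLetter_eq_tail (ha ▸ hsupp w hw)
  refine hp.snd_ne_penultimate (Subtype.ext ?_)
  rw [key p.snd (p.getVert_mem_support 1) (p.adj_snd hp.not_nil),
    key p.penultimate (p.getVert_mem_support _) (p.adj_penultimate hp.not_nil).symm]

/-- The truncated tree whose port `i` at `u` has the direction `ρ u i`. -/
def portTree (ρ : TreeVertex Δ D → Equiv.Perm (Fin Δ)) : RegTree Δ (TreeVertex Δ D) where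
  graph := wordTree Δ D
  isTree := ⟨wordTree_connected, wordTree_isAcyclic⟩
  other u i := if h : (pushLetter (ρ u i) u.1).length ≤ D then
    some ⟨pushLetter (ρ u i) u.1, isChain_pushLetter _ u.2.1, h⟩ else none
  adj_iff u v := by
    rw [wordTree_adj]
    constructor
    · rintro ⟨a, ha⟩
      refine ⟨(ρ u).symm a, ?_⟩
      rw [dif_pos (by rw [Equiv.apply_symm_apply, ha]; exact v.2.2)]
      simp only [Equiv.apply_symm_apply, ha]
    · rintro ⟨i, hi⟩
      split_ifs at hi with h
      exact ⟨ρ u i, congrArg Subtype.val (Option.some.inj hi)⟩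
  other_inj u v i j hi hj := by
    split_ifs at hi hj with h1 h2
    have := (congrArg Subtype.val (Option.some.inj hi)).trans
      (congrArg Subtype.val (Option.some.inj hj)).symm
    exact (ρ u).injective (pushLetter_injective this)

theorem portTree_other_eq_some {ρ : TreeVertex Δ D → Equiv.Perm (Fin Δ)} {u v : TreeVertex Δ D}
    {i : Fin Δ} : (portTree ρ).other u i = some v ↔ pushLetter (ρ u i) u.1 = v.1 := by
  simp only [portTree]
  split_ifs with h
  · simp [Subtype.ext_iff]
  · simp only [false_iff]
    intro hc
    exact h (hc ▸ v.2.2)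

theorem portTree_other_eq_none {ρ : TreeVertex Δ D → Equiv.Perm (Fin Δ)} {u : TreeVertex Δ D}
    {i : Fin Δ} : (portTree ρ).other u i = none ↔ D < (pushLetter (ρ u i) u.1).length := by
  simp only [portTree]
  split_ifs with h
  · simpa using h
  · simpa using h

theorem length_le_of_walk {u v : TreeVertex Δ D} (p : (wordTree Δ D).Walk u v) :
    v.1.length ≤ u.1.length + p.length := by
  induction p with
  | nil => simp
  | @cons x y z h p ih =>
    rw [SimpleGraph.Walk.length_cons]
    obtain ⟨a, ha⟩ := h
    have := length_pushLetter_le a x.1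
    rw [ha] at this
    omega

theorem length_le_of_dist {u v : TreeVertex Δ D} {t : ℕ} (h : (wordTree Δ D).dist u v ≤ t) :
    v.1.length ≤ u.1.length + t := by
  obtain ⟨p, hp⟩ := wordTree_connected.exists_walk_length_eq_dist u v
  have := length_le_of_walk p
  omega

/-- Left multiplication of short reduced words. -/
def shiftVertex (a : Fin Δ) (u : TreeVertex Δ D) (h : u.1.length + 1 ≤ D) : TreeVertex Δ D :=
  ⟨shiftLetter a u.1, isChain_shiftLetter a u.2.1, (length_shiftLetter_le a u.1).trans h⟩

theorem exists_shift_walk (a : Fin Δ) {u v : TreeVertex Δ D} (p : (wordTree Δ D).Walk u v)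
    (h : u.1.length + p.length + 1 ≤ D) :
    ∃ (hu : u.1.length + 1 ≤ D) (hv : v.1.length + 1 ≤ D)
      (q : (wordTree Δ D).Walk (shiftVertex a u hu) (shiftVertex a v hv)), q.length = p.length := by
  induction p with
  | @nil x => exact ⟨by simpa using h, by simpa using h, SimpleGraph.Walk.nil, rfl⟩
  | @cons x y z hadj p ih =>
    rw [SimpleGraph.Walk.length_cons] at h
    obtain ⟨b, hb⟩ := id hadj
    have hl := length_pushLetter_le b x.1
    rw [hb] at hl
    obtain ⟨hy, hz, q, hq⟩ := ih (by omega)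
    have hadj' : (wordTree Δ D).Adj (shiftVertex a x (by omega)) (shiftVertex a y hy) :=
      ⟨b, by
        change pushLetter b (shiftLetter a x.1) = shiftLetter a y.1
        rw [← shiftLetter_pushLetter, hb]⟩
    exact ⟨by omega, hz, SimpleGraph.Walk.cons hadj' q, by simp [hq]⟩

theorem dist_shiftVertex_le (a : Fin Δ) {u v : TreeVertex Δ D} {t : ℕ}
    (h : u.1.length + t + 1 ≤ D) (hv : (wordTree Δ D).dist u v ≤ t) (hu' : u.1.length + 1 ≤ D)
    (hv' : v.1.length + 1 ≤ D) :
    (wordTree Δ D).dist (shiftVertex a u hu') (shiftVertex a v hv') ≤ t := by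
  obtain ⟨p, hp⟩ := wordTree_connected.exists_walk_length_eq_dist u v
  obtain ⟨_, _, q, hq⟩ := exists_shift_walk a p (by omega)
  have := SimpleGraph.dist_le q
  omega

/-- Two vertices have isomorphic neighborhoods, up to the inputs. -/
def RegTree.SameShape {V : Type} (t : ℕ) (T₁ T₂ : RegTree Δ V) (v₁ v₂ : V) : Prop :=
  ∃ φ : T₁.Ball v₁ t ≃ T₂.Ball v₂ t,
    (∀ w : T₁.Ball v₁ t, (w : V) = v₁ → (φ w : V) = v₂) ∧
    (∀ (w : T₁.Ball v₁ t) (i : Fin Δ), T₁.other w i = none ↔ T₂.other (φ w) i = none) ∧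
    ∀ (w x : T₁.Ball v₁ t) (i : Fin Δ),
      T₁.other w i = some (x : V) ↔ T₂.other (φ w) i = some (φ x : V)

/-- Left multiplication preserves the neighborhoods of deep vertices. -/
theorem sameShape_shift (a : Fin Δ) (u : TreeVertex Δ D) {t : ℕ} (h : u.1.length + t + 2 ≤ D) :
    (portTree (fun _ : TreeVertex Δ D => 1)).SameShape t (portTree fun _ => 1) u
      (shiftVertex a u (by omega)) := by
  have hlen : ∀ w : (portTree (fun _ : TreeVertex Δ D => 1)).Ball u t,
      w.1.1.length + 2 ≤ D := fun w => by
    have := length_le_of_dist w.2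
    omega
  have hlen' : ∀ w : (portTree (fun _ : TreeVertex Δ D => 1)).Ball
      (shiftVertex a u (by omega)) t, w.1.1.length + 1 ≤ D := fun w => by
    have h1 := length_le_of_dist w.2
    have h2 : (shiftVertex a u (by omega)).1.length ≤ u.1.length + 1 := length_shiftLetter_le a u.1
    omega
  have hinv : ∀ (w : TreeVertex Δ D) (h1 : w.1.length + 1 ≤ D)
      (h2 : (shiftVertex a w h1).1.length + 1 ≤ D), shiftVertex a (shiftVertex a w h1) h2 = w :=
    fun w _ _ => Subtype.ext (shiftLetter_shiftLetter a w.2.1)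
  have hu1 : u.1.length + 1 ≤ D := by omega
  have hu2 : (shiftVertex a u hu1).1.length ≤ u.1.length + 1 := length_shiftLetter_le a u.1
  refine ⟨⟨fun w => ⟨shiftVertex a w.1 (by have := hlen w; omega),
      dist_shiftVertex_le a (by omega) w.2 hu1 _⟩,
    fun w => ⟨shiftVertex a w.1 (hlen' w), ?_⟩, ?_, ?_⟩, ?_, ?_, ?_⟩
  · have := dist_shiftVertex_le a (v := w.1) (t := t) (by omega) w.2 (by omega) (hlen' w)
    rwa [hinv] at this
  · intro w
    exact Subtype.ext (Subtype.ext (shiftLetter_shiftLetter a w.1.2.1))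
  · intro w
    exact Subtype.ext (Subtype.ext (shiftLetter_shiftLetter a w.1.2.1))
  · rintro w hw
    exact Subtype.ext (congrArg (fun z : TreeVertex Δ D => shiftLetter a z.1) hw)
  · intro w i
    rw [portTree_other_eq_none, portTree_other_eq_none]
    have h1 := hlen w
    have h2 := length_pushLetter_le i w.1.1
    have h3 : (shiftLetter a w.1.1).length ≤ w.1.1.length + 1 := length_shiftLetter_le a w.1.1
    have h4 := length_shiftLetter_le a (pushLetter i w.1.1)
    -- The margin of 2 in the depth keeps both balls away from the truncation, so neither contains
    -- virtual half-edges.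
    refine iff_of_false (by simp; omega) ?_
    simp only [Equiv.Perm.coe_one, id_eq, not_lt, Equiv.coe_fn_mk]
    change (pushLetter i (shiftLetter a w.1.1)).length ≤ D
    rw [← shiftLetter_pushLetter]
    omega
  · intro w x i
    rw [portTree_other_eq_some, portTree_other_eq_some]
    simp only [Equiv.Perm.coe_one, id_eq, Equiv.coe_fn_mk]
    change _ ↔ pushLetter i (shiftLetter a w.1.1) = shiftLetter a x.1.1
    rw [← shiftLetter_pushLetter]
    constructor
    · intro he
      rw [he]
    · intro he
      have := congrArg (shiftLetter a) he
      rwa [shiftLetter_shiftLetter a x.1.2.1,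
        shiftLetter_shiftLetter a (isChain_pushLetter i w.1.2.1)] at this

/-- Renaming the letters is an automorphism of the tree. -/
def relabelIso (π : Equiv.Perm (Fin Δ)) : wordTree Δ D ≃g wordTree Δ D where
  toFun u := ⟨u.1.map π, (List.isChain_map π).2 (u.2.1.imp fun _ _ h => π.injective.ne h),
    by simpa using u.2.2⟩
  invFun u := ⟨u.1.map π.symm,
    (List.isChain_map π.symm).2 (u.2.1.imp fun _ _ h => π.symm.injective.ne h),
    by simpa using u.2.2⟩
  left_inv u := by simp
  right_inv u := by simp
  map_rel_iff' := by
    intro u v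
    simp only [wordTree_adj, Equiv.coe_fn_mk]
    constructor
    · rintro ⟨a, ha⟩
      refine ⟨π.symm a, List.map_injective_iff.2 π.injective ?_⟩
      rw [← pushLetter_map, Equiv.apply_symm_apply, ha]
    · rintro ⟨a, ha⟩
      exact ⟨π a, by rw [pushLetter_map, ha]⟩

theorem relabelIso_root (π : Equiv.Perm (Fin Δ)) :
    relabelIso (D := D) π treeRoot = treeRoot := rfl

theorem coe_relabelIso (π : Equiv.Perm (Fin Δ)) (u : TreeVertex Δ D) :
    (relabelIso π u).1 = u.1.map π := rfl

/-- If the directions of the ports around the root are permuted, then the neighborhood of the root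
stays the same. -/
theorem sameShape_relabel (π : Equiv.Perm (Fin Δ)) {t : ℕ}
    {ρ : TreeVertex Δ D → Equiv.Perm (Fin Δ)} (hρ : ∀ u, u.1.length ≤ t → ρ u = π) :
    (portTree (fun _ : TreeVertex Δ D => 1)).SameShape t (portTree ρ) treeRoot treeRoot := by
  have hlen : ∀ w : (portTree (fun _ : TreeVertex Δ D => 1)).Ball treeRoot t,
      w.1.1.length ≤ t := fun w => by
    have : w.1.1.length ≤ 0 + t := length_le_of_dist w.2
    omega
  have hdist : ∀ u, (wordTree Δ D).dist treeRoot (relabelIso π u) =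
      (wordTree Δ D).dist treeRoot u := by
    intro u
    have h1 : ∀ (σ : Equiv.Perm (Fin Δ)) (u : TreeVertex Δ D),
        (wordTree Δ D).dist treeRoot (relabelIso σ u) ≤ (wordTree Δ D).dist treeRoot u := by
      intro σ u
      obtain ⟨p, hp⟩ := wordTree_connected.exists_walk_length_eq_dist treeRoot u
      rw [← hp]
      have := SimpleGraph.dist_le (p.map (relabelIso σ).toHom)
      rwa [SimpleGraph.Walk.length_map] at this
    refine le_antisymm (h1 π u) ?_
    have := h1 π.symm (relabelIso π u)
    have he : relabelIso π.symm (relabelIso π u) = u := by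
      apply Subtype.ext
      simp [coe_relabelIso]
    rwa [he] at this
  refine ⟨(relabelIso π).toEquiv.subtypeEquiv fun u => ?_, ?_, ?_, ?_⟩
  · exact iff_of_eq (congrArg (· ≤ t) (hdist u).symm)
  · rintro w hw
    change relabelIso π w.1 = treeRoot
    rw [hw, relabelIso_root]
  · intro w i
    rw [portTree_other_eq_none, portTree_other_eq_none]
    have h1 := hlen w
    have h2 := length_pushLetter_le i w.1.1
    change _ ↔ D < (pushLetter (ρ (relabelIso π w.1) i) (w.1.1.map π)).length
    rw [hρ _ (by rw [coe_relabelIso, List.length_map]; exact h1), pushLetter_map, List.length_map]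
    rfl
  · intro w x i
    rw [portTree_other_eq_some, portTree_other_eq_some]
    change _ ↔ pushLetter (ρ (relabelIso π w.1) i) (w.1.1.map π) = x.1.1.map π
    rw [hρ _ (by rw [coe_relabelIso, List.length_map]; exact hlen w), pushLetter_map,
      (List.map_injective_iff.2 π.injective).eq_iff]
    rfl

/-! ### Counting vertices -/

/-- Every reduced word extends by at least `Δ - 1 ≥ 2` letters; `f` selects two letters that differ
from the current head. -/
theorem two_mul_card_treeVertex_le (hΔ : 3 ≤ Δ) (D : ℕ) :
    2 * Nat.card (TreeVertex Δ D) ≤ Nat.card (TreeVertex Δ (D + 1)) := by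
  have hex : ∀ o : Option (Fin Δ), ∃ f : Bool → Fin Δ, Function.Injective f ∧ ∀ b, o ≠ some (f b) := by
    intro o
    have h2 : 1 < (Finset.univ.filter (fun a => o ≠ some a)).card := by
      rcases o with _ | c
      · simp; omega
      · have : Finset.univ.filter (fun a => some c ≠ some a) = Finset.univ.erase c := by
          ext a
          simp [eq_comm]
        rw [this, Finset.card_erase_of_mem (Finset.mem_univ c), Finset.card_univ, Fintype.card_fin]
        omega
    obtain ⟨a, ha, b, hb, hab⟩ := Finset.one_lt_card.1 h2
    refine ⟨fun c => if c then a else b, ?_, ?_⟩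
    · intro x y hxy
      cases x <;> cases y <;> simp_all
    · intro c
      cases c
      · simpa using hb
      · simpa using ha
  choose f hf1 hf2 using hex
  have hinj : Function.Injective (fun p : Bool × TreeVertex Δ D =>
      (⟨f p.2.1.head? p.1 :: p.2.1,
        List.isChain_cons.2 ⟨fun y hy he => hf2 p.2.1.head? p.1 (he ▸ hy), p.2.2.1⟩,
        Nat.succ_le_succ p.2.2.2⟩ : TreeVertex Δ (D + 1))) := by
    rintro ⟨b, u⟩ ⟨b', u'⟩ h
    have h' := congrArg Subtype.val h
    simp only [List.cons.injEq] at h'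
    obtain ⟨h1, h2⟩ := h'
    obtain rfl : u = u' := Subtype.ext h2
    rw [hf1 _ h1]
  have := Nat.card_le_card_of_injective _ hinj
  rwa [Nat.card_prod, Nat.card_eq_fintype_card (α := Bool), Fintype.card_bool] at this

theorem two_pow_mul_card_treeVertex_le (hΔ : 3 ≤ Δ) (D k : ℕ) :
    2 ^ k * Nat.card (TreeVertex Δ D) ≤ Nat.card (TreeVertex Δ (D + k)) := by
  induction k with
  | zero => simp
  | succ k ih =>
    have := two_mul_card_treeVertex_le hΔ (D + k)
    rw [pow_succ, ← add_assoc]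
    nlinarith

theorem card_treeVertex_le (D : ℕ) : Nat.card (TreeVertex Δ D) ≤ (Δ + 1) ^ D := by
  have hinj : Function.Injective (fun (u : TreeVertex Δ D) (i : Fin D) => u.1[(i : ℕ)]?) := by
    intro u v h
    refine Subtype.ext (List.ext_getElem? fun i => ?_)
    by_cases hi : i < D
    · exact congrFun h ⟨i, hi⟩
    · have h1 := u.2.2
      have h2 := v.2.2
      rw [List.getElem?_eq_none (by omega), List.getElem?_eq_none (by omega)]
  have := Nat.card_le_card_of_injective _ hinj
  simpa using this

theorem card_treeVertex_pos (D : ℕ) : 0 < Nat.card (TreeVertex Δ D) :=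
  Nat.card_pos_iff.2 ⟨⟨treeRoot⟩, inferInstance⟩

end WordTree

/-! ### Local algorithms on a finite set of vertices -/

instance : IsProbabilityMeasure fairBits := by
  unfold fairBits
  infer_instance

theorem SimpleGraph.Hom.dist_le {V W : Type*} {G : SimpleGraph V} {H : SimpleGraph W} (f : G →g H)
    (hG : G.Connected) (u v : V) : H.dist (f u) (f v) ≤ G.dist u v := by
  obtain ⟨p, hp⟩ := hG.exists_walk_length_eq_dist u v
  rw [← hp, ← SimpleGraph.Walk.length_map f p]
  exact SimpleGraph.dist_le _

theorem measurePreserving_comp_symm {V W R : Type*} [Fintype V] [Fintype W] [MeasurableSpace R]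
    (ν : Measure R) [SigmaFinite ν] (e : V ≃ W) :
    MeasurePreserving (fun r : V → R => r ∘ e.symm) (Measure.pi fun _ => ν)
      (Measure.pi fun _ => ν) := by
  have h := measurePreserving_piCongrLeft (fun _ : W => ν) e
  convert h using 1
  funext r w
  obtain ⟨v, rfl⟩ := e.surjective w
  simp [MeasurableEquiv.coe_piCongrLeft, Equiv.piCongrLeft_apply]

/-- Replace the values of `r` on `B` by those of `s`. -/
noncomputable def resample {V R : Type*} (B : Set V) (r s : V → R) : V → R :=
  open Classical in fun v => if v ∈ B then s v else r v

theorem resample_of_mem {V R : Type*} {B : Set V} (r s : V → R) {v : V} (hv : v ∈ B) :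
    resample B r s v = s v := if_pos hv

theorem resample_of_notMem {V R : Type*} {B : Set V} (r s : V → R) {v : V} (hv : v ∉ B) :
    resample B r s v = r v := if_neg hv

/-- The preimage of a box is a product of two boxes, which constrain `r` outside `B` and `s` inside
`B`. -/
theorem measurePreserving_resample {V R : Type*} [Fintype V] [MeasurableSpace R]
    (ν : Measure R) [IsProbabilityMeasure ν] (B : Set V) :
    MeasurePreserving (fun p : (V → R) × (V → R) => resample B p.1 p.2)
      ((Measure.pi fun _ => ν).prod (Measure.pi fun _ => ν)) (Measure.pi fun _ => ν) := by
  classical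
  have hm : Measurable (fun p : (V → R) × (V → R) => resample B p.1 p.2) := by
    refine measurable_pi_lambda _ fun v => ?_
    by_cases hv : v ∈ B
    · simp only [resample_of_mem _ _ hv]
      fun_prop
    · simp only [resample_of_notMem _ _ hv]
      fun_prop
  refine ⟨hm, (Measure.pi_eq fun s hs => ?_).symm⟩
  rw [Measure.map_apply hm (MeasurableSet.univ_pi hs)]
  have : (fun p : (V → R) × (V → R) => resample B p.1 p.2) ⁻¹' (Set.univ.pi s) =
      (Set.univ.pi fun v => if v ∈ B then Set.univ else s v) ×ˢ
        (Set.univ.pi fun v => if v ∈ B then s v else Set.univ) := by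
    ext p
    simp only [Set.mem_preimage, Set.mem_pi, Set.mem_univ, true_imp_iff, Set.mem_prod]
    rw [← forall_and]
    refine forall_congr' fun v => ?_
    by_cases hv : v ∈ B
    · simp [resample_of_mem _ _ hv, hv]
    · simp [resample_of_notMem _ _ hv, hv]
  rw [this, Measure.prod_prod, Measure.pi_pi, Measure.pi_pi, ← Finset.prod_mul_distrib]
  refine Finset.prod_congr rfl fun v _ => ?_
  by_cases hv : v ∈ B <;> simp [hv]

/-- If the events `A` for `r` and `C` for the independent input `s` coincide whenever `r` and a
resampled input are good, then `A` and `C` are almost deterministic. -/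
theorem resample_coupling {V R : Type*} [Fintype V] [MeasurableSpace R]
    (ν : Measure R) [IsProbabilityMeasure ν] (B : Set V) {A C M N : Set (V → R)}
    (hA : MeasurableSet A) (hC : MeasurableSet C) (hM : MeasurableSet M) (hN : MeasurableSet N)
    (h : ∀ r s, r ∈ M → resample B r s ∈ N → (r ∈ A ↔ s ∈ C)) :
    (Measure.pi fun _ => ν).real A * (Measure.pi fun _ => ν).real Cᶜ +
      (Measure.pi fun _ => ν).real Aᶜ * (Measure.pi fun _ => ν).real C ≤
      (Measure.pi fun _ => ν).real Mᶜ + (Measure.pi fun _ => ν).real Nᶜ := by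
  set μ : Measure (V → R) := Measure.pi fun _ => ν
  have hres := measurePreserving_resample ν B
  have h1 : (μ.prod μ).real (Prod.fst ⁻¹' Mᶜ) = μ.real Mᶜ :=
    measurePreserving_fst.measureReal_preimage hM.compl.nullMeasurableSet
  have h2 : (μ.prod μ).real ((fun p => resample B p.1 p.2) ⁻¹' Nᶜ) = μ.real Nᶜ :=
    hres.measureReal_preimage hN.compl.nullMeasurableSet
  rw [← h1, ← h2, ← measureReal_prod_prod, ← measureReal_prod_prod,
    ← measureReal_union ?_ (hA.compl.prod hC)]
  -- The pairs on which `A` and `C` disagree form two disjoint rectangles, and they lie in the union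
  -- of the two bad events.
  · refine (measureReal_mono ?_).trans (measureReal_union_le _ _)
    rintro ⟨r, s⟩ hrs
    by_contra hc
    simp only [Set.mem_union, Set.mem_preimage, Set.mem_compl_iff, not_or, not_not] at hc
    have := h r s hc.1 hc.2
    rcases hrs with ⟨ha, hc'⟩ | ⟨ha, hc'⟩
    · exact hc' (this.1 ha)
    · exact ha (this.2 hc')
  · rw [Set.disjoint_left]
    rintro ⟨r, s⟩ ⟨ha, -⟩ ⟨ha', -⟩
    exact ha' ha

/-! ### Transport along bijections of the vertices -/

namespace RegTree

variable {Δ : ℕ} {V W : Type}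

/-- Transport of a finite regular tree along a bijection of the vertices. -/
def transport (e : V ≃ W) (T : RegTree Δ V) : RegTree Δ W where
  graph := T.graph.comap e.symm
  isTree := (SimpleGraph.Iso.comap e.symm T.graph).isTree_iff.2 T.isTree
  other w i := (T.other (e.symm w) i).map e
  adj_iff v w := by
    rw [SimpleGraph.comap_adj, T.adj_iff]
    refine exists_congr fun i => ?_
    rw [Option.map_eq_some_iff]
    constructor
    · intro h
      exact ⟨_, h, e.apply_symm_apply w⟩
    · rintro ⟨a, ha, rfl⟩
      rwa [e.symm_apply_apply]
  other_inj v w i j hi hj := by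
    obtain ⟨a, ha, rfl⟩ := Option.map_eq_some_iff.1 hi
    obtain ⟨b, hb, hab⟩ := Option.map_eq_some_iff.1 hj
    obtain rfl := e.injective hab
    exact T.other_inj _ _ i j ha hb

theorem transport_other_eq_some (e : V ≃ W) (T : RegTree Δ V) (v w : V) (i : Fin Δ) :
    (T.transport e).other (e v) i = some (e w) ↔ T.other v i = some w := by
  simp [transport]

theorem transport_dist (e : V ≃ W) (T : RegTree Δ V) (v w : V) :
    (T.transport e).graph.dist (e v) (e w) = T.graph.dist v w := by
  let f : (T.transport e).graph ≃g T.graph := SimpleGraph.Iso.comap e.symm T.graph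
  apply le_antisymm
  · have := f.symm.toHom.dist_le T.isTree.1 v w
    exact this
  · have := f.toHom.dist_le (T.transport e).isTree.1 (e v) (e w)
    have h1 : ∀ v, f.toHom (e v) = v := fun v => e.symm_apply_apply v
    rwa [h1, h1] at this

theorem SameView.transport {R : Type} (e : V ≃ W) {t : ℕ} {T₁ T₂ : RegTree Δ V} {r₁ r₂ : V → R}
    {v₁ v₂ : V} (h : SameView t T₁ r₁ v₁ T₂ r₂ v₂) :
    SameView t (T₁.transport e) (r₁ ∘ e.symm) (e v₁) (T₂.transport e) (r₂ ∘ e.symm) (e v₂) := by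
  obtain ⟨φ, h1, h2, h3, h4⟩ := h
  let f : ∀ (T : RegTree Δ V) (v : V), T.Ball v t ≃ (T.transport e).Ball (e v) t := fun T v =>
    e.subtypeEquiv fun w => iff_of_eq (congrArg (· ≤ t) (T.transport_dist e v w).symm)
  have hf : ∀ (T : RegTree Δ V) (v : V) (w : T.Ball v t), (f T v w : W) = e w := fun _ _ _ => rfl
  refine ⟨(f T₁ v₁).symm.trans (φ.trans (f T₂ v₂)), ?_, ?_, ?_, ?_⟩
  · intro w hw
    obtain ⟨w, rfl⟩ := (f T₁ v₁).surjective w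
    rw [hf] at hw
    simp only [Equiv.trans_apply, Equiv.symm_apply_apply, hf]
    rw [h1 w (e.injective hw)]
  · intro w
    obtain ⟨w, rfl⟩ := (f T₁ v₁).surjective w
    simp only [Equiv.trans_apply, Equiv.symm_apply_apply, hf, Function.comp_apply]
    exact h2 w
  · intro w i
    obtain ⟨w, rfl⟩ := (f T₁ v₁).surjective w
    simp only [Equiv.trans_apply, Equiv.symm_apply_apply, hf]
    simp only [RegTree.transport, Option.map_eq_none_iff, Equiv.symm_apply_apply]
    exact h3 w i
  · intro w x i
    obtain ⟨w, rfl⟩ := (f T₁ v₁).surjective w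
    obtain ⟨x, rfl⟩ := (f T₁ v₁).surjective x
    simp only [Equiv.trans_apply, Equiv.symm_apply_apply, hf]
    rw [transport_other_eq_some, transport_other_eq_some]
    exact h4 w x i

theorem isColoring_transport (e : V ≃ W) (T : RegTree Δ V) (P : LCL Δ) (c : W → Fin Δ → P.Label) :
    (T.transport e).IsColoring P c ↔ T.IsColoring P (fun v => c (e v)) := by
  refine and_congr ⟨fun h v => h (e v), fun h w => ?_⟩ ?_
  · obtain ⟨v, rfl⟩ := e.surjective w
    exact h v
  · constructor
    · intro h v w i j hi hj
      exact h (e v) (e w) i j ((transport_other_eq_some e T v w i).2 hi)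
        ((transport_other_eq_some e T w v j).2 hj)
    · intro h v w i j hi hj
      obtain ⟨v, rfl⟩ := e.surjective v
      obtain ⟨w, rfl⟩ := e.surjective w
      exact h v w i j ((transport_other_eq_some e T v w i).1 hi)
        ((transport_other_eq_some e T w v j).1 hj)

end RegTree

/-- A randomized local algorithm of complexity `t` that solves `P` on the trees with vertex set `V`. -/
structure LocalSolver {Δ : ℕ} (P : LCL Δ) (V : Type) [Fintype V] (t : ℕ) where
  out : RegTree Δ V → (V → RandomString) → V → Fin Δ → P.Label
  isLocal : ∀ {T₁ T₂ : RegTree Δ V} {r₁ r₂ : V → RandomString} {v₁ v₂ : V},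
    RegTree.SameView t T₁ r₁ v₁ T₂ r₂ v₂ → out T₁ r₁ v₁ = out T₂ r₂ v₂
  measurable_out : ∀ (T : RegTree Δ V) (v : V) (i : Fin Δ) (a : P.Label),
    MeasurableSet {r | out T r v i = a}
  success : ∀ T : RegTree Δ V, 1 - 1 / (Nat.card V : ℝ) ≤
    (Measure.pi (fun _ : V => fairBits)).real {r | T.IsColoring P (out T r)}

namespace LocalSolver

variable {Δ : ℕ} {P : LCL Δ} {V : Type} [Fintype V] {t : ℕ}

/-- This allows reduced words as vertices in place of `Fin n`. -/
theorem nonempty_of_mem_RLOCAL {τ : ℕ → ℕ} (h : P ∈ RLOCAL Δ τ) (V : Type) [Fintype V] :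
    Nonempty (LocalSolver P V (τ (Nat.card V))) := by
  obtain ⟨A, hA⟩ := h
  let e : V ≃ Fin (Nat.card V) := Finite.equivFin V
  have he := measurePreserving_comp_symm fairBits e
  refine ⟨⟨fun T r v => A.output _ (T.transport e) (r ∘ e.symm) (e v), fun {T₁ T₂ r₁ r₂ v₁ v₂} h =>
    A.isLocal _ _ _ _ _ _ _ (h.transport e), fun T v i a => ?_, fun T => ?_⟩⟩
  · exact he.measurable (A.measurable_output _ (T.transport e) (e v) i a)
  · refine (hA _ (T.transport e)).trans ?_
    have hmap := he.map_eq
    rw [← hmap]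
    refine le_of_eq_of_le (measureReal_def _ _) ?_
    have h1 : {r : V → RandomString | T.IsColoring P fun v =>
          A.output _ (T.transport e) (r ∘ e.symm) (e v)} =
        (fun r : V → RandomString => r ∘ e.symm) ⁻¹'
          {r | (T.transport e).IsColoring P (A.output _ (T.transport e) r)} := by
      ext r
      exact (RegTree.isColoring_transport e T P _).symm
    rw [h1, ← measureReal_def]
    have hemb : MeasurableEmbedding (fun r : V → RandomString => r ∘ e.symm) := by
      have := (MeasurableEquiv.piCongrLeft (fun _ => RandomString) e).measurableEmbedding
      convert this using 1
      funext r w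
      obtain ⟨v, rfl⟩ := e.surjective w
      simp [MeasurableEquiv.coe_piCongrLeft, Equiv.piCongrLeft_apply]
    rw [measureReal_def, measureReal_def, hemb.map_apply]

variable (S : LocalSolver P V t)

theorem measurableSet_out (T : RegTree Δ V) (C : Set (V → Fin Δ → P.Label)) :
    MeasurableSet {r | S.out T r ∈ C} := by
  have := P.finite_label
  have h1 : {r | S.out T r ∈ C} = ⋃ c ∈ C, ⋂ v, ⋂ i, {r | S.out T r v i = c v i} := by
    ext r
    simp only [Set.mem_ofPred_eq, Set.mem_iUnion, Set.mem_iInter, exists_prop]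
    constructor
    · intro h
      exact ⟨_, h, fun _ _ => rfl⟩
    · rintro ⟨c, hc, h⟩
      have : S.out T r = c := funext fun v => funext fun i => h v i
      rwa [this]
  rw [h1]
  exact MeasurableSet.biUnion (Set.to_countable C) fun c _ => MeasurableSet.iInter fun v =>
    MeasurableSet.iInter fun i => S.measurable_out T v i _

theorem measurableSet_out_vertex (T : RegTree Δ V) (v : V) (C : Set (Fin Δ → P.Label)) :
    MeasurableSet {r | S.out T r v ∈ C} :=
  S.measurableSet_out T {c | c v ∈ C}

theorem failure_le (T : RegTree Δ V) :
    (Measure.pi (fun _ : V => fairBits)).real {r | T.IsColoring P (S.out T r)}ᶜ ≤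
      1 / (Nat.card V : ℝ) := by
  have h := S.success T
  have hm : MeasurableSet {r | T.IsColoring P (S.out T r)} :=
    S.measurableSet_out T {c | T.IsColoring P c}
  rw [probReal_compl_eq_one_sub hm]
  linarith

/-- The distribution of the output at a vertex depends only on the shape of its neighborhood. -/
theorem measure_out_eq {T₁ T₂ : RegTree Δ V} {v₁ v₂ : V} (h : T₁.SameShape t T₂ v₁ v₂)
    (C : Set (Fin Δ → P.Label)) :
    (Measure.pi (fun _ : V => fairBits)).real {r | S.out T₁ r v₁ ∈ C} =
      (Measure.pi (fun _ : V => fairBits)).real {r | S.out T₂ r v₂ ∈ C} := by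
  classical
  obtain ⟨φ, h1, h2, h3⟩ := h
  -- The isomorphism of the balls is extended to a permutation of all vertices, because permuting
  -- the inputs preserves the product measure.
  let ψ : Equiv.Perm V := φ.extendSubtype
  have hψ := measurePreserving_comp_symm fairBits ψ.symm
  have hm := S.measurableSet_out_vertex T₁ v₁ C
  rw [← hψ.measureReal_preimage hm.nullMeasurableSet]
  congr 1
  ext r
  have : S.out T₁ (r ∘ ψ.symm.symm) v₁ = S.out T₂ r v₂ := by
    refine S.isLocal ⟨φ, h1, fun w => ?_, h2, h3⟩
    change r (ψ w) = _
    rw [φ.extendSubtype_apply_of_mem w.1 w.2]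
  simp only [Set.mem_preimage, Set.mem_ofPred_eq, this]

end LocalSolver

/-! ### Parity of the colorings of trees -/

section Parity

variable {Δ D : ℕ}

/-- The values of a labeling with prescribed sums on the edges in a ball are determined by its values
on the sphere. -/
theorem eq_of_eq_on_sphere {M : Type*} [AddCancelCommMonoid M] {d d' : TreeVertex Δ D → Fin Δ → M}
    {R : ℕ} (hR : R ≤ D) (hd : ∀ u v a, pushLetter a u.1 = v.1 → d u a = d v a)
    (hd' : ∀ u v a, pushLetter a u.1 = v.1 → d' u a = d' v a)
    (hsum : ∀ u : TreeVertex Δ D, u.1.length ≤ R → ∑ a, d u a = ∑ a, d' u a)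
    (h : ∀ u : TreeVertex Δ D, u.1.length = R → d u = d' u) :
    ∀ u : TreeVertex Δ D, u.1.length ≤ R → d u = d' u := by
  suffices H : ∀ (k : ℕ) (u : TreeVertex Δ D), u.1.length + k = R → d u = d' u from
    fun u hu => H (R - u.1.length) u (by omega)
  intro k
  induction k with
  | zero => exact fun u hu => h u hu
  | succ k ih =>
    intro u hu
    have hup : ∀ a, (pushLetter a u.1).length = u.1.length + 1 → d u a = d' u a := by
      intro a ha
      let v : TreeVertex Δ D := ⟨pushLetter a u.1, isChain_pushLetter a u.2.1, by omega⟩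
      have hv : v.1.length + k = R := by
        change (pushLetter a u.1).length + k = R
        omega
      rw [hd u v a rfl, hd' u v a rfl, ih v hv]
    by_cases hall : ∀ a, (pushLetter a u.1).length = u.1.length + 1
    · exact funext fun a => hup a (hall a)
    · push Not at hall
      obtain ⟨b, hb⟩ := hall
      -- Only the direction `b` leads towards the root. All others are settled by the induction from
      -- the sphere, and the equal sums then give `b` by cancellation.
      have hother : ∀ a, a ≠ b → d u a = d' u a := by
        intro a hab
        refine hup a ?_
        by_contra ha
        have h1 := length_pushLetter a u.1
        have h2 := length_pushLetter b u.1
        exact hab (pushLetter_injective ((pushLetter_eq_tail (a := a) (u := u.1) (by omega)).trans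
          (pushLetter_eq_tail (a := b) (by omega)).symm))
      have hs := hsum u (by omega)
      rw [← Finset.add_sum_erase _ _ (Finset.mem_univ b),
        ← Finset.add_sum_erase (a := b) _ (d' u) (Finset.mem_univ b),
        Finset.sum_congr rfl fun a ha => hother a (Finset.ne_of_mem_erase ha)] at hs
      funext a
      by_cases hab : a = b
      · subst hab
        exact add_right_cancel hs
      · exact hother a hab

/-- Whether a half-edge has the new label. -/
def lineBit : Option (HopLabel Δ) → ZMod 2
  | none => 1
  | some _ => 0

/-- The parity of the number of pairs of partners that use a half-edge. -/
def matchBit : Option (HopLabel Δ) → ZMod 2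
  | none => 0
  | some ⟨p, r⟩ => (match p with | .idle => 0 | _ => 1) + (if r = none then 0 else 1)

theorem lineBit_eq_one_iff {a : Option (HopLabel Δ)} : lineBit a = 1 ↔ a = none := by
  cases a <;> simp [lineBit]

theorem lineBit_eq_of_edge {a b : Option (HopLabel Δ)}
    (h : s(a, b) ∈ (hopMatching Δ).lineAugment.edgeConfigs) : lineBit a = lineBit b := by
  rcases (mem_lineAugment_edgeConfigs a b).1 h with ⟨a', b', rfl, rfl, -⟩ | ⟨rfl, rfl⟩ <;> rfl

/-- Both half-edges count the same pairs: an adjacent pair shows as a pointer on each side, and a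
far pair as a pointer on one side and a color on the other. -/
theorem matchBit_eq_of_edge {a b : Option (HopLabel Δ)}
    (h : s(a, b) ∈ (hopMatching Δ).lineAugment.edgeConfigs) : matchBit a = matchBit b := by
  rcases (mem_lineAugment_edgeConfigs a b).1 h with ⟨⟨p, r⟩, ⟨q, s⟩, rfl, rfl, hc⟩ | ⟨rfl, rfl⟩
  · obtain ⟨h1, h2, h3⟩ := hc
    cases p <;> cases q <;> simp_all [matchBit]
  · rfl

/-- Charges every odd edge to a pointer at one of its half-edges, for the final count. -/
theorem pointer_ne_idle_of_matchBit {a b : Option (HopLabel Δ)}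
    (h : s(a, b) ∈ (hopMatching Δ).lineAugment.edgeConfigs) (ha : matchBit a = 1) :
    (∃ l, a = some l ∧ l.pointer ≠ Pointer.idle) ∨ ∃ l, b = some l ∧ l.pointer ≠ Pointer.idle := by
  rcases (mem_lineAugment_edgeConfigs a b).1 h with ⟨⟨p, r⟩, ⟨q, s⟩, rfl, rfl, hc⟩ | ⟨rfl, rfl⟩
  · obtain ⟨h1, h2, h3⟩ := hc
    cases p <;> cases q <;> simp_all [matchBit]
  · simp [matchBit] at ha

theorem sum_lineBit {f : Fin Δ → Option (HopLabel Δ)}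
    (h : configOf f ∈ (hopMatching Δ).lineAugment.vertexConfigs) : ∑ i, lineBit (f i) = 0 := by
  classical
  rcases (mem_lineAugment_vertexConfigs f).1 h with ⟨g, hg, -⟩ | h2
  · exact Finset.sum_eq_zero fun i _ => by rw [hg]; rfl
  · have : ∀ i, lineBit (f i) = if f i = none then 1 else 0 := fun i => by
      cases f i <;> simp [lineBit]
    simp only [this, Finset.sum_boole, h2]
    rfl

theorem exists_ne_none (hΔ : 3 ≤ Δ) {f : Fin Δ → Option (HopLabel Δ)}
    (h : configOf f ∈ (hopMatching Δ).lineAugment.vertexConfigs) : ∃ i, f i ≠ none := by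
  classical
  by_contra! hf
  rcases (mem_lineAugment_vertexConfigs f).1 h with ⟨g, hg, -⟩ | h2
  · exact absurd ((hg ⟨0, by omega⟩).symm.trans (hf _)) (by simp)
  · rw [Finset.filter_true_of_mem fun i _ => hf i, Finset.card_univ, Fintype.card_fin] at h2
    omega

/-- Modulo 2 only the unique pointer contributes, since each color occurs zero or two times. -/
theorem exists_pointer_of_ne_none {f : Fin Δ → Option (HopLabel Δ)}
    (h : configOf f ∈ (hopMatching Δ).lineAugment.vertexConfigs) (hf : ∀ i, f i ≠ none) :
    ∃ g : Fin Δ → HopLabel Δ, (∀ i, f i = some (g i)) ∧ ∑ i, matchBit (some (g i)) = 1 ∧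
      ∀ i j, (g i).pointer ≠ Pointer.idle → (g j).pointer ≠ Pointer.idle → i = j := by
  classical
  rcases (mem_lineAugment_vertexConfigs f).1 h with ⟨g, hg, h1, h2⟩ | h2
  · refine ⟨g, hg, ?_, fun i j hi hj => ?_⟩
    · have hm : ∀ l : HopLabel Δ, matchBit (some l) =
          (if l.pointer ≠ Pointer.idle then 1 else 0) +
            ∑ c : Fin (Δ / 2), if l.relay = some c then 1 else 0 := by
        rintro ⟨p, r⟩
        cases p <;> cases r <;> simp [matchBit]
      simp only [hm, Finset.sum_add_distrib]
      rw [Finset.sum_comm]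
      simp only [Finset.sum_boole, h1]
      rw [Finset.sum_eq_zero]
      · simp
      · intro c _
        rcases h2 c with h | h <;> rw [h]
        · rfl
        · rfl
    · have := Finset.card_le_one.1 h1.le i (by simpa using hi) j (by simpa using hj)
      exact this
  · rw [Finset.filter_false_of_mem fun i _ => hf i] at h2
    simp at h2

/-- The permutation of the ports in a ball around the root. -/
noncomputable def ballPerm (t : ℕ) (π : Equiv.Perm (Fin Δ)) (u : TreeVertex Δ D) :
    Equiv.Perm (Fin Δ) := if u.1.length ≤ t then π else 1

variable {P : LCL Δ}

/-- If two colorings agree on a sphere, then an invariant with the same sums inside agrees at the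
root. -/
theorem eq_root_of_eq_on_sphere {M : Type*} [AddCancelCommMonoid M] (g : P.Label → M)
    (hg : ∀ a b, s(a, b) ∈ P.edgeConfigs → g a = g b) {t R : ℕ} (htR : t < R) (hR : R ≤ D)
    {π : Equiv.Perm (Fin Δ)} {c c' : TreeVertex Δ D → Fin Δ → P.Label}
    (hc : (portTree fun _ => 1).IsColoring P c) (hc' : (portTree (ballPerm t π)).IsColoring P c')
    (hsum : ∀ u, u.1.length ≤ R → ∑ i, g (c u i) = ∑ i, g (c' u i))
    (h : ∀ u, u.1.length = R → c u = c' u) :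
    ∀ u, u.1.length ≤ R → ∀ i, g (c u (ballPerm t π u i)) = g (c' u i) := by
  -- Labels are read by direction instead of by port. This turns colorings for different port
  -- numberings into labelings of the same edges.
  have key : ∀ (ρ : TreeVertex Δ D → Equiv.Perm (Fin Δ)) (c : TreeVertex Δ D → Fin Δ → P.Label),
      (portTree ρ).IsColoring P c → ∀ u v a, pushLetter a u.1 = v.1 →
        g (c u ((ρ u).symm a)) = g (c v ((ρ v).symm a)) := by
    intro ρ c hc u v a ha
    refine hg _ _ (hc.2 u v _ _ ?_ ?_)
    · rw [portTree_other_eq_some, Equiv.apply_symm_apply, ha]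
    · rw [portTree_other_eq_some, Equiv.apply_symm_apply, ← ha, pushLetter_pushLetter a u.2.1]
  have H := eq_of_eq_on_sphere (d := fun u a => g (c u a))
    (d' := fun u a => g (c' u ((ballPerm t π u).symm a))) hR (key _ _ hc) (key _ _ hc') ?_ ?_
  · intro u hu i
    have := congrFun (H u hu) (ballPerm t π u i)
    simpa using this
  · intro u hu
    rw [hsum u hu]
    exact (Equiv.sum_comp (ballPerm t π u).symm fun i => g (c' u i)).symm
  · intro u hu
    have : ballPerm t π u = 1 := if_neg (by omega)
    funext a
    rw [h u hu, this]
    rfl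

end Parity

/-! ### Local algorithms for the line-augmented matching problem -/

/-- If some `p i` is at least 1/2, the pair `i, j` bounds `1 - p j`. Otherwise the pair `j, j`
bounds `p j`. -/
theorem dichotomy_of_swap_bound {ι : Type*} {p : ι → ℝ} {δ : ℝ} (h0 : ∀ i, 0 ≤ p i)
    (h1 : ∀ i, p i ≤ 1) (h : ∀ i j, p i * (1 - p j) + (1 - p i) * p j ≤ δ) :
    (∀ i, p i ≤ 2 * δ) ∨ ∀ i, 1 - p i ≤ 2 * δ := by
  by_cases hc : ∃ i, 1 / 2 ≤ p i
  · obtain ⟨i, hi⟩ := hc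
    refine Or.inr fun j => ?_
    have := h i j
    nlinarith [mul_nonneg (sub_nonneg.2 hi) (sub_nonneg.2 (h1 j)),
      mul_nonneg (sub_nonneg.2 (h1 i)) (h0 j)]
  · push Not at hc
    refine Or.inl fun j => ?_
    have := h j j
    nlinarith [mul_nonneg (sub_nonneg.2 (hc j).le) (h0 j)]

namespace LocalSolver

open scoped Classical in
noncomputable instance {Δ D : ℕ} : Fintype (TreeVertex Δ D) := Fintype.ofFinite _

variable {Δ D t : ℕ}

section General

variable {P : LCL Δ} (S : LocalSolver P (TreeVertex Δ D) t)

/-- The output at a vertex depends only on the ports and the inputs in its neighborhood. -/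
theorem out_congr {ρ ρ' : TreeVertex Δ D → Equiv.Perm (Fin Δ)}
    {r r' : TreeVertex Δ D → RandomString} {u : TreeVertex Δ D}
    (h : ∀ w, (wordTree Δ D).dist u w ≤ t → ρ w = ρ' w ∧ r w = r' w) :
    S.out (portTree ρ) r u = S.out (portTree ρ') r' u := by
  refine S.isLocal ⟨Equiv.refl _, fun w hw => hw, fun w => (h w.1 w.2).2, fun w i => ?_,
    fun w x i => ?_⟩
  · rw [portTree_other_eq_none, portTree_other_eq_none, (h w.1 w.2).1]
    rfl
  · rw [portTree_other_eq_some, portTree_other_eq_some, (h w.1 w.2).1]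
    rfl

/-- The output on the tree in which all ports are named consistently. -/
noncomputable def std (r : TreeVertex Δ D → RandomString) : TreeVertex Δ D → Fin Δ → P.Label :=
  S.out (portTree fun _ => 1) r

/-- The probability of an event about the output on the standard tree. -/
noncomputable def prob (E : Set (TreeVertex Δ D → RandomString)) : ℝ :=
  (Measure.pi (fun _ : TreeVertex Δ D => fairBits)).real E

theorem prob_union_le (A B : Set (TreeVertex Δ D → RandomString)) :
    prob (A ∪ B) ≤ prob A + prob B := measureReal_union_le A B

theorem prob_mono {A B : Set (TreeVertex Δ D → RandomString)} (h : A ⊆ B) : prob A ≤ prob B :=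
  measureReal_mono h

theorem prob_nonneg (A : Set (TreeVertex Δ D → RandomString)) : 0 ≤ prob A := measureReal_nonneg

theorem prob_le_one (A : Set (TreeVertex Δ D → RandomString)) : prob A ≤ 1 := measureReal_le_one

theorem prob_compl {A : Set (TreeVertex Δ D → RandomString)} (h : MeasurableSet A) :
    prob Aᶜ = 1 - prob A := probReal_compl_eq_one_sub h

theorem exists_notMem_of_prob_lt_one {A : Set (TreeVertex Δ D → RandomString)} (h : prob A < 1) :
    ∃ r, r ∉ A := by
  by_contra! hc
  rw [Set.eq_univ_of_forall hc, prob, probReal_univ] at h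
  exact lt_irrefl _ h

theorem prob_iUnion_le {ι : Type*} [Fintype ι] (A : ι → Set (TreeVertex Δ D → RandomString)) :
    prob (⋃ i, A i) ≤ ∑ i, prob (A i) := measureReal_iUnion_fintype_le A

/-- The probability that the output on the half-edge `(u, j)` satisfies `q`. -/
noncomputable def labelProb (q : P.Label → Prop) (u : TreeVertex Δ D) (j : Fin Δ) : ℝ :=
  prob {r | q (S.std r u j)}

theorem measurableSet_label (q : P.Label → Prop) (u : TreeVertex Δ D) (j : Fin Δ) :
    MeasurableSet {r | q (S.std r u j)} :=
  S.measurableSet_out_vertex _ u {f | q (f j)}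

theorem labelProb_shift (q : P.Label → Prop) (a : Fin Δ) (u : TreeVertex Δ D)
    (h : u.1.length + t + 2 ≤ D) (j : Fin Δ) :
    S.labelProb q (shiftVertex a u (by omega)) j = S.labelProb q u j :=
  (S.measure_out_eq (sameShape_shift a u h) {f | q (f j)}).symm

/-- The letter next to the root is removed by left multiplication, one letter at a time; this keeps
directions and the view. -/
theorem labelProb_eq_root (q : P.Label → Prop) (u : TreeVertex Δ D) (h : u.1.length + t + 2 ≤ D)
    (j : Fin Δ) : S.labelProb q u j = S.labelProb q treeRoot j := by
  obtain ⟨u, hu⟩ := u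
  induction u using List.reverseRecOn with
  | nil => rfl
  | append_singleton u a ih =>
    have hlen : (u ++ [a]).length = u.length + 1 := by simp
    have hu' : u.IsChain (· ≠ ·) ∧ u.length ≤ D := ⟨hu.1.left_of_append, by omega⟩
    have h' := h
    simp only [hlen] at h'
    rw [← ih hu' (by simp only; omega), ← S.labelProb_shift q a ⟨u ++ [a], hu⟩ h j]
    congr 1
    exact Subtype.ext (shiftLetter_concat a u)

/-- The bound for two ports `j` and `k` that are exchanged around the root. -/
theorem labelProb_swap_bound (q : P.Label → Prop) {R : ℕ} (hR : 2 * t < R) (j k : Fin Δ)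
    {M : Set (TreeVertex Δ D → RandomString)} (hM : MeasurableSet M)
    (h : ∀ r ∈ M, ∀ c', (portTree (ballPerm t (Equiv.swap j k))).IsColoring P c' →
      (∀ u, u.1.length = R → S.std r u = c' u) → (q (S.std r treeRoot j) ↔ q (c' treeRoot k))) :
    S.labelProb q treeRoot j * (1 - S.labelProb q treeRoot k) +
      (1 - S.labelProb q treeRoot j) * S.labelProb q treeRoot k ≤
      prob Mᶜ + 1 / (Nat.card (TreeVertex Δ D) : ℝ) := by
  set T' : RegTree Δ (TreeVertex Δ D) := portTree (ballPerm t (Equiv.swap j k)) with hT'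
  have hC : MeasurableSet {r | q (S.out T' r treeRoot k)} :=
    S.measurableSet_out_vertex T' treeRoot {f | q (f k)}
  have hN : MeasurableSet {r | T'.IsColoring P (S.out T' r)} :=
    S.measurableSet_out T' {c | T'.IsColoring P c}
  have hcoup := resample_coupling fairBits {u : TreeVertex Δ D | u.1.length ≤ t}
    (S.measurableSet_label q treeRoot j) hC hM hN ?_
  -- To the root, the tree with permuted ports looks like the standard tree, because the whole view
  -- is permuted.
  · have hk : prob {r | q (S.out T' r treeRoot k)} = S.labelProb q treeRoot k :=
      (S.measure_out_eq (sameShape_relabel (ρ := ballPerm t (Equiv.swap j k)) (Equiv.swap j k)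
        fun u hu => if_pos hu) {f | q (f k)}).symm
    have hb := hcoup.trans (add_le_add_right (S.failure_le T') _)
    change prob _ * prob _ + prob _ * prob _ ≤ prob _ + _ at hb
    rw [prob_compl hC, prob_compl (S.measurableSet_label q treeRoot j), hk] at hb
    exact hb
  · intro r s hr hrs
    -- Since `R > 2 * t`, views from the sphere miss the ball where ports and bits were changed; the
    -- view of the root lies entirely in that ball and sees only `s`.
    have h1 := h r hr _ hrs fun u hu => S.out_congr fun w hw => ?_
    · rw [Set.mem_ofPred_eq, h1, Set.mem_ofPred_eq]
      have h2 : S.out T' (resample {u : TreeVertex Δ D | u.1.length ≤ t} r s) treeRoot = S.out T' s treeRoot := by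
        refine S.out_congr fun w hw => ⟨rfl, resample_of_mem _ _ ?_⟩
        have : w.1.length ≤ 0 + t := length_le_of_dist hw
        simpa using this
      rw [h2]
    · have h3 : ¬ w.1.length ≤ t := by
        rw [SimpleGraph.dist_comm] at hw
        have := length_le_of_dist hw
        omega
      exact ⟨(if_neg h3).symm, (resample_of_notMem (B := {u : TreeVertex Δ D | u.1.length ≤ t}) _ _ h3).symm⟩

end General
end LocalSolver

/-! ### Rarity of lines and the contradiction for matchings -/

namespace LocalSolver

variable {Δ D t : ℕ} (S : LocalSolver (hopMatching Δ).lineAugment (TreeVertex Δ D) t)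

/-- The set of inputs for which the algorithm succeeds on the standard tree. -/
def successSet : Set (TreeVertex Δ D → RandomString) :=
  {r | (portTree fun _ => 1).IsColoring (hopMatching Δ).lineAugment (S.std r)}

theorem measurableSet_successSet : MeasurableSet S.successSet :=
  S.measurableSet_out _ {c | (portTree fun _ => 1).IsColoring (hopMatching Δ).lineAugment c}

theorem prob_compl_successSet_le : prob S.successSetᶜ ≤ 1 / (Nat.card (TreeVertex Δ D) : ℝ) :=
  S.failure_le _

theorem lineBit_eq_root {R : ℕ} (htR : t < R) (hR : R ≤ D) {π : Equiv.Perm (Fin Δ)}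
    {c c' : TreeVertex Δ D → Fin Δ → Option (HopLabel Δ)}
    (hc : (portTree fun _ => 1).IsColoring (hopMatching Δ).lineAugment c)
    (hc' : (portTree (ballPerm t π)).IsColoring (hopMatching Δ).lineAugment c')
    (h : ∀ u, u.1.length = R → c u = c' u) (u : TreeVertex Δ D) (hu : u.1.length ≤ R) (i : Fin Δ) :
    c u (ballPerm t π u i) = none ↔ c' u i = none := by
  have := eq_root_of_eq_on_sphere (P := (hopMatching Δ).lineAugment) lineBit
    (fun a b hab => lineBit_eq_of_edge hab) htR hR hc hc'
    (fun u _ => (sum_lineBit (hc.1 u)).trans (sum_lineBit (hc'.1 u)).symm) h u hu i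
  rw [← lineBit_eq_one_iff, ← lineBit_eq_one_iff, this]

/-- The two failure probabilities give the swap bound `2 / n`, and the dichotomy doubles it. If the
new label were likely at every port, all `Δ ≥ 3` root half-edges would carry it at once; excluding
this needs `(1 + 4 * Δ) / n < 1`. -/
theorem labelProb_none_le (hΔ : 3 ≤ Δ) (hD : 2 * t + 1 ≤ D)
    (hn : 5 * (Δ : ℝ) < Nat.card (TreeVertex Δ D)) (j : Fin Δ) :
    S.labelProb (fun l => l = none) treeRoot j ≤ 4 / Nat.card (TreeVertex Δ D) := by
  set n : ℝ := (Nat.card (TreeVertex Δ D) : ℝ) with hndef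
  have hn0 : 0 < n := lt_of_le_of_lt (by positivity) hn
  have hswap : ∀ j k, S.labelProb (fun l => l = none) treeRoot j *
      (1 - S.labelProb (fun l => l = none) treeRoot k) +
      (1 - S.labelProb (fun l => l = none) treeRoot j) *
        S.labelProb (fun l => l = none) treeRoot k ≤ 2 / n := by
    intro j k
    refine (S.labelProb_swap_bound (R := 2 * t + 1) (fun l => l = none) (by omega) j k
      S.measurableSet_successSet ?_).trans ?_
    · intro r hr c' hc' h
      have := lineBit_eq_root (c := S.std r) (by omega) hD hr hc' h treeRoot (Nat.zero_le _) k
      have hp : ballPerm t (Equiv.swap j k) (treeRoot : TreeVertex Δ D) k = j :=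
        (congrArg (fun π : Equiv.Perm (Fin Δ) => π k) (if_pos (Nat.zero_le t))).trans
          (Equiv.swap_apply_right j k)
      rw [hp] at this
      exact this
    · have := S.prob_compl_successSet_le
      have h2 : (2 : ℝ) / n = 1 / n + 1 / n := by ring
      linarith
  rcases dichotomy_of_swap_bound (fun i => prob_nonneg _) (fun i => prob_le_one _) hswap with h | h
  · refine (h j).trans_eq (by ring)
  · exfalso
    have hbad : prob (S.successSetᶜ ∪ ⋃ i, {r | S.std r treeRoot i = none}ᶜ) < 1 := by
      refine (prob_union_le _ _).trans_lt ?_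
      have h1 : prob (⋃ i, {r | S.std r treeRoot i = none}ᶜ) ≤ Δ * (4 / n) := by
        refine (prob_iUnion_le _).trans ?_
        refine (Finset.sum_le_card_nsmul _ _ (4 / n) fun i _ => ?_).trans_eq (by simp)
        rw [prob_compl (S.measurableSet_label (fun l => l = none) treeRoot i)]
        exact (h i).trans_eq (by ring)
      have h2 := S.prob_compl_successSet_le
      have h3 : (1 : ℝ) / n + Δ * (4 / n) < 1 := by
        rw [← mul_div_assoc, ← add_div, div_lt_one hn0]
        have : (3 : ℝ) ≤ Δ := by exact_mod_cast hΔ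
        linarith
      linarith
    obtain ⟨r, hr⟩ := exists_notMem_of_prob_lt_one hbad
    simp only [Set.mem_union, Set.mem_compl_iff, Set.mem_iUnion, not_or, not_not, not_exists] at hr
    obtain ⟨hr1, hr2⟩ := hr
    obtain ⟨i, hi⟩ := exists_ne_none hΔ (hr1.1 treeRoot)
    exact hi (hr2 i)

/-- The set of inputs for which the algorithm succeeds without lines around the root. -/
def goodSet (R : ℕ) : Set (TreeVertex Δ D → RandomString) :=
  {r | r ∈ S.successSet ∧ ∀ u : TreeVertex Δ D, u.1.length ≤ R → ∀ j, S.std r u j ≠ none}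

theorem measurableSet_goodSet (R : ℕ) : MeasurableSet (S.goodSet R) :=
  S.measurableSet_out _ {c | (portTree fun _ => 1).IsColoring (hopMatching Δ).lineAugment c ∧
    ∀ u : TreeVertex Δ D, u.1.length ≤ R → ∀ j, c u j ≠ none}

/-- Union bound over all half-edges of the ball, whose vertices are deep enough to have the same
label probabilities as the root. -/
theorem prob_compl_goodSet_le (hΔ : 3 ≤ Δ) (hD : 2 * t + 1 ≤ D)
    (hn : 5 * (Δ : ℝ) < Nat.card (TreeVertex Δ D)) {R : ℕ} (hR : R + t + 2 ≤ D) :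
    prob (S.goodSet R)ᶜ ≤
      (1 + 4 * Δ * Nat.card (TreeVertex Δ R)) / Nat.card (TreeVertex Δ D) := by
  set n : ℝ := (Nat.card (TreeVertex Δ D) : ℝ) with hndef
  let e : TreeVertex Δ R → TreeVertex Δ D := fun u => ⟨u.1, u.2.1, by have := u.2.2; omega⟩
  have hsub : (S.goodSet R)ᶜ ⊆ S.successSetᶜ ∪
      ⋃ p : TreeVertex Δ R × Fin Δ, {r | S.std r (e p.1) p.2 = none} := by
    intro r hr
    by_cases hs : r ∈ S.successSet
    · right
      by_contra hc
      refine hr ⟨hs, fun u hu j hj => hc (Set.mem_iUnion.2 ⟨(⟨u.1, u.2.1, hu⟩, j), hj⟩)⟩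
    · exact Or.inl hs
  refine (prob_mono hsub).trans ((prob_union_le _ _).trans ?_)
  have h1 : prob (⋃ p : TreeVertex Δ R × Fin Δ, {r | S.std r (e p.1) p.2 = none}) ≤
      (Nat.card (TreeVertex Δ R) * Δ) * (4 / n) := by
    refine (prob_iUnion_le _).trans ?_
    refine (Finset.sum_le_card_nsmul _ _ (4 / n) fun p _ => ?_).trans_eq ?_
    · refine le_of_eq_of_le (S.labelProb_eq_root (fun l => l = none) (e p.1) ?_ p.2)
        (S.labelProb_none_le hΔ hD hn p.2)
      have := p.1.2.2
      change p.1.1.length + t + 2 ≤ D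
      omega
    · rw [Finset.card_univ, Fintype.card_prod, Fintype.card_fin, ← Nat.card_eq_fintype_card]
      simp
  have h2 := S.prob_compl_successSet_le
  calc _ ≤ 1 / n + (Nat.card (TreeVertex Δ R) * Δ) * (4 / n) := add_le_add h2 h1
    _ = _ := by ring

theorem exists_pointer_of_mem_goodSet {R : ℕ} {r : TreeVertex Δ D → RandomString}
    (hr : r ∈ S.goodSet R) (u : TreeVertex Δ D) (hu : u.1.length ≤ R) :
    ∃ g : Fin Δ → HopLabel Δ, (∀ i, S.std r u i = some (g i)) ∧ ∑ i, matchBit (some (g i)) = 1 ∧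
      ∀ i j, (g i).pointer ≠ Pointer.idle → (g j).pointer ≠ Pointer.idle → i = j :=
  exists_pointer_of_ne_none (hr.1.1 u) (hr.2 u hu)

/-- Agreement of the line bits carries the absence of lines over to `c'`, so in both colorings the
matching parities sum to 1 throughout the ball and the sphere determines them. -/
theorem matchBit_swap {R : ℕ} (htR : t < R) (hR : R ≤ D) {r : TreeVertex Δ D → RandomString}
    (hr : r ∈ S.goodSet R) (j k : Fin Δ) {c' : TreeVertex Δ D → Fin Δ → Option (HopLabel Δ)}
    (hc' : (portTree (ballPerm t (Equiv.swap j k))).IsColoring (hopMatching Δ).lineAugment c')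
    (h : ∀ u, u.1.length = R → S.std r u = c' u) :
    matchBit (S.std r treeRoot j) = matchBit (c' treeRoot k) := by
  have hnone := lineBit_eq_root (c := S.std r) htR hR hr.1 hc' h
  have := eq_root_of_eq_on_sphere (P := (hopMatching Δ).lineAugment) matchBit
    (fun a b hab => matchBit_eq_of_edge hab) htR hR hr.1 hc' ?_ h treeRoot (Nat.zero_le _) k
  · have hp : ballPerm t (Equiv.swap j k) (treeRoot : TreeVertex Δ D) k = j :=
      (congrArg (fun π : Equiv.Perm (Fin Δ) => π k) (if_pos (Nat.zero_le t))).trans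
        (Equiv.swap_apply_right j k)
    rwa [hp] at this
  · intro u hu
    obtain ⟨g, hg, h1, -⟩ := S.exists_pointer_of_mem_goodSet hr u hu
    obtain ⟨g', hg', h1', -⟩ := exists_pointer_of_ne_none (hc'.1 u) fun i hi =>
      hr.2 u hu _ ((hnone u hu i).2 hi)
    calc _ = ∑ i, matchBit (some (g i)) := Finset.sum_congr rfl fun i _ => by rw [hg]
      _ = ∑ i, matchBit (some (g' i)) := h1.trans h1'.symm
      _ = _ := Finset.sum_congr rfl fun i _ => by rw [← hg']

/-- The label points to the partner. -/
def IsPointing (l : Option (HopLabel Δ)) : Prop := ∃ a, l = some a ∧ a.pointer ≠ Pointer.idle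

/-- On the good set the root has a single pointer, so the events for different ports are disjoint;
each term exceeds its good part by at most the probability of the bad set. -/
theorem sum_labelProb_isPointing_le (R : ℕ) :
    ∑ j, S.labelProb IsPointing treeRoot j ≤ 1 + Δ * prob (S.goodSet R)ᶜ := by
  have h1 : ∀ j, S.labelProb IsPointing treeRoot j ≤
      prob ({r | IsPointing (S.std r treeRoot j)} ∩ S.goodSet R) + prob (S.goodSet R)ᶜ := by
    intro j
    refine (prob_mono fun r hr => ?_).trans (prob_union_le _ _)
    by_cases hg : r ∈ S.goodSet R
    · exact Or.inl ⟨hr, hg⟩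
    · exact Or.inr hg
  refine (Finset.sum_le_sum fun j _ => h1 j).trans ?_
  rw [Finset.sum_add_distrib]
  refine add_le_add ?_ (by simp)
  have hdisj : Pairwise (Function.onFun Disjoint
      fun j => {r | IsPointing (S.std r treeRoot j)} ∩ S.goodSet R) := by
    intro i j hij
    rw [Function.onFun, Set.disjoint_left]
    rintro r ⟨⟨a, ha, ha'⟩, hr⟩ ⟨⟨b, hb, hb'⟩, -⟩
    obtain ⟨g, hg, -, huniq⟩ := S.exists_pointer_of_mem_goodSet hr treeRoot (Nat.zero_le _)
    obtain rfl : g i = a := Option.some.inj ((hg i).symm.trans ha)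
    obtain rfl : g j = b := Option.some.inj ((hg j).symm.trans hb)
    exact hij (huniq i j ha' hb')
  have h2 := measureReal_iUnion_fintype (μ := Measure.pi fun _ : TreeVertex Δ D => fairBits) hdisj
    fun j => (S.measurableSet_label IsPointing treeRoot j).inter (S.measurableSet_goodSet R)
  exact h2.symm.trans_le (prob_le_one _)

/-- The other half-edge of the root edge in direction `j` is port `j` of the neighbor, which points
as often as port `j` of the root. The last term pays for failure. -/
theorem labelProb_matchBit_le (hD : t + 3 ≤ D) (j : Fin Δ) :
    S.labelProb (fun l => matchBit l = 1) treeRoot j ≤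
      2 * S.labelProb IsPointing treeRoot j + 1 / Nat.card (TreeVertex Δ D) := by
  let v : TreeVertex Δ D := ⟨[j], List.isChain_singleton _, by simp; omega⟩
  have hv : S.labelProb IsPointing v j = S.labelProb IsPointing treeRoot j :=
    S.labelProb_eq_root IsPointing v (by change 1 + t + 2 ≤ D; omega) j
  have hsub : {r | matchBit (S.std r treeRoot j) = 1} ⊆
      ({r | IsPointing (S.std r treeRoot j)} ∪ {r | IsPointing (S.std r v j)}) ∪
        S.successSetᶜ := by
    intro r hr
    by_cases hs : r ∈ S.successSet
    · left
      refine pointer_ne_idle_of_matchBit (hs.2 treeRoot v j j ?_ ?_) hr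
      · exact portTree_other_eq_some.2 rfl
      · refine portTree_other_eq_some.2 ?_
        exact pushLetter_of_tail j []
    · exact Or.inr hs
  have h1 := prob_mono hsub
  have h2 := prob_union_le ({r | IsPointing (S.std r treeRoot j)} ∪ {r | IsPointing (S.std r v j)})
    S.successSetᶜ
  have h3 := prob_union_le {r | IsPointing (S.std r treeRoot j)} {r | IsPointing (S.std r v j)}
  have h4 := S.prob_compl_successSet_le
  change _ ≤ S.labelProb IsPointing treeRoot j + S.labelProb IsPointing v j at h3
  rw [hv] at h3
  change prob _ ≤ _
  linarith

/-- There is no solver whose complexity is small in comparison with the depth of the tree. -/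
theorem not_local_of_large (S : LocalSolver (hopMatching Δ).lineAugment (TreeVertex Δ D) t)
    (hΔ : 3 ≤ Δ) (hD : 3 * t + 3 ≤ D)
    (hn : 35 * (Δ : ℝ) ^ 2 * Nat.card (TreeVertex Δ (2 * t + 1)) < Nat.card (TreeVertex Δ D)) :
    False := by
  set n : ℝ := (Nat.card (TreeVertex Δ D) : ℝ) with hndef
  set s : ℝ := (Nat.card (TreeVertex Δ (2 * t + 1)) : ℝ) with hsdef
  set ε : ℝ := (1 + 4 * Δ * s) / n with hε
  have hΔ' : (3 : ℝ) ≤ Δ := by exact_mod_cast hΔ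
  have hs : 1 ≤ s := by
    rw [hsdef]
    exact_mod_cast card_treeVertex_pos (Δ := Δ) (2 * t + 1)
  have hΔs : (3 : ℝ) ≤ Δ * s := by nlinarith
  have hn0 : 0 < n := lt_of_le_of_lt (by positivity) hn
  -- The 35 splits into 28, from the product, and 7, which absorbs the linear term.
  have hn' : 7 * Δ * (1 + 4 * Δ * s) < n := by nlinarith
  have h7 : 7 * Δ * ε < 1 := by
    rw [hε, ← mul_div_assoc, div_lt_one hn0]
    exact hn'
  have hn5 : 5 * (Δ : ℝ) < n := by nlinarith
  have hnε : 1 / n ≤ ε := by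
    rw [hε]
    gcongr
    linarith
  have hε0 : 0 < ε := by positivity
  have hgood : prob (S.goodSet (2 * t + 1))ᶜ ≤ ε :=
    S.prob_compl_goodSet_le hΔ (by omega) hn5 (by omega)
  have hswap : ∀ j k, S.labelProb (fun l => matchBit l = 1) treeRoot j *
      (1 - S.labelProb (fun l => matchBit l = 1) treeRoot k) +
      (1 - S.labelProb (fun l => matchBit l = 1) treeRoot j) *
        S.labelProb (fun l => matchBit l = 1) treeRoot k ≤ 2 * ε := by
    intro j k
    refine (S.labelProb_swap_bound (R := 2 * t + 1) (fun l => matchBit l = 1) (by omega) j k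
      (S.measurableSet_goodSet (2 * t + 1)) fun r hr c' hc' h => ?_).trans (by linarith)
    rw [S.matchBit_swap (by omega) (by omega) hr j k hc' h]
  rcases dichotomy_of_swap_bound (fun i => prob_nonneg _) (fun i => prob_le_one _) hswap with h | h
  -- Almost all edges at the root even: some good input makes all of them even, and their sum is 0
  -- instead of 1.
  · have hbad : prob ((S.goodSet (2 * t + 1))ᶜ ∪
        ⋃ i, {r | matchBit (S.std r treeRoot i) = 1}) < 1 := by
      refine (prob_union_le _ _).trans_lt ?_
      have h1 : prob (⋃ i, {r | matchBit (S.std r treeRoot i) = 1}) ≤ Δ * (2 * (2 * ε)) := by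
        refine (prob_iUnion_le _).trans ?_
        exact (Finset.sum_le_card_nsmul _ _ (2 * (2 * ε)) fun i _ => h i).trans_eq (by simp)
      nlinarith
    obtain ⟨r, hr⟩ := exists_notMem_of_prob_lt_one hbad
    simp only [Set.mem_union, Set.mem_compl_iff, Set.mem_iUnion, not_or, not_not, not_exists] at hr
    obtain ⟨g, hg, h1, -⟩ := S.exists_pointer_of_mem_goodSet hr.1 treeRoot (Nat.zero_le _)
    rw [Finset.sum_eq_zero] at h1
    · exact absurd h1 (by decide)
    · intro i _
      have h2 : matchBit (some (g i)) ≠ 1 := by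
        rw [← hg i]
        exact hr.2 i
      generalize matchBit (some (g i)) = x at h2
      revert x
      decide
  -- Almost all edges at the root odd: counting pointers gives `Δ * (1 - 4 * ε) ≤ 2 * (1 + Δ * ε) +
  -- Δ * ε`, so `Δ ≤ 2 + 7 * Δ * ε < 3`.
  · have h1 : (Δ : ℝ) * (1 - 2 * (2 * ε)) ≤ ∑ j, S.labelProb (fun l => matchBit l = 1) treeRoot j := by
      refine le_of_eq_of_le (by simp)
        (Finset.card_nsmul_le_sum Finset.univ _ (1 - 2 * (2 * ε)) fun j _ => ?_)
      exact sub_le_comm.1 (h j)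
    have h2 := Finset.sum_le_sum fun j (_ : j ∈ Finset.univ) =>
      S.labelProb_matchBit_le (by omega) j
    rw [Finset.sum_add_distrib, ← Finset.mul_sum] at h2
    have h3 := S.sum_labelProb_isPointing_le (2 * t + 1)
    have h4 : ∑ _j : Fin Δ, 1 / n = Δ * (1 / n) := by simp
    rw [h4] at h2
    have h5 : (Δ : ℝ) * (1 / n) ≤ Δ * ε := by gcongr
    have h6 : (Δ : ℝ) * prob (S.goodSet (2 * t + 1))ᶜ ≤ Δ * ε := by gcongr
    nlinarith

end LocalSolver

/-- The line-augmented matching problem needs logarithmic randomized local complexity. -/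
theorem hopMatching_lineAugment_notMem_RLOCALoLog {Δ : ℕ} (hΔ : 3 ≤ Δ) :
    (hopMatching Δ).lineAugment ∉ RLOCALoLog Δ := by
  rintro ⟨τ, hτ, hP⟩
  have hlog : 0 < Real.log (Δ + 1) := Real.log_pos (by
    have : (3 : ℝ) ≤ Δ := by exact_mod_cast hΔ
    linarith)
  have hn : ∀ D, 2 ^ D ≤ Nat.card (TreeVertex Δ D) := fun D => by
    have h1 := two_pow_mul_card_treeVertex_le hΔ 0 D
    rw [zero_add] at h1
    exact (Nat.le_mul_of_pos_right _ (card_treeVertex_pos 0)).trans h1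
  have hn_top : Tendsto (fun D => Nat.card (TreeVertex Δ D)) atTop atTop :=
    tendsto_atTop_mono hn (tendsto_pow_atTop_atTop_of_one_lt one_lt_two)
  -- As `log n ≤ D * log (Δ + 1)`, this constant yields `8 * t ≤ D`.
  have hsmall := hn_top.eventually (hτ.bound (c := 1 / (8 * Real.log (Δ + 1))) (by positivity))
  have hpow : ∀ᶠ m in atTop, 35 * Δ ^ 2 < 2 ^ m :=
    (tendsto_pow_atTop_atTop_of_one_lt (one_lt_two (α := ℕ))).eventually_gt_atTop _
  obtain ⟨m, hm⟩ := hpow.exists_forall_of_atTop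
  -- With `8 * t ≤ D` and `D ≥ 2 * m + 8`, at least `m` levels lie beyond radius `2 * t + 1`. The
  -- ball at least doubles on each level, which gives the factor `2 ^ m > 35 * Δ ^ 2`.
  obtain ⟨D, hD, hDm⟩ := (hsmall.and (eventually_ge_atTop (2 * m + 8))).exists
  set t := τ (Nat.card (TreeVertex Δ D)) with ht
  have htD : 8 * t ≤ D := by
    have h1 : Real.log (Nat.card (TreeVertex Δ D)) ≤ D * Real.log (Δ + 1) := by
      rw [← Real.log_pow]
      refine Real.log_le_log (by exact_mod_cast card_treeVertex_pos D) ?_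
      exact_mod_cast card_treeVertex_le D
    rw [Real.norm_natCast, Real.norm_of_nonneg (Real.log_natCast_nonneg _), div_mul_eq_mul_div,
      one_mul, le_div_iff₀ (by positivity)] at hD
    have h2 : (8 * t : ℝ) * Real.log (Δ + 1) ≤ D * Real.log (Δ + 1) := by linarith
    exact_mod_cast le_of_mul_le_mul_right h2 hlog
  obtain ⟨S⟩ := LocalSolver.nonempty_of_mem_RLOCAL hP (TreeVertex Δ D)
  refine S.not_local_of_large hΔ (by omega) ?_
  obtain ⟨k, hk⟩ : ∃ k, D = 2 * t + 1 + k := ⟨D - (2 * t + 1), by omega⟩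
  have h1 := two_pow_mul_card_treeVertex_le hΔ (2 * t + 1) k
  rw [← hk] at h1
  have h2 := Nat.mul_lt_mul_of_pos_right (hm k (by omega))
    (card_treeVertex_pos (Δ := Δ) (2 * t + 1))
  exact_mod_cast h2.trans_le h1

theorem mainTheorem9 (Δ : ℕ) (hΔ : 2 ≤ Δ) :
    (∀ (X : Type u) [MeasurableSpace X] [StandardBorelSpace X] (G : SimpleGraph X),
      IsRegularBorelForest Δ G →
        ∃ T : SimpleGraph X, IsBorelGraph T ∧ IsOneOrTwoEndedSpanningForest G T) ∧
    (hopMatching Δ).lineAugment ∈ BOREL.{u} Δ ∧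
    (3 ≤ Δ →
      (hopMatching Δ).lineAugment ∉ RLOCALoLog Δ ∧ ¬ BOREL.{u} Δ ⊆ RLOCALoLog Δ) :=
  ⟨fun _ _ _ _ hG => hG.exists_spanningForest hΔ, hopMatching_lineAugment_mem_BOREL hΔ,
    fun h => ⟨hopMatching_lineAugment_notMem_RLOCALoLog h, fun hsub =>
      hopMatching_lineAugment_notMem_RLOCALoLog h (hsub (hopMatching_lineAugment_mem_BOREL hΔ))⟩⟩
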